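/- Let $M\ge N\ge 1$ be integers with $M$ even, let $\tau\in(0,1)$, $\eta_+=\frac1{1-\tau^2}$, $\eta_-=\frac{\tau}{1-\tau^2}$, and let $\sigma_1,\dots,\sigma_N>\eta_- /\eta_+=\tau$ (not necessarily distinct). Square roots are principal and $\sqrt{z^2-1}:=\sqrt{z+1}\sqrt{z-1}$. A contour is a closed piecewise $C^1$ curve in $\mathbb C$; it "encircles" a point if its winding number about the point is $1$, and "does not encircle" a point if it avoids the point and has winding number $0$ about it. For $u,v\ge0$ put $$\mathcal E(u,v)=\int_{\mathbb R^2}\frac{x-y}{x+y}\,e^{-\frac12(x^2+y^2)}\Big(I_0(2x\sqrt u)I_0(2y\sqrt v)-I_0(2y\sqrt u)I_0(2x\sqrt v)\Big)\,dx\,dy,$$ with $I_0$ the modified Bessel function. Define the sub-kernels (of the Pfaffian correlation kernel $\begin{bmatrix}DS_N(u,v)&S_N(u,v)\\-S_N(v,u)&IS_N(u,v)\end{bmatrix}$ of the squared singular values of the spiked elliptic Ginibre ensemble) for $u,v>0$ by $$DS_N(u,v)=\frac{\eta_-^2}{4\pi}\oint\frac{dz}{2\pi i}\oint\frac{dw}{2\pi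 i}\,\frac{e^{-\eta_-v(z+1)}}{\sqrt{z^2-1}}\frac{e^{-\eta_-u(w+1)}}{\sqrt{w^2-1}}(zw)^{M-N}\frac{z-w}{1-zw}\prod_{k=1}^N\frac{\sigma_kz-\tau}{\tau z-\sigma_k}\frac{\sigma_kw-\tau}{\tau w-\sigma_k},$$ where both contours encircle $\sigma_1/\tau,\dots,\sigma_N/\tau$ and no other singularity of the integrand (that is, they do not encircle the points of $[-1,1]$, and neither of them encircles the inverse of a point of the other one), and $$S_N(u,v)=\int_0^\infty\mathcal E(\eta_-v,\eta_-t)\,DS_N(u,t)\,dt,$$ $$IS_N(u,v)=-\mathcal E(\eta_-u,\eta_-v)+\int_0^\infty\!\!\int_0^\infty\mathcal E(\eta_-v,\eta_-t)\,DS_N(s,t)\,\mathcal E(\eta_-u,\eta_-s)\,ds\,dt.$$ Let $M(a,b,\cdot)$ be Kummer's confluent hypergeometric function and $$g(z,v)=-zM(\tfrac12,1,2v)+(1-z^2)\int_0^ve^{(v-s)(z+1)}M(\tfrac12,1,2s)\,ds .$$ Then the integrals over $\mathbb R^2$, $(0,\infty)$ and $(0,\infty)^2$ in these definitions converge absolutely,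 and for all $u,v>0$, whichever admissible contours are used for $DS_N$, the following holds. (1) $$S_N(u,v)=\eta_-\oint_{\mathcal C_{\{\tau/\sigma_l\}}}\frac{dz}{2\pi i}\oint_{\mathcal C_{\{\sigma_l/\tau\}}}\frac{dw}{2\pi i}\,\frac{g(z,\eta_-v)}{1-z^2}\,\frac{e^{-\eta_-u(w+1)}}{\sqrt{w^2-1}}\Big(\frac wz\Big)^{M-N}\frac{1-zw}{w-z}\prod_{k=1}^N\frac{\tau z-\sigma_k}{\sigma_kz-\tau}\frac{\sigma_kw-\tau}{\tau w-\sigma_k}$$ for all contours such that the $z$-contour encircles all $\tau/\sigma_l$ and lies in $\{|z|<1,\ \Re z>0\}$, the $w$-contour encircles all $\sigma_l/\tau$ and lies in $\{|w|>1\}$, and neither encircles any other singularity of the integrand (for $z$: $0,\pm1$ and the points $w$ of the other contour; for $w$: $[-1,1]$ and the points $z$ of the other contour). (2) $$IS_N(u,v)=-\mathcal E(\eta_-u,\eta_-v)+4\pi\oint_{\mathcal C_{\{\tau/\sigma_l\}}}\frac{dz}{2\pi i}\oint_{\mathcal C_{\{\tau/\sigma_l\}}}\frac{dw}{2\pi i}\,\frac{g(z,\eta_-v)}{1-z^2}\frac{g(w,\eta_-u)}{1-w^2}\Big(\frac1{zw}\Big)^{M-N}\frac{z-w}{1-zw}\prod_{k=1}^N\frac{\tau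 z-\sigma_k}{\sigma_kz-\tau}\frac{\tau w-\sigma_k}{\sigma_kw-\tau}$$ for all contours that encircle all $\tau/\sigma_l$ but no other singularity of the integrand ($0$, $\pm1$, inverses of points of the other contour), and lie in $\{|z|<1,\ \Re z>0\}$. (3) If moreover $M=N$, then $$S_N(u,v)=\eta_-\oint_{\mathcal C_{\{\pm1,\tau/\sigma_l\}}}\frac{dz}{2\pi i}\oint_{\mathcal C_{\{\sigma_l/\tau\}}}\frac{dw}{2\pi i}\,\frac{g(z,\eta_-v)}{1-z^2}\,\frac{e^{-\eta_-u(w+1)}}{\sqrt{w^2-1}}\,\frac{1-zw}{w-z}\prod_{k=1}^N\frac{\tau z-\sigma_k}{\sigma_kz-\tau}\frac{\sigma_kw-\tau}{\tau w-\sigma_k}$$ for all disjoint contours lying in $\{|z|>1\}$ such that the $z$-contour encircles $\pm1$ and all $\tau/\sigma_l$ but no point of the $w$-contour, and the $w$-contour encircles all $\sigma_l/\tau$ but no point of $[-1,1]$ or of the $z$-contour; and $$IS_N(u,v)=4\pi\oint_{\mathcal C_{\{\pm1,\tau/\sigma_l\}}}\frac{dz}{2\pi i}\oint_{\mathcal C_{\{\pm1,\tau/\sigma_l\}}}\frac{dw}{2\pi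 i}\,\frac{g(z,\eta_-v)}{1-z^2}\frac{g(w,\eta_-u)}{1-w^2}\,\frac{z-w}{1-zw}\prod_{k=1}^N\frac{\tau z-\sigma_k}{\sigma_kz-\tau}\frac{\tau w-\sigma_k}{\sigma_kw-\tau}$$ for all contours that encircle $\pm1$ and all $\tau/\sigma_l$ and lie in $\{|z|>1\}$. -/

import Mathlib

open MeasureTheory Set

noncomputable section

namespace EllipticGinibre

/-! ### Contours and contour integrals -/

/-- A contour: a closed, piecewise continuously differentiable path in the complex plane. The path
is `C¹` (with one-sided derivatives at the endpoints) on every closed subinterval of `[0, 1]` whose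
interior avoids a suitable finite set of break points. -/
structure Contour where
  base : ℂ
  path : Path base base
  piecewise_contDiff : ∃ s : Finset ℝ, ∀ a b : ℝ, 0 ≤ a → a < b → b ≤ 1 →
    Disjoint (s : Set ℝ) (Ioo a b) → ContDiffOn ℝ 1 path.extend (Icc a b)

/-- The set of points of the contour. -/
def Contour.trace (γ : Contour) : Set ℂ := range γ.path

/-- The normalized contour integral `∫_γ f(z) dz / (2πi)`. -/
def Contour.integral (γ : Contour) (f : ℂ → ℂ) : ℂ :=
  (2 * Real.pi * Complex.I)⁻¹ *
    curveIntegral (𝕜 := ℂ) (fun z => f z • ContinuousLinearMap.id ℂ ℂ) γ.path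

/-- The winding number of the contour about a point `a` off the contour. -/
def Contour.index (γ : Contour) (a : ℂ) : ℂ := γ.integral fun z => (z - a)⁻¹

/-- The contour goes once, anticlockwise, around each point of `A`, and does not go around
any point of `B`. -/
structure Contour.Encircles (γ : Contour) (A B : Set ℂ) : Prop where
  inside : ∀ a ∈ A, a ∉ γ.trace ∧ γ.index a = 1
  outside : ∀ b ∈ B, b ∉ γ.trace ∧ γ.index b = 0

/-! ### Special functions -/

/-- The modified Bessel function `I₀`. -/
def besselI0 (x : ℝ) : ℝ := ∑' k : ℕ, (x / 2) ^ (2 * k) / (k.factorial : ℝ) ^ 2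

/-- Kummer's confluent hypergeometric function `M(a, b, z)`. -/
def kummerM (a b z : ℂ) : ℂ :=
  ∑' k : ℕ, (ascPochhammer ℂ k).eval a / (ascPochhammer ℂ k).eval b * z ^ k / (k.factorial : ℂ)

/-- `√(z² - 1)`, understood as the product `√(z + 1) √(z - 1)` of principal square roots. It is
holomorphic off the segment `[-1, 1]`. -/
def sqrtSqSubOne (z : ℂ) : ℂ := (z + 1) ^ (1 / 2 : ℂ) * (z - 1) ^ (1 / 2 : ℂ)

/-- `g(z, v) = -z M(1/2, 1, 2v) + (1 - z²) ∫₀^v e^{(v - s)(z + 1)} M(1/2, 1, 2s) ds`. -/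
def gFun (z : ℂ) (v : ℝ) : ℂ :=
  -z * kummerM (1 / 2) 1 (2 * v) +
    (1 - z ^ 2) * ∫ s in (0 : ℝ)..v, Complex.exp ((v - s) * (z + 1)) * kummerM (1 / 2) 1 (2 * s)

/-! ### The model -/

/-- `η₊ = 1 / (1 - τ²)`. -/
def etaPlus (τ : ℝ) : ℝ := 1 / (1 - τ ^ 2)

/-- `η₋ = τ / (1 - τ²)`. -/
def etaMinus (τ : ℝ) : ℝ := τ / (1 - τ ^ 2)

/-- The integrand of the skew weight `𝓔(u, v)`. -/
def weightIntegrand (u v : ℝ) (p : ℝ × ℝ) : ℝ :=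
  (p.1 - p.2) / (p.1 + p.2) * Real.exp (-(1 / 2) * (p.1 ^ 2 + p.2 ^ 2)) *
    (besselI0 (2 * p.1 * √u) * besselI0 (2 * p.2 * √v) -
      besselI0 (2 * p.2 * √u) * besselI0 (2 * p.1 * √v))

/-- The skew weight `𝓔(u, v)`, an integral over the plane. -/
def weightE (u v : ℝ) : ℝ := ∫ p : ℝ × ℝ, weightIntegrand u v p

/-- The segment `[-1, 1]`, off which `sqrtSqSubOne` is holomorphic. -/
def cut : Set ℂ := (fun x : ℝ => (x : ℂ)) '' Icc (-1) 1

/-- The points `σ_l / τ`. -/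
def outerPoles {N : ℕ} (τ : ℝ) (σ : Fin N → ℝ) : Set ℂ :=
  range fun l => (σ l : ℂ) / (τ : ℂ)

/-- The points `τ / σ_l`. -/
def innerPoles {N : ℕ} (τ : ℝ) (σ : Fin N → ℝ) : Set ℂ :=
  range fun l => (τ : ℂ) / (σ l : ℂ)

/-- The product `∏_k (σ_k z - τ) / (τ z - σ_k)`. -/
def sigmaProd {N : ℕ} (τ : ℝ) (σ : Fin N → ℝ) (z : ℂ) : ℂ :=
  ∏ k, ((σ k : ℂ) * z - τ) / ((τ : ℂ) * z - σ k)

/-- The product `∏_k (τ z - σ_k) / (σ_k z - τ)`. -/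
def sigmaProdInv {N : ℕ} (τ : ℝ) (σ : Fin N → ℝ) (z : ℂ) : ℂ :=
  ∏ k, ((τ : ℂ) * z - σ k) / ((σ k : ℂ) * z - τ)

/-! ### The sub-kernels -/

/-- The pairs of contours allowed in the definition of `DS_N`: both encircle the points `σ_l / τ`
and no other singularity of the integrand. -/
def DSContours {N : ℕ} (τ : ℝ) (σ : Fin N → ℝ) (Γz Γw : Contour) : Prop :=
  Γz.Encircles (outerPoles τ σ) (cut ∪ (fun w => w⁻¹) '' Γw.trace) ∧
  Γw.Encircles (outerPoles τ σ) (cut ∪ (fun z => z⁻¹) '' Γz.trace)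

/-- The sub-kernel `DS_N(u, v)`. -/
def kernelDS (M : ℕ) {N : ℕ} (τ : ℝ) (σ : Fin N → ℝ) (Γz Γw : Contour) (u v : ℝ) : ℂ :=
  (etaMinus τ : ℂ) ^ 2 / (4 * Real.pi) *
    Γz.integral fun z => Γw.integral fun w =>
      Complex.exp (-etaMinus τ * v * (z + 1)) / sqrtSqSubOne z *
      (Complex.exp (-etaMinus τ * u * (w + 1)) / sqrtSqSubOne w) *
      (z * w) ^ (M - N) * ((z - w) / (1 - z * w)) * (sigmaProd τ σ z * sigmaProd τ σ w)

/-- The integrand `𝓔(η₋ v, η₋ t) DS_N(u, t)` of `S_N(u, v)`. -/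
def kernelSIntegrand (M : ℕ) {N : ℕ} (τ : ℝ) (σ : Fin N → ℝ) (Γz Γw : Contour) (u v t : ℝ) : ℂ :=
  (weightE (etaMinus τ * v) (etaMinus τ * t) : ℂ) * kernelDS M τ σ Γz Γw u t

/-- The sub-kernel `S_N(u, v)`. -/
def kernelS (M : ℕ) {N : ℕ} (τ : ℝ) (σ : Fin N → ℝ) (Γz Γw : Contour) (u v : ℝ) : ℂ :=
  ∫ t in Ioi (0 : ℝ), kernelSIntegrand M τ σ Γz Γw u v t

/-- The integrand `𝓔(η₋ v, η₋ t) DS_N(s, t) 𝓔(η₋ u, η₋ s)` in `IS_N(u, v)`, with `p = (s, t)`. -/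
def kernelISIntegrand (M : ℕ) {N : ℕ} (τ : ℝ) (σ : Fin N → ℝ) (Γz Γw : Contour) (u v : ℝ)
    (p : ℝ × ℝ) : ℂ :=
  (weightE (etaMinus τ * v) (etaMinus τ * p.2) : ℂ) * kernelDS M τ σ Γz Γw p.1 p.2 *
    (weightE (etaMinus τ * u) (etaMinus τ * p.1) : ℂ)

/-- The sub-kernel `IS_N(u, v)`. -/
def kernelIS (M : ℕ) {N : ℕ} (τ : ℝ) (σ : Fin N → ℝ) (Γz Γw : Contour) (u v : ℝ) : ℂ :=
  -(weightE (etaMinus τ * u) (etaMinus τ * v) : ℂ) +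
    ∫ p in Ioi (0 : ℝ) ×ˢ Ioi (0 : ℝ), kernelISIntegrand M τ σ Γz Γw u v p

end EllipticGinibre

end

open EllipticGinibre

open MeasureTheory Set
open Filter Topology Metric

noncomputable section

namespace EllipticGinibre

/-! ### Contour integrals as integrals against an integrable density -/

namespace Contour

/-! The proof rests on two evaluations of the skew weight. Expanding the Bessel functions gives 𝓔(a,
b) = ∑ e_{jk} a^j b^k / (j! k!), with e_{jk} a moment of (x - y)/(x + y) against a Gaussian. The sum
of two neighbouring moments carries a factor x² + y², which only affects the radial integral; their
difference carries a factor x² - y², which removes the denominator and leaves products of Gaussian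
moments (`moment_add`, `moment_sub`). This yields e_{j+1,k+1} = e_{j,k+1} + e_{j+1,k} + 4π(μ_j
μ_{k+1} - μ_{j+1} μ_k).

The Taylor coefficients γ_k(z) of g(z, v) in v satisfy γ_{k+1} = (1 + z) γ_k + (affine in z). Since
(1 + z)(1 + z⁻¹) = (1 + z) + (1 + z⁻¹), the integrals 4π ∮ γ_k(z) γ_j(z⁻¹)/(1 - z²) around the
closed unit disc obey the same recursion (`eCoef_eq`). Hence 𝓔(a, b) = 4π ∮ g(z, b) g(z⁻¹, a)/(1 -
z²) (`weightE_eq`). Transforming this in b gives the second evaluation, ∫ 𝓔(a, b) e^{-(p+1)b} db =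
4π g(p⁻¹, a)/√(p² - 1) for Re p > 1 (`laplace_weightE`).

With the contours of DS_N on a circle in Re z > 1, Fubini reduces the integrals over s and t to
these Laplace transforms, and z ↦ z⁻¹ turns the result into (1) and (2) for that circle and its
inverse (`kernelS_circle`, `kernelIS_circle`).

Passing to arbitrary contours needs no homotopy. Dixon's form of Cauchy's formula and division with
remainder by ∏ (w - a_k) evaluate the inner integral by an expression in which the contour does not
occur, and the outer integral likewise (`exists_integral_kernel_eq`, `exists_integral_integral_eq`).
Coincident σ_k need no special care.

If M = N, then N is even, the product of the σ-factors is 1 at ±1, and g(1, v) = -g(-1, v). The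
residues at ±1 then cancel, so the contours may be enlarged. For IS_N the enlargement also crosses
zw = 1. The residue there is -g(z, η₋v) g(z⁻¹, η₋u)/(1 - z²), because the product at z times the
product at z⁻¹ is 1, and by `weightE_eq` it contributes exactly -𝓔(η₋u, η₋v). -/

/-- The parametrization of a contour, extended to the real line. -/
def pt (γ : Contour) (t : ℝ) : ℂ := γ.path.extend t

/-- The density of the contour integral with respect to the parameter. -/
def dens (γ : Contour) (t : ℝ) : ℂ := (2 * Real.pi * Complex.I)⁻¹ * deriv γ.path.extend t

/-- The length of a contour, divided by `2π`. -/
def mass (γ : Contour) : ℝ := ∫ t in Ioc (0 : ℝ) 1, ‖γ.dens t‖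

variable (γ : Contour)

lemma continuous_pt : Continuous γ.pt := γ.path.continuous_extend

lemma pt_mem (t : ℝ) : γ.pt t ∈ γ.trace := by
  have : γ.pt t ∈ range γ.path.extend := mem_range_self t
  rwa [Path.extend_range] at this

lemma isCompact_trace : IsCompact γ.trace := isCompact_range γ.path.continuous

lemma isClosed_trace : IsClosed γ.trace := γ.isCompact_trace.isClosed

lemma integral_eq (f : ℂ → ℂ) :
    γ.integral f = ∫ t in Ioc (0 : ℝ) 1, f (γ.pt t) * γ.dens t := by
  rw [Contour.integral, curveIntegral_eq_intervalIntegral_deriv,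
    intervalIntegral.integral_of_le zero_le_one, ← integral_const_mul]
  congr 1
  ext t
  simp [pt, dens]
  ring

lemma intervalIntegrable_deriv_of_disjoint {a b : ℝ} (hab : a ≤ b)
    (h : ContDiffOn ℝ 1 γ.path.extend (Icc a b)) :
    IntervalIntegrable (deriv γ.path.extend) volume a b := by
  rcases hab.eq_or_lt with rfl | hab
  · simp
  have h1 : ContinuousOn (derivWithin γ.path.extend (Icc a b)) (Icc a b) :=
    h.continuousOn_derivWithin (uniqueDiffOn_Icc hab) le_rfl
  have h2 := h1.intervalIntegrable_of_Icc hab.le (μ := volume)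
  refine h2.congr_ae ?_
  rw [uIoc_of_le hab.le, ← restrict_Ioo_eq_restrict_Ioc]
  filter_upwards [ae_restrict_mem measurableSet_Ioo] with x hx
  rw [derivWithin_of_mem_nhds (Icc_mem_nhds hx.1 hx.2)]

/-- Induction on the number of break points inside the interval: splitting at one of them leaves
strictly fewer in each half. -/
lemma intervalIntegrable_deriv_aux (s : Finset ℝ)
    (hs : ∀ a b : ℝ, 0 ≤ a → a < b → b ≤ 1 →
      Disjoint (s : Set ℝ) (Ioo a b) → ContDiffOn ℝ 1 γ.path.extend (Icc a b)) (n : ℕ) :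
    ∀ a b : ℝ, 0 ≤ a → a < b → b ≤ 1 → (s.filter (· ∈ Ioo a b)).card ≤ n →
      IntervalIntegrable (deriv γ.path.extend) volume a b := by
  classical
  induction n with
  | zero =>
    intro a b ha hab hb hn
    refine γ.intervalIntegrable_deriv_of_disjoint hab.le (hs a b ha hab hb ?_)
    rw [Set.disjoint_left]
    intro x hx hx'
    have : x ∈ s.filter (· ∈ Ioo a b) := Finset.mem_filter.2 ⟨hx, hx'⟩
    rw [Finset.card_eq_zero.1 (Nat.le_zero.1 hn)] at this
    simp at this
  | succ n ih =>
    intro a b ha hab hb hn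
    by_cases he : ∃ c ∈ s, c ∈ Ioo a b
    · obtain ⟨c, hc, hc'⟩ := he
      have key : ∀ a' b' : ℝ, a ≤ a' → b' ≤ b → c ∉ Ioo a' b' →
          (s.filter (· ∈ Ioo a' b')).card ≤ n := by
        intro a' b' h1 h2 h3
        have : s.filter (· ∈ Ioo a' b') ⊂ s.filter (· ∈ Ioo a b) := by
          rw [Finset.ssubset_iff_of_subset]
          · exact ⟨c, Finset.mem_filter.2 ⟨hc, hc'⟩, fun h => h3 (Finset.mem_filter.1 h).2⟩
          · intro x hx
            rw [Finset.mem_filter] at hx ⊢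
            exact ⟨hx.1, Ioo_subset_Ioo h1 h2 hx.2⟩
        have := Finset.card_lt_card this
        omega
      exact (ih a c ha hc'.1 (hc'.2.le.trans hb) (key a c le_rfl hc'.2.le (by simp))).trans
        (ih c b (ha.trans hc'.1.le) hc'.2 hb (key c b hc'.1.le le_rfl (by simp)))
    · push Not at he
      exact γ.intervalIntegrable_deriv_of_disjoint hab.le
        (hs a b ha hab hb (Set.disjoint_left.2 fun x hx hx' => he x hx hx'))

lemma intervalIntegrable_deriv : IntervalIntegrable (deriv γ.path.extend) volume 0 1 := by
  obtain ⟨s, hs⟩ := γ.piecewise_contDiff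
  exact γ.intervalIntegrable_deriv_aux s hs _ 0 1 le_rfl zero_lt_one le_rfl le_rfl

lemma integrable_dens : Integrable γ.dens (volume.restrict (Ioc (0 : ℝ) 1)) :=
  (((intervalIntegrable_iff_integrableOn_Ioc_of_le zero_le_one).1
    γ.intervalIntegrable_deriv).const_mul _ :)

lemma mass_nonneg : 0 ≤ γ.mass := integral_nonneg fun _ => norm_nonneg _

variable {γ} {f g : ℂ → ℂ}

lemma continuous_comp_pt (hf : ContinuousOn f γ.trace) : Continuous fun t => f (γ.pt t) :=
  hf.comp_continuous γ.continuous_pt γ.pt_mem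

lemma exists_bound (hf : ContinuousOn f γ.trace) : ∃ C, ∀ z ∈ γ.trace, ‖f z‖ ≤ C :=
  γ.isCompact_trace.exists_bound_of_continuousOn hf

lemma integrable_of_continuousOn (hf : ContinuousOn f γ.trace) :
    Integrable (fun t => f (γ.pt t) * γ.dens t) (volume.restrict (Ioc (0 : ℝ) 1)) := by
  obtain ⟨C, hC⟩ := exists_bound hf
  exact γ.integrable_dens.bdd_mul (c := C) (continuous_comp_pt hf).aestronglyMeasurable
    (ae_of_all _ fun t => hC _ (γ.pt_mem t))

lemma integral_congr (h : ∀ z ∈ γ.trace, f z = g z) : γ.integral f = γ.integral g := by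
  simp only [integral_eq]
  congr 1
  ext t
  rw [h _ (γ.pt_mem t)]

lemma integral_add (hf : ContinuousOn f γ.trace) (hg : ContinuousOn g γ.trace) :
    (γ.integral fun z => f z + g z) = γ.integral f + γ.integral g := by
  simp only [integral_eq, add_mul]
  exact MeasureTheory.integral_add (integrable_of_continuousOn hf) (integrable_of_continuousOn hg)

lemma integral_sub (hf : ContinuousOn f γ.trace) (hg : ContinuousOn g γ.trace) :
    (γ.integral fun z => f z - g z) = γ.integral f - γ.integral g := by
  simp only [integral_eq, sub_mul]
  exact MeasureTheory.integral_sub (integrable_of_continuousOn hf) (integrable_of_continuousOn hg)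

lemma integral_const_mul (c : ℂ) (f : ℂ → ℂ) :
    (γ.integral fun z => c * f z) = c * γ.integral f := by
  simp only [integral_eq, mul_assoc]
  exact MeasureTheory.integral_const_mul _ _

lemma integral_mul_const (c : ℂ) (f : ℂ → ℂ) :
    (γ.integral fun z => f z * c) = γ.integral f * c := by
  simp only [mul_comm _ c, integral_const_mul]

lemma integral_neg (f : ℂ → ℂ) : (γ.integral fun z => -f z) = -γ.integral f := by
  simpa using integral_const_mul (γ := γ) (-1) f

lemma norm_integral_le {C : ℝ} (h : ∀ z ∈ γ.trace, ‖f z‖ ≤ C) :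
    ‖γ.integral f‖ ≤ C * γ.mass := by
  rw [integral_eq, mass, ← MeasureTheory.integral_const_mul]
  refine norm_integral_le_of_norm_le (γ.integrable_dens.norm.const_mul C) (ae_of_all _ fun t => ?_)
  rw [norm_mul]
  exact mul_le_mul_of_nonneg_right (h _ (γ.pt_mem t)) (norm_nonneg _)

lemma countable_not_differentiableAt :
    ∃ s : Set ℝ, s.Countable ∧ ∀ t ∈ Ioo (0 : ℝ) 1 \ s, DifferentiableAt ℝ γ.path.extend t := by
  obtain ⟨s, hs⟩ := γ.piecewise_contDiff
  refine ⟨s, s.countable_toSet, fun t ht => ?_⟩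
  have : ((s : Set ℝ)ᶜ ∩ Ioo 0 1) ∈ 𝓝 t :=
    inter_mem (s.finite_toSet.isClosed.isOpen_compl.mem_nhds ht.2) (isOpen_Ioo.mem_nhds ht.1)
  obtain ⟨ε, hε, hb⟩ := Metric.mem_nhds_iff.1 this
  have hsub : Icc (t - ε / 2) (t + ε / 2) ⊆ (s : Set ℝ)ᶜ ∩ Ioo 0 1 := by
    refine Subset.trans ?_ hb
    rw [Real.ball_eq_Ioo]
    exact Icc_subset_Ioo (by linarith) (by linarith)
  have h := hs (t - ε / 2) (t + ε / 2) (hsub (left_mem_Icc.2 (by linarith))).2.1.le (by linarith)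
    (hsub (right_mem_Icc.2 (by linarith))).2.2.le
    (Set.disjoint_right.2 fun x hx => (hsub (Ioo_subset_Icc_self hx)).1)
  exact (h.differentiableOn one_ne_zero).differentiableAt
    (Icc_mem_nhds (by linarith) (by linarith))

/-- The integral of a function with a primitive around a closed contour is zero. -/
lemma integral_eq_zero_of_hasDerivAt {F : ℂ → ℂ} (hf : ContinuousOn f γ.trace)
    (hF : ∀ z ∈ γ.trace, HasDerivAt F (f z) z) : γ.integral f = 0 := by
  obtain ⟨s, hs, hd⟩ := γ.countable_not_differentiableAt
  have hFc : ContinuousOn F γ.trace := fun z hz => (hF z hz).continuousAt.continuousWithinAt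
  have hint : IntervalIntegrable (fun t => f (γ.pt t) * deriv γ.path.extend t) volume 0 1 :=
    γ.intervalIntegrable_deriv.continuousOn_mul (continuous_comp_pt hf).continuousOn
  have key := MeasureTheory.integral_eq_of_hasDerivAt_off_countable_of_le
    (fun t => F (γ.pt t)) (fun t => f (γ.pt t) * deriv γ.path.extend t) zero_le_one hs
    (continuous_comp_pt hFc).continuousOn
    (fun t ht => ((hF _ (γ.pt_mem t)).comp t (hd t ht).hasDerivAt)) hint
  rw [Contour.integral, curveIntegral_eq_intervalIntegral_deriv]
  have h01 : F (γ.pt 1) - F (γ.pt 0) = 0 := by simp [pt]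
  simp only [_root_.smul_apply, ContinuousLinearMap.id_apply, smul_eq_mul]
  change _ * (∫ t in (0:ℝ)..1, f (γ.pt t) * deriv γ.path.extend t) = 0
  rw [key, h01, mul_zero]

/-- A contour integral depends holomorphically on parameters. -/
lemma differentiableAt_integral {F : ℂ → ℂ → ℂ} {x₀ : ℂ} {r C : ℝ} (hr : 0 < r)
    (hc : ∀ x ∈ ball x₀ r, ContinuousOn (F x) γ.trace)
    (hd : ∀ w ∈ γ.trace, DifferentiableOn ℂ (fun x => F x w) (ball x₀ r))
    (hb : ∀ x ∈ ball x₀ r, ∀ w ∈ γ.trace, ‖F x w‖ ≤ C) :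
    DifferentiableAt ℂ (fun x => γ.integral (F x)) x₀ := by
  have hsub : ∀ x ∈ ball x₀ (r / 3), closedBall x (r / 3) ⊆ ball x₀ r := fun x hx y hy => by
    rw [mem_ball] at *
    rw [mem_closedBall] at hy
    linarith [dist_triangle y x x₀]
  have hd' : ∀ w ∈ γ.trace, ∀ x ∈ ball x₀ r,
      HasDerivAt (fun x => F x w) (deriv (fun x => F x w) x) x := fun w hw x hx =>
    ((hd w hw).differentiableAt (isOpen_ball.mem_nhds hx)).hasDerivAt
  -- The parameter derivative is measurable along the contour as a limit of difference quotients,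
  -- with increments `δ n` tending to 0 inside the ball.
  have hmeas : AEStronglyMeasurable (fun t => deriv (fun x => F x (γ.pt t)) x₀)
      (volume.restrict (Ioc (0 : ℝ) 1)) := by
    obtain ⟨δ, hδ0, hδ⟩ : ∃ δ : ℕ → ℂ, (∀ n, δ n ≠ 0 ∧ x₀ + δ n ∈ ball x₀ r) ∧
        Tendsto δ atTop (𝓝[≠] 0) := by
      have hlim : Tendsto (fun n : ℕ => (((r / 2) * (1 / ((n : ℝ) + 1)) : ℝ) : ℂ)) atTop (𝓝 0) := by
        have := (tendsto_one_div_add_atTop_nhds_zero_nat (𝕜 := ℝ)).const_mul (r / 2)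
        rw [mul_zero] at this
        exact (Complex.continuous_ofReal.tendsto 0).comp this
      have hpos : ∀ n : ℕ, 0 < (r / 2) * (1 / ((n : ℝ) + 1)) := fun n => by positivity
      have hne : ∀ n : ℕ, (((r / 2) * (1 / ((n : ℝ) + 1)) : ℝ) : ℂ) ≠ 0 := fun n =>
        Complex.ofReal_ne_zero.2 (hpos n).ne'
      refine ⟨_, fun n => ⟨hne n, ?_⟩, tendsto_nhdsWithin_iff.2 ⟨hlim, Eventually.of_forall hne⟩⟩
      rw [mem_ball, dist_eq_norm, add_sub_cancel_left, Complex.norm_real, Real.norm_eq_abs,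
        abs_of_pos (hpos n)]
      have : 1 / ((n : ℝ) + 1) ≤ 1 := by
        rw [div_le_one (by positivity)]; linarith [n.cast_nonneg (α := ℝ)]
      nlinarith
    refine aestronglyMeasurable_of_tendsto_ae atTop
      (f := fun n t => (δ n)⁻¹ • (F (x₀ + δ n) (γ.pt t) - F x₀ (γ.pt t))) (fun n => ?_) ?_
    · have := ((continuous_comp_pt (hc _ (hδ0 n).2)).sub
        (continuous_comp_pt (hc _ (mem_ball_self hr)))).const_smul (δ n)⁻¹
      exact this.aestronglyMeasurable
    · refine ae_of_all _ fun t => ?_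
      exact (hasDerivAt_iff_tendsto_slope_zero.1
        (hd' _ (γ.pt_mem t) x₀ (mem_ball_self hr))).comp hδ
  have hball : ball x₀ (r / 3) ∈ 𝓝 x₀ := ball_mem_nhds _ (by positivity)
  have hlt : ball x₀ (r / 3) ⊆ ball x₀ r := ball_subset_ball (by linarith)
  have := (hasDerivAt_integral_of_dominated_loc_of_deriv_le
    (μ := volume.restrict (Ioc (0 : ℝ) 1)) (x₀ := x₀) (s := ball x₀ (r / 3))
    (F := fun x t => F x (γ.pt t) * γ.dens t)
    (F' := fun x t => deriv (fun x => F x (γ.pt t)) x * γ.dens t)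
    (bound := fun t => C / (r / 3) * ‖γ.dens t‖) hball
    (eventually_of_mem hball fun x hx => (integrable_of_continuousOn (hc x (hlt hx))).1)
    (integrable_of_continuousOn (hc _ (mem_ball_self hr)))
    (hmeas.mul γ.integrable_dens.1)
    (ae_of_all _ fun t x hx => ?_) (γ.integrable_dens.norm.const_mul _)
    (ae_of_all _ fun t x hx => (hd' _ (γ.pt_mem t) x (hlt hx)).mul_const _)).2
  · simpa only [integral_eq] using this.differentiableAt
  · rw [norm_mul]
    refine mul_le_mul_of_nonneg_right ?_ (norm_nonneg _)
    -- Cauchy's estimate on the circle of radius `r / 3` about `x`, which stays in the ball where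
    -- `F` is bounded by `C`.
    refine Complex.norm_deriv_le_of_forall_mem_sphere_norm_le (by positivity) ?_ fun y hy =>
      hb y (hsub x hx (sphere_subset_closedBall hy)) _ (γ.pt_mem t)
    exact ((hd _ (γ.pt_mem t)).mono (hsub x hx)).diffContOnCl_ball subset_rfl

end Contour

end EllipticGinibre

end

open MeasureTheory Set
open Filter Topology Metric

noncomputable section

namespace EllipticGinibre

namespace Contour

variable {γ : Contour} {f : ℂ → ℂ}

/-! ### The index -/

lemma sub_ne_zero_of_notMem {x w : ℂ} (hx : x ∉ γ.trace) (hw : w ∈ γ.trace) : w - x ≠ 0 :=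
  sub_ne_zero.2 fun h => hx (h ▸ hw)

lemma continuousOn_inv_sub {x : ℂ} (hx : x ∉ γ.trace) :
    ContinuousOn (fun w => (w - x)⁻¹) γ.trace :=
  (continuousOn_id.sub continuousOn_const).inv₀ fun _ hw => sub_ne_zero_of_notMem hx hw

lemma continuousOn_div_sub (hf : ContinuousOn f γ.trace) {x : ℂ} (hx : x ∉ γ.trace) :
    ContinuousOn (fun w => f w / (w - x)) γ.trace :=
  hf.div (continuousOn_id.sub continuousOn_const) fun _ hw => sub_ne_zero_of_notMem hx hw

lemma one_sub_mem_slitPlane {z : ℂ} (hz : ‖z‖ < 1) : 1 - z ∈ Complex.slitPlane := by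
  simpa [sub_eq_add_neg] using Complex.mem_slitPlane_of_norm_lt_one (z := -z) (by simpa using hz)

/-- The index does not change when the point moves less than its distance to the contour. -/
lemma index_eq_of_norm_lt {x x₀ : ℂ} (h : ∀ w ∈ γ.trace, ‖x - x₀‖ < ‖w - x₀‖) :
    γ.index x = γ.index x₀ := by
  have h0 : x₀ ∉ γ.trace := fun h0 => by
    have := h _ h0
    simp only [sub_self, norm_zero] at this
    exact absurd this (not_lt.2 (norm_nonneg _))
  have hx : x ∉ γ.trace := fun hx => lt_irrefl _ (h _ hx)
  rw [← sub_eq_zero, index, index,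
    ← integral_sub (continuousOn_inv_sub hx) (continuousOn_inv_sub h0)]
  -- The integrand is the logarithmic derivative of (w - x)/(w - x₀), a quotient at distance less
  -- than 1 from 1, so the principal logarithm is a primitive.
  refine integral_eq_zero_of_hasDerivAt (F := fun w => Complex.log (1 - (x - x₀) / (w - x₀)))
    ((continuousOn_inv_sub hx).sub (continuousOn_inv_sub h0)) fun w hw => ?_
  have hw0 := sub_ne_zero_of_notMem h0 hw
  have hwx := sub_ne_zero_of_notMem hx hw
  have hlt : ‖(x - x₀) / (w - x₀)‖ < 1 := by
    rw [norm_div, div_lt_one (norm_pos_iff.2 hw0)]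
    exact h w hw
  have h1 : HasDerivAt (fun w => (x - x₀) / (w - x₀)) (-((x - x₀) / (w - x₀) ^ 2)) w := by
    have := (hasDerivAt_const w (x - x₀)).div ((hasDerivAt_id w).sub_const x₀) hw0
    refine this.congr_deriv ?_
    simp only [id]
    ring
  have h2 := (h1.const_sub 1).clog (one_sub_mem_slitPlane hlt)
  refine h2.congr_deriv ?_
  have h3 : 1 - (x - x₀) / (w - x₀) = (w - x) / (w - x₀) := by field_simp; ring
  rw [h3]
  field_simp
  ring

/-- The index about points outside a disc that contains the contour is zero. -/
lemma index_eq_zero_of_norm_lt {b c : ℂ} (h : ∀ w ∈ γ.trace, ‖w - c‖ < ‖b - c‖) :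
    γ.index b = 0 := by
  have hb : b ∉ γ.trace := fun hb => lt_irrefl _ (h _ hb)
  refine integral_eq_zero_of_hasDerivAt (F := fun w => Complex.log (1 - (w - c) / (b - c)))
    (continuousOn_inv_sub hb) fun w hw => ?_
  have hb0 : b - c ≠ 0 := norm_pos_iff.1 ((norm_nonneg _).trans_lt (h w hw))
  have hwb := sub_ne_zero_of_notMem hb hw
  have hlt : ‖(w - c) / (b - c)‖ < 1 := by
    rw [norm_div, div_lt_one (norm_pos_iff.2 hb0)]
    exact h w hw
  have h2 := ((((hasDerivAt_id w).sub_const c).div_const (b - c)).const_sub 1).clog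
    (one_sub_mem_slitPlane hlt)
  refine h2.congr_deriv ?_
  have h3 : 1 - (id w - c) / (b - c) = -(w - b) / (b - c) := by simp only [id]; field_simp; ring
  rw [h3]
  field_simp

lemma exists_norm_lt : ∃ R : ℝ, 0 < R ∧ ∀ w ∈ γ.trace, ‖w‖ < R := by
  obtain ⟨R, hR⟩ := γ.isCompact_trace.isBounded.exists_norm_le
  exact ⟨max R 0 + 1, by positivity, fun w hw => by
    linarith [hR w hw, le_max_left R 0]⟩

lemma integral_div_sub_const {x : ℂ} (c : ℂ) :
    (γ.integral fun w => c / (w - x)) = γ.index x * c := by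
  simp only [div_eq_mul_inv, integral_const_mul, index]
  ring

/-! ### Cauchy integrals -/

lemma exists_ball_disjoint {x₀ : ℂ} (hx : x₀ ∉ γ.trace) :
    ∃ r > 0, ∀ w ∈ γ.trace, 2 * r ≤ ‖w - x₀‖ := by
  obtain ⟨r, hr, h⟩ := Metric.isOpen_iff.1 γ.isClosed_trace.isOpen_compl x₀ hx
  refine ⟨r / 2, by positivity, fun w hw => ?_⟩
  by_contra hlt
  refine h (a := w) ?_ hw
  rw [mem_ball, dist_eq_norm]
  linarith

lemma differentiableAt_integral_div_sub (hf : ContinuousOn f γ.trace) {x₀ : ℂ}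
    (hx : x₀ ∉ γ.trace) :
    DifferentiableAt ℂ (fun x => γ.integral fun w => f w / (w - x)) x₀ := by
  obtain ⟨r, hr, hd⟩ := exists_ball_disjoint hx
  obtain ⟨C, hC⟩ := exists_bound hf
  have hge : ∀ x ∈ ball x₀ r, ∀ w ∈ γ.trace, r ≤ ‖w - x‖ := fun x hx w hw => by
    have h1 : ‖w - x₀‖ ≤ ‖w - x‖ + ‖x - x₀‖ := norm_sub_le_norm_sub_add_norm_sub _ _ _
    rw [mem_ball, dist_eq_norm] at hx
    linarith [hd w hw]
  refine differentiableAt_integral (r := r) (C := C / r) hr (fun x hx => ?_) (fun w hw => ?_)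
    (fun x hx w hw => ?_)
  · exact continuousOn_div_sub hf fun hx' => by
      have := hge x hx x hx'
      rw [sub_self, norm_zero] at this
      linarith
  · intro x hx
    have : w - x ≠ 0 := norm_pos_iff.1 (hr.trans_le (hge x hx w hw))
    exact (DifferentiableAt.div (by fun_prop) (by fun_prop) this).differentiableWithinAt
  · rw [norm_div]
    exact div_le_div₀ ((norm_nonneg _).trans (hC w hw)) (hC w hw) hr (hge x hx w hw)

lemma tendsto_integral_div_sub (hf : ContinuousOn f γ.trace) :
    Tendsto (fun x => γ.integral fun w => f w / (w - x)) (cocompact ℂ) (𝓝 0) := by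
  obtain ⟨C, hC⟩ := exists_bound hf
  obtain ⟨R, hR0, hR⟩ := γ.exists_norm_lt
  have hlim : Tendsto (fun x : ℂ => C / (‖x‖ - R) * γ.mass) (cocompact ℂ) (𝓝 0) := by
    have h1 : Tendsto (fun x : ℂ => ‖x‖ - R) (cocompact ℂ) atTop :=
      tendsto_atTop_add_const_right _ _ tendsto_norm_cocompact_atTop
    simpa using (h1.const_div_atTop C).mul_const γ.mass
  refine squeeze_zero_norm' ?_ hlim
  filter_upwards [tendsto_norm_cocompact_atTop.eventually_gt_atTop R] with x hx
  refine norm_integral_le fun w hw => ?_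
  rw [norm_div]
  refine div_le_div₀ ((norm_nonneg _).trans (hC w hw)) (hC w hw) (by linarith) ?_
  have := norm_sub_norm_le x w
  rw [norm_sub_rev] at this
  linarith [hR w hw]

lemma dslope_comm (f : ℂ → ℂ) (a b : ℂ) : dslope f a b = dslope f b a := by
  rcases eq_or_ne a b with rfl | h
  · rfl
  · rw [dslope_of_ne f h.symm, dslope_of_ne f h, slope_comm]

/-- As `dslope` is symmetric, for fixed w it is holomorphic in x with the singularity at x = w
removed. A bound uniform in w comes from the mean value inequality when w is near x₀, and from a
denominator of size at least r otherwise. -/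
lemma differentiableAt_integral_dslope {U : Set ℂ} (hU : IsOpen U) (hf : DifferentiableOn ℂ f U)
    (hγ : γ.trace ⊆ U) {x₀ : ℂ} (hx : x₀ ∈ U) :
    DifferentiableAt ℂ (fun x => γ.integral (dslope f x)) x₀ := by
  obtain ⟨R, hR, hRU⟩ := Metric.isOpen_iff.1 hU x₀ hx
  set r := R / 6 with hr
  have hr0 : 0 < r := by positivity
  have hcb : closedBall x₀ (3 * r) ⊆ U :=
    (closedBall_subset_ball (by linarith)).trans hRU
  have hbU : ball x₀ r ⊆ U := (ball_subset_ball (by linarith)).trans hRU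
  obtain ⟨M₁, hM₁⟩ := exists_bound (hf.continuousOn.mono hγ)
  obtain ⟨M₂, hM₂⟩ := (isCompact_closedBall x₀ (3 * r)).exists_bound_of_continuousOn
    (hf.continuousOn.mono hcb)
  obtain ⟨L, hL⟩ := (isCompact_closedBall x₀ (3 * r)).exists_bound_of_continuousOn
    ((hf.deriv hU).continuousOn.mono hcb)
  have hfd : ∀ x ∈ U, DifferentiableAt ℂ f x := fun x hx => hf.differentiableAt (hU.mem_nhds hx)
  refine differentiableAt_integral (r := r) (C := max L ((M₁ + M₂) / r)) hr0 (fun x hx => ?_)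
    (fun w hw => ?_) (fun x hx w hw => ?_)
  · exact ((continuousOn_dslope (hU.mem_nhds (hbU hx))).2
      ⟨hf.continuousOn, hfd x (hbU hx)⟩).mono hγ
  · simp only [dslope_comm f _ w]
    exact ((Complex.differentiableOn_dslope (hU.mem_nhds (hγ hw))).2 hf).mono hbU
  · have hx3 : x ∈ closedBall x₀ (3 * r) :=
      (ball_subset_closedBall.trans (closedBall_subset_closedBall (by linarith))) hx
    rcases eq_or_ne w x with rfl | hne
    · rw [dslope_same]
      exact (hL _ hx3).trans (le_max_left _ _)
    rw [dslope_of_ne f hne, slope_def_module, norm_smul, norm_inv]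
    have hpos : 0 < ‖w - x‖ := norm_pos_iff.2 (sub_ne_zero.2 hne)
    rw [inv_mul_le_iff₀ hpos]
    by_cases hw3 : w ∈ closedBall x₀ (3 * r)
    · rw [mul_comm]
      refine ((convex_closedBall x₀ (3 * r)).norm_image_sub_le_of_norm_deriv_le
        (fun y hy => hfd y (hcb hy)) hL hx3 hw3).trans ?_
      gcongr
      exact le_max_left _ _
    · have h1 : 3 * r < ‖w - x₀‖ := by simpa [dist_eq_norm] using hw3
      have h2 : ‖x - x₀‖ < r := by simpa [dist_eq_norm] using hx
      have h3 : ‖w - x₀‖ ≤ ‖w - x‖ + ‖x - x₀‖ := norm_sub_le_norm_sub_add_norm_sub _ _ _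
      have h4 : r ≤ ‖w - x‖ := by linarith
      have hM0 : 0 ≤ (M₁ + M₂) / r := div_nonneg
        (add_nonneg ((norm_nonneg _).trans (hM₁ w hw)) ((norm_nonneg _).trans (hM₂ x hx3))) hr0.le
      calc ‖f w - f x‖ ≤ M₁ + M₂ := (norm_sub_le _ _).trans (add_le_add (hM₁ w hw) (hM₂ x hx3))
        _ = r * ((M₁ + M₂) / r) := by field_simp
        _ ≤ ‖w - x‖ * max L ((M₁ + M₂) / r) :=
            mul_le_mul h4 (le_max_right _ _) hM0 hpos.le

lemma integral_dslope {U : Set ℂ} (hf : DifferentiableOn ℂ f U)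
    (hγ : γ.trace ⊆ U) {x : ℂ} (hx : x ∉ γ.trace) :
    γ.integral (dslope f x) = (γ.integral fun w => f w / (w - x)) - γ.index x * f x := by
  have hfc := hf.continuousOn.mono hγ
  rw [← integral_div_sub_const, ← integral_sub (continuousOn_div_sub hfc hx)
    (continuousOn_div_sub continuousOn_const hx)]
  refine integral_congr fun w hw => ?_
  have hne : w ≠ x := fun h => hx (h ▸ hw)
  rw [dslope_of_ne f hne, slope_def_module, smul_eq_mul, ← sub_div, div_eq_inv_mul]

/-- **Cauchy's integral formula**, in Dixon's form. The index is supposed to have the constant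
value `c` off the domain `U` of the function `f`, and `c f` to vanish at infinity. The case `c = 0`
is the usual formula, the case `c = 1` is the formula for the exterior. -/
theorem cauchy_formula {U : Set ℂ} (hU : IsOpen U) (hf : DifferentiableOn ℂ f U)
    (hγ : γ.trace ⊆ U) {c : ℂ} (hind : ∀ x ∉ U, γ.index x = c)
    (hlim : Tendsto (fun x => c * f x) (cocompact ℂ) (𝓝 0)) {x : ℂ} (hx : x ∉ γ.trace) :
    (x ∈ U → (γ.integral fun w => f w / (w - x)) = (γ.index x - c) * f x) ∧
    (γ.index x = c → (γ.integral fun w => f w / (w - x)) = 0) := by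
  classical
  have hfc := hf.continuousOn.mono hγ
  set Ψ : ℂ → ℂ := fun x => γ.integral fun w => f w / (w - x) with hΨ
  set H : ℂ → ℂ := fun x => if x ∈ U then γ.integral (dslope f x) + c * f x else Ψ x with hH
  have hHU : ∀ x ∉ γ.trace, x ∈ U → H x = Ψ x + (c - γ.index x) * f x := fun x hx hxU => by
    simp only [hH, if_pos hxU, integral_dslope hf hγ hx]
    ring
  have hHc : ∀ x ∉ γ.trace, γ.index x = c → H x = Ψ x := fun x hx hxc => by
    by_cases hxU : x ∈ U
    · rw [hHU x hx hxU, hxc, sub_self, zero_mul, add_zero]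
    · simp only [hH, if_neg hxU]
  have hdiff : Differentiable ℂ H := by
    intro x₀
    by_cases hxU : x₀ ∈ U
    · have : DifferentiableAt ℂ (fun x => γ.integral (dslope f x) + c * f x) x₀ :=
        (differentiableAt_integral_dslope hU hf hγ hxU).add
          ((hf.differentiableAt (hU.mem_nhds hxU)).const_mul c)
      refine this.congr_of_eventuallyEq ?_
      filter_upwards [hU.mem_nhds hxU] with x hx
      simp only [hH, if_pos hx]
    · have hx₀ : x₀ ∉ γ.trace := fun h => hxU (hγ h)
      obtain ⟨r, hr, hd⟩ := exists_ball_disjoint hx₀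
      refine (differentiableAt_integral_div_sub hfc hx₀).congr_of_eventuallyEq ?_
      filter_upwards [ball_mem_nhds x₀ hr] with x hx
      rw [mem_ball, dist_eq_norm] at hx
      refine hHc x (fun h => by linarith [hd x h]) ?_
      rw [index_eq_of_norm_lt fun w hw => by linarith [hd w hw], hind x₀ hxU]
  have hzero : Tendsto H (cocompact ℂ) (𝓝 0) := by
    obtain ⟨R, hR0, hR⟩ := γ.exists_norm_lt
    have hsum : Tendsto (fun x => ‖Ψ x‖ + ‖c * f x‖) (cocompact ℂ) (𝓝 0) := by
      simpa using (tendsto_integral_div_sub hfc).norm.add hlim.norm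
    refine squeeze_zero_norm' ?_ hsum
    filter_upwards [tendsto_norm_cocompact_atTop.eventually_ge_atTop R] with x hx
    have hxt : x ∉ γ.trace := fun h => absurd (hR x h) (not_lt.2 hx)
    have h0 : γ.index x = 0 := index_eq_zero_of_norm_lt (c := 0) fun w hw => by
      simpa using (hR w hw).trans_le hx
    by_cases hxU : x ∈ U
    · rw [hHU x hxt hxU, h0, sub_zero]
      exact norm_add_le _ _
    · rw [hHc x hxt (hind x hxU)]
      linarith [norm_nonneg (c * f x)]
  have hH0 : ∀ x, H x = 0 := fun x => hdiff.apply_eq_of_tendsto_cocompact x hzero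
  refine ⟨fun hxU => ?_, fun hxc => ?_⟩
  · have := hHU x hx hxU
    rw [hH0] at this
    linear_combination -this
  · exact (hHc x hx hxc).symm.trans (hH0 x)

end Contour

end EllipticGinibre

end

open MeasureTheory Set
open Filter Topology Metric

noncomputable section

namespace EllipticGinibre

/-! ### Division with remainder of holomorphic functions by polynomials -/

lemma tendsto_inv_sub_cocompact (a : ℂ) :
    Tendsto (fun x : ℂ => (x - a)⁻¹) (cocompact ℂ) (𝓝 0) := by
  refine tendsto_inv₀_cobounded.comp ?_
  rw [Metric.cobounded_eq_cocompact]
  exact (Homeomorph.subRight a).isClosedEmbedding.tendsto_cocompact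

/-- Newton interpolation: each further node divides the current quotient once more by means of
`dslope`, so repeated nodes are harmless. The decay at infinity is what Cauchy's formula for the
exterior requires of p/∏ (x - a k). -/
lemma exists_division {ι : Type*} (a : ι → ℂ) {U : Set ℂ} (hU : IsOpen U) {h : ℂ → ℂ}
    (hh : DifferentiableOn ℂ h U) (ha : ∀ k, a k ∈ U) (s : Finset ι) :
    ∃ (p : Polynomial ℂ) (r : ℂ → ℂ), p.degree < s.card ∧ DifferentiableOn ℂ r U ∧
      (∀ x ∈ U, h x = p.eval x + (∏ k ∈ s, (x - a k)) * r x) ∧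
      Tendsto (fun x => p.eval x / ∏ k ∈ s, (x - a k)) (cocompact ℂ) (𝓝 0) := by
  classical
  induction s using Finset.induction_on with
  | empty => exact ⟨0, h, by simp, hh, by simp, by simp⟩
  | insert i s hi ih =>
    obtain ⟨p, r, hp, hr, hpr, hlim⟩ := ih
    refine ⟨p + Polynomial.C (r (a i)) * ∏ k ∈ s, (Polynomial.X - Polynomial.C (a k)),
      dslope r (a i), ?_, (Complex.differentiableOn_dslope (hU.mem_nhds (ha i))).2 hr,
      fun x hx => ?_, ?_⟩
    · rw [Finset.card_insert_of_notMem hi]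
      have hc : (s.card : WithBot ℕ) < ((s.card + 1 : ℕ) : WithBot ℕ) := by
        exact_mod_cast Nat.lt_succ_self _
      refine (Polynomial.degree_add_le _ _).trans_lt (max_lt (hp.trans hc) ?_)
      refine lt_of_le_of_lt ?_ hc
      refine (Polynomial.degree_mul_le _ _).trans ?_
      rw [Polynomial.degree_prod]
      simp only [Polynomial.degree_X_sub_C, Finset.sum_const, nsmul_eq_mul, mul_one]
      calc _ ≤ (0 : WithBot ℕ) + s.card := by gcongr; exact Polynomial.degree_C_le
        _ = _ := zero_add _
    · have h1 := sub_smul_dslope r (a i) x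
      rw [hpr x hx, Finset.prod_insert hi]
      simp only [Polynomial.eval_add, Polynomial.eval_mul, Polynomial.eval_C,
        Polynomial.eval_prod, Polynomial.eval_sub, Polynomial.eval_X]
      rw [smul_eq_mul] at h1
      linear_combination (-∏ k ∈ s, (x - a k)) * h1
    · have h0 := ((hlim.add_const (r (a i))).mul (tendsto_inv_sub_cocompact (a i)))
      rw [mul_zero] at h0
      refine h0.congr' ?_
      have hfin : ((fun k => a k) '' (s : Set ι)).Finite := s.finite_toSet.image _
      filter_upwards [hfin.isCompact.compl_mem_cocompact] with x hx
      have hne : ∏ k ∈ s, (x - a k) ≠ 0 := Finset.prod_ne_zero_iff.2 fun k hk => by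
        intro h
        exact hx ⟨k, hk, (sub_eq_zero.1 h).symm⟩
      rw [Finset.prod_insert hi]
      simp only [Polynomial.eval_add, Polynomial.eval_mul, Polynomial.eval_C,
        Polynomial.eval_prod, Polynomial.eval_sub, Polynomial.eval_X]
      rw [mul_comm (x - a i), ← div_div, add_div, mul_div_assoc, div_self hne, mul_one,
        div_eq_mul_inv _ (x - a i)]

namespace Contour

/-- The contour integrals of `h / ((w - x) ∏ (w - a k))` around the points `a k`, evaluated by means
of division with remainder. The polynomial and the quotient do not depend on the contour. -/
theorem exists_residue_formula {ι : Type*} [Fintype ι] (a : ι → ℂ) {U : Set ℂ} (hU : IsOpen U)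
    {h : ℂ → ℂ} (hh : DifferentiableOn ℂ h U) (ha : ∀ k, a k ∈ U) :
    ∃ (p : Polynomial ℂ) (r : ℂ → ℂ), p.degree < Fintype.card ι ∧ DifferentiableOn ℂ r U ∧
      (∀ x ∈ U, h x = p.eval x + (∏ k, (x - a k)) * r x) ∧
      ∀ γ : Contour, γ.trace ⊆ U → (∀ k, a k ∉ γ.trace ∧ γ.index (a k) = 1) →
        (∀ x ∉ U, γ.index x = 0) → ∀ x ∉ γ.trace,
        (γ.index x = 0 → (γ.integral fun w => h w / ((∏ k, (w - a k)) * (w - x))) =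
          -(p.eval x / ∏ k, (x - a k))) ∧
        (x ∈ U → γ.index x = 1 →
          (γ.integral fun w => h w / ((∏ k, (w - a k)) * (w - x))) = r x) := by
  obtain ⟨p, r, hp, hr, hpr, hlim⟩ := exists_division a hU hh ha Finset.univ
  refine ⟨p, r, hp, hr, hpr, fun γ hγ hin hout x hx => ?_⟩
  have hD : ∀ y, y ∉ range a → ∏ k, (y - a k) ≠ 0 := fun y hy =>
    Finset.prod_ne_zero_iff.2 fun k _ h => hy ⟨k, (sub_eq_zero.1 h).symm⟩
  have htr : ∀ w ∈ γ.trace, w ∉ range a := by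
    rintro w hw ⟨k, rfl⟩
    exact (hin k).1 hw
  have hopen : IsOpen (range a)ᶜ := (finite_range a).isClosed.isOpen_compl
  have hf : DifferentiableOn ℂ (fun x => p.eval x / ∏ k, (x - a k)) (range a)ᶜ := fun y hy => by
    refine (DifferentiableAt.div p.differentiable.differentiableAt ?_
      (hD y hy)).differentiableWithinAt
    exact DifferentiableAt.fun_finsetProd fun k _ => by fun_prop
  have h1 := cauchy_formula hopen hf (fun w hw => htr w hw) (c := 1)
    (by simp only [mem_compl_iff, not_not]; rintro _ ⟨k, rfl⟩; exact (hin k).2)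
    (by simpa using hlim) hx
  have h2 := cauchy_formula hU hr hγ (c := 0) hout (by simp) hx
  have hsplit : (γ.integral fun w => h w / ((∏ k, (w - a k)) * (w - x))) =
      (γ.integral fun w => (p.eval w / ∏ k, (w - a k)) / (w - x)) +
        γ.integral fun w => r w / (w - x) := by
    rw [← integral_add (continuousOn_div_sub (hf.continuousOn.mono fun w hw => htr w hw) hx)
      (continuousOn_div_sub (hr.continuousOn.mono hγ) hx)]
    refine integral_congr fun w hw => ?_
    have := hD w (htr w hw)
    have := sub_ne_zero_of_notMem hx hw
    rw [hpr w (hγ hw)]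
    field_simp
  rw [hsplit]
  constructor
  · intro h0
    have hxa : x ∈ (range a)ᶜ := by
      rintro ⟨k, rfl⟩
      rw [(hin k).2] at h0
      exact one_ne_zero h0
    rw [h1.1 hxa, h2.2 h0, h0]
    ring
  · intro hxU h11
    rw [h1.2 h11, h2.1 hxU, h11]
    ring

/-! ### Circles -/

/-- The circle with centre `c` and radius `r`, as a contour. -/
def circle (c : ℂ) (r : ℝ) : Contour where
  base := circleMap c r 0
  path :=
    { toFun := fun t => circleMap c r (2 * Real.pi * t)
      continuous_toFun := by fun_prop
      source' := by simp
      target' := by simp [circleMap] }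
  piecewise_contDiff := by
    refine ⟨∅, fun a b ha hab hb _ => ?_⟩
    have h : ContDiff ℝ 1 fun t : ℝ => circleMap c r (2 * Real.pi * t) :=
      (contDiff_circleMap c r).comp (contDiff_const.mul contDiff_id)
    refine h.contDiffOn.congr fun t ht => ?_
    exact Path.extend_apply _ ⟨ha.trans ht.1, ht.2.trans hb⟩

lemma circle_pt (c : ℂ) (r : ℝ) {t : ℝ} (ht : t ∈ Icc (0 : ℝ) 1) :
    (circle c r).pt t = circleMap c r (2 * Real.pi * t) :=
  Path.extend_apply _ ht

lemma circle_integral (c : ℂ) (r : ℝ) (f : ℂ → ℂ) :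
    (circle c r).integral f = (2 * Real.pi * Complex.I)⁻¹ * ∮ z in C(c, r), f z := by
  rw [Contour.integral, curveIntegral_eq_intervalIntegral_deriv, circleIntegral]
  congr 1
  have h := intervalIntegral.smul_integral_comp_mul_left (a := 0) (b := 1)
    (fun θ => deriv (circleMap c r) θ • f (circleMap c r θ)) (2 * Real.pi)
  rw [mul_zero, mul_one] at h
  rw [← h, ← intervalIntegral.integral_smul]
  rw [intervalIntegral.integral_of_le zero_le_one, intervalIntegral.integral_of_le zero_le_one,
    ← restrict_Ioo_eq_restrict_Ioc]
  refine setIntegral_congr_fun measurableSet_Ioo fun t ht => ?_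
  have h1 : (circle c r).path.extend t = circleMap c r (2 * Real.pi * t) :=
    circle_pt c r (Ioo_subset_Icc_self ht)
  have h2 : deriv (circle c r).path.extend t =
      (2 * Real.pi : ℝ) • deriv (circleMap c r) (2 * Real.pi * t) := by
    have : (circle c r).path.extend =ᶠ[𝓝 t] fun t => circleMap c r (2 * Real.pi * t) := by
      filter_upwards [Icc_mem_nhds ht.1 ht.2] with s hs using circle_pt c r hs
    rw [this.deriv_eq]
    exact ((hasDerivAt_circleMap c r (2 * Real.pi * t)).scomp t
      (by simpa using (hasDerivAt_id t).const_mul (2 * Real.pi))).deriv.trans (by simp)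
  simp only [h1, h2]
  simp
  ring

lemma circle_trace (c : ℂ) {r : ℝ} (hr : 0 ≤ r) : (circle c r).trace ⊆ sphere c r := by
  rintro _ ⟨t, rfl⟩
  exact circleMap_mem_sphere c hr _

lemma circle_index_of_mem {c : ℂ} {r : ℝ} {x : ℂ} (hx : x ∈ ball c r) :
    (circle c r).index x = 1 := by
  rw [index, circle_integral, circleIntegral.integral_sub_inv_of_mem_ball hx]
  exact inv_mul_cancel₀ Complex.two_pi_I_ne_zero

lemma circle_index_of_notMem {c : ℂ} {r : ℝ} (hr : 0 ≤ r) {x : ℂ} (hx : x ∉ closedBall c r) :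
    (circle c r).index x = 0 := by
  refine index_eq_zero_of_norm_lt (c := c) fun w hw => ?_
  have h1 := circle_trace c hr hw
  rw [mem_sphere, dist_eq_norm] at h1
  rw [mem_closedBall, dist_eq_norm] at hx
  linarith

/-! ### Inversion -/

/-- The image of a contour under `z ↦ z⁻¹`. -/
def inv (γ : Contour) (h0 : (0 : ℂ) ∉ γ.trace) : Contour where
  base := γ.base⁻¹
  path :=
    { toFun := fun t => (γ.path t)⁻¹
      continuous_toFun := γ.path.continuous.inv₀ fun t ht => h0 ⟨t, ht⟩
      source' := by simp
      target' := by simp }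
  piecewise_contDiff := by
    obtain ⟨s, hs⟩ := γ.piecewise_contDiff
    refine ⟨s, fun a b ha hab hb hd => ?_⟩
    exact (hs a b ha hab hb hd).inv fun t _ ht => h0 (ht ▸ γ.pt_mem t)

variable {γ : Contour} (h0 : (0 : ℂ) ∉ γ.trace)

lemma inv_trace : (γ.inv h0).trace = (fun z => z⁻¹) '' γ.trace := by
  ext z
  simp only [trace, mem_range, mem_image, exists_exists_eq_and]
  rfl

lemma ne_zero_of_mem_trace (h0 : (0 : ℂ) ∉ γ.trace) {z : ℂ} (hz : z ∈ γ.trace) : z ≠ 0 :=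
  fun h => h0 (h ▸ hz)

lemma inv_integral (f : ℂ → ℂ) :
    (γ.inv h0).integral f = γ.integral fun z => -(f z⁻¹ / z ^ 2) := by
  obtain ⟨s, hs, hd⟩ := γ.countable_not_differentiableAt
  rw [integral_eq, integral_eq, ← restrict_Ioo_eq_restrict_Ioc]
  refine MeasureTheory.integral_congr_ae ?_
  have hsn : ∀ᵐ t ∂(volume.restrict (Ioo (0 : ℝ) 1)), t ∉ s :=
    ae_restrict_of_ae (hs.ae_notMem volume)
  filter_upwards [ae_restrict_mem measurableSet_Ioo, hsn] with t ht hts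
  have hpt : (γ.inv h0).pt = fun t => (γ.pt t)⁻¹ := rfl
  have hne : γ.pt t ≠ 0 := ne_zero_of_mem_trace h0 (γ.pt_mem t)
  have hder : deriv (γ.inv h0).path.extend t = -deriv γ.path.extend t / γ.pt t ^ 2 := by
    change deriv (fun t => (γ.pt t)⁻¹) t = _
    exact ((hd t ⟨ht, hts⟩).hasDerivAt.inv hne).deriv
  simp only [dens, hder, hpt]
  ring

/-- Under y = z⁻¹ the form dy/(y - b) becomes (1/(z - b⁻¹) - 1/z) dz when b ≠ 0; hence the
subtracted index of the origin. -/
lemma inv_index {b : ℂ} (hb : b ∉ (γ.inv h0).trace) :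
    (γ.inv h0).index b = if b = 0 then -γ.index 0 else γ.index b⁻¹ - γ.index 0 := by
  rw [index, inv_integral]
  split_ifs with hb0
  · subst hb0
    rw [index, ← integral_neg]
    refine integral_congr fun z hz => ?_
    have := ne_zero_of_mem_trace h0 hz
    field_simp
    simp
  · have hb' : b⁻¹ ∉ γ.trace := fun h => hb (by
      rw [inv_trace]
      exact ⟨b⁻¹, h, inv_inv b⟩)
    rw [index, index, ← integral_sub (continuousOn_inv_sub hb') (continuousOn_inv_sub h0)]
    refine integral_congr fun z hz => ?_
    have h1 := ne_zero_of_mem_trace h0 hz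
    have h2 := sub_ne_zero_of_notMem hb' hz
    have h3 : z⁻¹ - b ≠ 0 := fun h => h2 (by
      rw [sub_eq_zero] at h ⊢
      rw [← h, inv_inv])
    have h4 : z * b - 1 ≠ 0 := fun h => h3 (by
      field_simp
      linear_combination -h)
    have h5 : 1 - z * b ≠ 0 := fun h => h4 (by linear_combination -h)
    rw [sub_zero]
    field_simp
    ring

/-- **Cauchy's theorem** for contours that do not go around points off the domain. -/
theorem integral_eq_zero {U : Set ℂ} {f : ℂ → ℂ} (hU : IsOpen U) (hf : DifferentiableOn ℂ f U)
    (hγ : γ.trace ⊆ U) (hind : ∀ x ∉ U, γ.index x = 0) : γ.integral f = 0 := by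
  obtain ⟨R, hR0, hR⟩ := γ.exists_norm_lt
  have hx : (R : ℂ) ∉ γ.trace := fun h => by
    have := hR _ h
    rw [Complex.norm_real, Real.norm_of_nonneg hR0.le] at this
    exact lt_irrefl _ this
  -- The factor w - R cancels the denominator in Cauchy's formula at the point R off the contour and
  -- makes the value there 0.
  have hg : DifferentiableOn ℂ (fun w => (w - R) * f w) U := DifferentiableOn.mul (by fun_prop) hf
  have h := cauchy_formula hU hg hγ (c := 0) hind (by simp) hx
  have heq : γ.integral f = γ.integral fun w => (w - R) * f w / (w - R) :=
    integral_congr fun w hw => by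
      have := sub_ne_zero_of_notMem hx hw
      field_simp
  rw [heq]
  by_cases hxU : (R : ℂ) ∈ U
  · rw [h.1 hxU]
    simp
  · exact h.2 (hind _ hxU)

/-- Fubini's theorem for contour integrals. -/
lemma integral_swap {X : Type*} [MeasurableSpace X] {μ : Measure X} [SFinite μ] {F : X → ℂ → ℂ}
    {b : X → ℝ} (hm : AEStronglyMeasurable (fun p : X × ℝ => F p.1 (γ.pt p.2))
      (μ.prod (volume.restrict (Ioc (0 : ℝ) 1))))
    (hb : Integrable b μ) (hF : ∀ᵐ x ∂μ, ∀ z ∈ γ.trace, ‖F x z‖ ≤ b x) :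
    Integrable (fun x => γ.integral (F x)) μ ∧
      ∫ x, γ.integral (F x) ∂μ = γ.integral fun z => ∫ x, F x z ∂μ := by
  have hint : Integrable (fun p : X × ℝ => F p.1 (γ.pt p.2) * γ.dens p.2)
      (μ.prod (volume.restrict (Ioc (0 : ℝ) 1))) := by
    refine (hb.mul_prod γ.integrable_dens.norm).mono' (hm.mul γ.integrable_dens.1.comp_snd) ?_
    have : ∀ᵐ p ∂(μ.prod (volume.restrict (Ioc (0 : ℝ) 1))), ∀ z ∈ γ.trace, ‖F p.1 z‖ ≤ b p.1 :=
      Measure.quasiMeasurePreserving_fst.ae hF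
    filter_upwards [this] with p hp
    rw [norm_mul]
    exact mul_le_mul_of_nonneg_right (hp _ (γ.pt_mem _)) (norm_nonneg _)
  simp only [integral_eq]
  refine ⟨hint.integral_prod_left, ?_⟩
  rw [integral_integral_swap hint]
  congr 1
  ext t
  exact MeasureTheory.integral_mul_const _ _

end Contour

end EllipticGinibre

end

open MeasureTheory Set
open Filter Topology Metric

noncomputable section

namespace EllipticGinibre

/-! ### Series of integrable functions -/

lemma integrable_of_hasSum {α ι E : Type*} [MeasurableSpace α] {μ : Measure α} [Countable ι]
    [NormedAddCommGroup E] {F : ι → α → E} {f : α → E}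
    (hF : ∀ i, Integrable (F i) μ) (hs : Summable fun i => ∫ x, ‖F i x‖ ∂μ)
    (hf : ∀ᵐ x ∂μ, HasSum (fun i => F i x) (f x)) (hm : AEStronglyMeasurable f μ) :
    Integrable f μ := by
  refine ⟨hm, ?_⟩
  have h1 : ∫⁻ x, ‖f x‖ₑ ∂μ ≤ ∫⁻ x, ∑' i, ‖F i x‖ₑ ∂μ := by
    refine lintegral_mono_ae ?_
    filter_upwards [hf] with x hx
    rw [← hx.tsum_eq]
    exact enorm_tsum_le_tsum_enorm
  rw [lintegral_tsum fun i => (hF i).1.enorm] at h1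
  refine h1.trans_lt ?_
  have h2 : ∀ i, ∫⁻ x, ‖F i x‖ₑ ∂μ = ENNReal.ofReal (∫ x, ‖F i x‖ ∂μ) := fun i => by
    rw [ofReal_integral_norm_eq_lintegral_enorm (hF i)]
  simp only [h2]
  exact (hs.tsum_ofReal_lt_top)

/-! ### Gaussian moments -/

/-- The coefficients of `M(1/2, 1, 2s) = ∑ μ_k s^k / k!`. -/
def mu (k : ℕ) : ℝ := k.centralBinom / 2 ^ k

lemma mu_zero : mu 0 = 1 := by simp [mu]

lemma mu_succ (k : ℕ) : (k + 1) * mu (k + 1) = (2 * k + 1) * mu k := by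
  have h : ((k + 1 : ℕ) : ℝ) * ((k + 1).centralBinom : ℝ) =
      2 * (2 * k + 1) * (k.centralBinom : ℝ) := by
    exact_mod_cast Nat.succ_mul_centralBinom_succ k
  simp only [mu, pow_succ]
  push_cast at h
  field_simp
  linarith

lemma mu_nonneg (k : ℕ) : 0 ≤ mu k := by unfold mu; positivity

lemma mu_le (k : ℕ) : mu k ≤ 2 ^ k := by
  induction k with
  | zero => simp [mu_zero]
  | succ k ih =>
    have h := mu_succ k
    have h1 : (0 : ℝ) < k + 1 := by positivity
    rw [← mul_le_mul_iff_of_pos_left h1, h, pow_succ]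
    nlinarith [mu_nonneg k]

/-- The moments `∫ x^n e^{-x²/2} dx`. -/
def gaussMoment (n : ℕ) : ℝ := ∫ x : ℝ, x ^ n * Real.exp (-(1 / 2) * x ^ 2)

lemma gaussMoment_odd (j : ℕ) : gaussMoment (2 * j + 1) = 0 := by
  have h := integral_neg_eq_self (fun x : ℝ => x ^ (2 * j + 1) * Real.exp (-(1 / 2) * x ^ 2)) volume
  have h2 : ∀ x : ℝ, (-x) ^ (2 * j + 1) * Real.exp (-(1 / 2) * (-x) ^ 2) =
      -(x ^ (2 * j + 1) * Real.exp (-(1 / 2) * x ^ 2)) := fun x => by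
    rw [Odd.neg_pow ⟨j, rfl⟩, neg_sq, neg_mul]
  simp only [h2, integral_neg] at h
  rw [gaussMoment]
  linarith

/-- The even moments are √(2π) (2j - 1)!!, and (2j - 1)!! = j! μ_j. The induction step is Γ(x + 1) =
x Γ(x) combined with `mu_succ`. -/
lemma gaussMoment_even (j : ℕ) :
    gaussMoment (2 * j) = Real.sqrt (2 * Real.pi) * (j.factorial * mu j) := by
  have h1 : ∀ j : ℕ, gaussMoment (2 * j) =
      2 * ((1 / 2 : ℝ) ^ (-((2 * j : ℝ) + 1) / 2) * (1 / 2) * Real.Gamma (j + 1 / 2)) := by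
    intro j
    have h := integral_rpow_mul_exp_neg_mul_rpow (p := 2) (q := 2 * j) (b := 1 / 2) (by norm_num)
      (by linarith [j.cast_nonneg (α := ℝ)]) (by norm_num)
    have h2 : ((2 * j : ℝ) + 1) / 2 = j + 1 / 2 := by ring
    rw [h2] at h
    rw [← h, gaussMoment]
    have habs : ∀ x : ℝ, x ^ (2 * j) * Real.exp (-(1 / 2) * x ^ 2) =
        (fun y : ℝ => y ^ (2 * j) * Real.exp (-(1 / 2) * y ^ 2)) |x| := fun x => by
      simp only [sq_abs, pow_mul]
    rw [show (fun x : ℝ => x ^ (2 * j) * Real.exp (-(1 / 2) * x ^ 2)) = _ from funext habs,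
      integral_comp_abs (f := fun y : ℝ => y ^ (2 * j) * Real.exp (-(1 / 2) * y ^ 2))]
    congr 1
    refine setIntegral_congr_fun measurableSet_Ioi fun x _ => ?_
    have e1 : x ^ (2 * (j : ℝ)) = x ^ (2 * j) := by
      rw [← Real.rpow_natCast]; push_cast; rfl
    simp only [e1, Real.rpow_two]
  induction j with
  | zero =>
    have h := integral_gaussian (1 / 2)
    simp only [gaussMoment, mul_zero, pow_zero, one_mul, Nat.factorial_zero, Nat.cast_one,
      mu_zero, mul_one, h]
    congr 1
    ring
  | succ j ih =>
    have h2 : gaussMoment (2 * (j + 1)) = (2 * j + 1) * gaussMoment (2 * j) := by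
      rw [h1, h1]
      push_cast
      rw [show (j : ℝ) + 1 + 1 / 2 = (j + 1 / 2) + 1 by ring, Real.Gamma_add_one (by positivity),
        show -(2 * ((j : ℝ) + 1) + 1) / 2 = -(2 * (j : ℝ) + 1) / 2 - 1 by ring,
        Real.rpow_sub_one (by norm_num)]
      ring
    rw [h2, ih, Nat.factorial_succ]
    push_cast
    linear_combination (-(Real.sqrt (2 * Real.pi) * j.factorial)) * mu_succ j

lemma gaussMoment_integrable (n : ℕ) :
    Integrable fun x : ℝ => x ^ n * Real.exp (-(1 / 2) * x ^ 2) := by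
  have := integrable_rpow_mul_exp_neg_mul_sq (b := 1 / 2) (by norm_num) (s := n)
    (by linarith [n.cast_nonneg (α := ℝ)])
  simpa only [Real.rpow_natCast] using this

/-- The integrals `∫_0^∞ r^{2n+1} e^{-r²/2} dr`. -/
lemma radial_integral (n : ℕ) :
    ∫ r in Ioi (0 : ℝ), r ^ (2 * n + 1) * Real.exp (-(1 / 2) * r ^ 2) = 2 ^ n * n.factorial := by
  have h := integral_rpow_mul_exp_neg_mul_rpow (p := 2) (q := 2 * n + 1) (b := 1 / 2) (by norm_num)
    (by linarith [n.cast_nonneg (α := ℝ)]) (by norm_num)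
  have h2 : ((2 * n + 1 : ℝ) + 1) / 2 = n + 1 := by ring
  have h3 : -((2 * n + 1 : ℝ) + 1) / 2 = -((n + 1 : ℕ) : ℝ) := by push_cast; ring
  rw [h2, h3, Real.Gamma_nat_eq_factorial, Real.rpow_neg (by norm_num), Real.rpow_natCast] at h
  have h4 : ∀ x : ℝ, x ^ (2 * (n : ℝ) + 1) = x ^ (2 * n + 1) := fun x => by
    rw [← Real.rpow_natCast]; push_cast; rfl
  simp only [h4, Real.rpow_two] at h
  rw [h, pow_succ, one_div, inv_pow]
  field_simp

/-! ### The moments of the skew weight -/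

/-- The integrand of the moment of order `(j, k)` of the skew weight. -/
def momentIntegrand (j k : ℕ) (p : ℝ × ℝ) : ℝ :=
  (p.1 - p.2) / (p.1 + p.2) * Real.exp (-(1 / 2) * (p.1 ^ 2 + p.2 ^ 2)) *
    (p.1 ^ (2 * j) * p.2 ^ (2 * k) - p.2 ^ (2 * j) * p.1 ^ (2 * k))

/-- The moments of the skew weight. -/
def moment (j k : ℕ) : ℝ := ∫ p : ℝ × ℝ, momentIntegrand j k p

/-- The radial integrand `(x² + y²)^n e^{-(x² + y²)/2}`. -/
def radialIntegrand (n : ℕ) (p : ℝ × ℝ) : ℝ :=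
  (p.1 ^ 2 + p.2 ^ 2) ^ n * Real.exp (-(1 / 2) * (p.1 ^ 2 + p.2 ^ 2))

lemma momentIntegrand_swap (j k : ℕ) (p : ℝ × ℝ) :
    momentIntegrand k j p = -momentIntegrand j k p := by
  unfold momentIntegrand
  ring

/-- An integral over the plane in polar coordinates. -/
lemma integral_polar {f : ℝ × ℝ → ℝ} {n : ℕ} {t : ℝ → ℝ}
    (h : ∀ r > 0, ∀ θ, f (r * Real.cos θ, r * Real.sin θ) =
      r ^ (2 * n) * Real.exp (-(1 / 2) * r ^ 2) * t θ) :
    ∫ p, f p = 2 ^ n * n.factorial * ∫ θ in Ioo (-Real.pi) Real.pi, t θ := by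
  rw [← integral_comp_polarCoord_symm, ← radial_integral n]
  have := setIntegral_prod_mul (μ := volume) (ν := volume)
    (fun r : ℝ => r ^ (2 * n + 1) * Real.exp (-(1 / 2) * r ^ 2)) t (Ioi 0)
    (Ioo (-Real.pi) Real.pi)
  rw [← this]
  refine setIntegral_congr_fun (measurableSet_Ioi.prod measurableSet_Ioo) fun p hp => ?_
  rw [polarCoord_symm_apply]
  simp only [smul_eq_mul]
  rw [h _ hp.1]
  ring

lemma integral_radialIntegrand (n : ℕ) :
    ∫ p, radialIntegrand n p = 2 * Real.pi * (2 ^ n * n.factorial) := by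
  rw [integral_polar (n := n) (t := fun _ => 1) fun r hr θ => ?_]
  · have : (0 : ℝ) ≤ Real.pi + Real.pi := by positivity
    simp [this]
    ring
  · have : (r * Real.cos θ) ^ 2 + (r * Real.sin θ) ^ 2 = r ^ 2 := by
      rw [← mul_one (r ^ 2), ← Real.cos_sq_add_sin_sq θ]; ring
    simp only [radialIntegrand, this]
    rw [pow_mul, mul_one]

/-- A function that is not integrable has integral 0 by convention, so the nonzero value proves
integrability. -/
lemma integrable_radialIntegrand (n : ℕ) : Integrable (radialIntegrand n) :=
  Integrable.of_integral_ne_zero (by rw [integral_radialIntegrand]; positivity)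

lemma radialIntegrand_nonneg (n : ℕ) (p : ℝ × ℝ) : 0 ≤ radialIntegrand n p := by
  unfold radialIntegrand; positivity

/-- The difference is divisible by X - Y. For X = x², Y = y² this factor contains x + y and will
cancel the singularity of the kernel. -/
lemma abs_pow_mul_sub_le {X Y : ℝ} (hX : 0 ≤ X) (hY : 0 ≤ Y) (k m : ℕ) :
    |X ^ (k + (m + 1)) * Y ^ k - Y ^ (k + (m + 1)) * X ^ k| ≤
      |X - Y| * (m + 1) * (X + Y) ^ (2 * k + m) := by
  have h1 : X ^ (k + (m + 1)) * Y ^ k - Y ^ (k + (m + 1)) * X ^ k =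
      X ^ k * Y ^ k * (X ^ (m + 1) - Y ^ (m + 1)) := by ring
  have h2 := abs_pow_sub_pow_le X Y (m + 1)
  rw [Nat.add_sub_cancel, abs_of_nonneg hX, abs_of_nonneg hY] at h2
  have h3 : max X Y ≤ X + Y := max_le (by linarith) (by linarith)
  have h4 : X ^ k * Y ^ k ≤ (X + Y) ^ (2 * k) := by
    rw [two_mul, pow_add]
    gcongr <;> linarith
  rw [h1, abs_mul, abs_of_nonneg (a := X ^ k * Y ^ k) (by positivity)]
  push_cast at h2
  calc X ^ k * Y ^ k * |X ^ (m + 1) - Y ^ (m + 1)|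
      ≤ (X + Y) ^ (2 * k) * (|X - Y| * (m + 1) * max X Y ^ m) := by gcongr
    _ ≤ (X + Y) ^ (2 * k) * (|X - Y| * (m + 1) * (X + Y) ^ m) := by gcongr
    _ = _ := by ring

lemma abs_momentIntegrand_le (j k : ℕ) (p : ℝ × ℝ) :
    |momentIntegrand j k p| ≤ 2 * (j + k) * radialIntegrand (j + k) p := by
  wlog h : k ≤ j generalizing j k
  · rw [momentIntegrand_swap, abs_neg, add_comm (j : ℝ), add_comm j]
    exact this k j (by omega)
  obtain ⟨m, rfl⟩ := Nat.exists_eq_add_of_le h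
  rcases m with _ | m
  · have := radialIntegrand_nonneg (k + 0 + k) p
    simp only [momentIntegrand, add_zero]
    rw [mul_comm (p.2 ^ (2 * k)), sub_self, mul_zero, abs_zero]
    positivity
  obtain ⟨x, y⟩ := p
  simp only [momentIntegrand, radialIntegrand]
  have hXY := abs_pow_mul_sub_le (sq_nonneg x) (sq_nonneg y) k m
  rw [abs_mul, abs_mul, abs_of_pos (Real.exp_pos _), abs_div]
  simp only [pow_mul] at hXY ⊢
  set E := Real.exp (-(1 / 2) * (x ^ 2 + y ^ 2))
  have hE : 0 ≤ E := (Real.exp_pos _).le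
  have hS : 0 ≤ x ^ 2 + y ^ 2 := by positivity
  have hK : |x - y| / |x + y| * |x ^ 2 - y ^ 2| ≤ 2 * (x ^ 2 + y ^ 2) := by
    -- On the line x + y = 0 the quotient is 0 by the convention for division by zero; off it the
    -- product is (x - y)² ≤ 2(x² + y²).
    rcases eq_or_ne (x + y) 0 with h0 | h0
    · rw [h0, abs_zero, div_zero, zero_mul]
      positivity
    · rw [show x ^ 2 - y ^ 2 = (x - y) * (x + y) by ring, abs_mul]
      have : |x - y| / |x + y| * (|x - y| * |x + y|) = |x - y| ^ 2 := by
        have := abs_pos.2 h0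
        field_simp
      rw [this, sq_abs]
      nlinarith [sq_nonneg (x + y)]
  calc |x - y| / |x + y| * E *
        |(x ^ 2) ^ (k + (m + 1)) * (y ^ 2) ^ k - (y ^ 2) ^ (k + (m + 1)) * (x ^ 2) ^ k|
      ≤ |x - y| / |x + y| * E *
        (|x ^ 2 - y ^ 2| * (m + 1) * (x ^ 2 + y ^ 2) ^ (2 * k + m)) := by gcongr
    _ = |x - y| / |x + y| * |x ^ 2 - y ^ 2| *
        ((m + 1) * (x ^ 2 + y ^ 2) ^ (2 * k + m) * E) := by ring
    _ ≤ 2 * (x ^ 2 + y ^ 2) * ((m + 1) * (x ^ 2 + y ^ 2) ^ (2 * k + m) * E) := by gcongr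
    _ = 2 * (m + 1) * ((x ^ 2 + y ^ 2) ^ (k + (m + 1) + k) * E) := by ring
    _ ≤ 2 * (((k + (m + 1) : ℕ) : ℝ) + k) * ((x ^ 2 + y ^ 2) ^ (k + (m + 1) + k) * E) := by
        refine mul_le_mul_of_nonneg_right ?_ (by positivity)
        push_cast
        linarith [k.cast_nonneg (α := ℝ)]

lemma measurable_momentIntegrand (j k : ℕ) : Measurable (momentIntegrand j k) := by
  unfold momentIntegrand
  fun_prop

lemma integrable_momentIntegrand (j k : ℕ) : Integrable (momentIntegrand j k) :=
  ((integrable_radialIntegrand (j + k)).const_mul (2 * ((j : ℝ) + k))).mono'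
    (measurable_momentIntegrand j k).aestronglyMeasurable
    (ae_of_all _ fun p => abs_momentIntegrand_le j k p)

lemma integral_abs_momentIntegrand_le (j k : ℕ) :
    ∫ p, ‖momentIntegrand j k p‖ ≤
      4 * Real.pi * (j + k) * (2 ^ (j + k) * (j + k).factorial) := by
  refine (integral_mono (integrable_momentIntegrand j k).norm
    ((integrable_radialIntegrand (j + k)).const_mul _)
    fun p => abs_momentIntegrand_le j k p).trans_eq ?_
  rw [integral_const_mul, integral_radialIntegrand]
  ring

lemma moment_swap (j k : ℕ) : moment k j = -moment j k := by
  simp only [moment, momentIntegrand_swap j k, integral_neg]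

/-- The two integrands add up to x² + y² times the one of order (j, k). The angular factor `T` is
unchanged, and with n = j + k the radial integral passes from 2^n n! to 2^(n+1) (n+1)!. -/
lemma moment_add (j k : ℕ) :
    moment (j + 1) k + moment j (k + 1) = 2 * (j + k + 1) * moment j k := by
  set T : ℝ → ℝ := fun θ => (Real.cos θ - Real.sin θ) / (Real.cos θ + Real.sin θ) *
    (Real.cos θ ^ (2 * j) * Real.sin θ ^ (2 * k) -
      Real.sin θ ^ (2 * j) * Real.cos θ ^ (2 * k)) with hT
  have key : ∀ r > (0 : ℝ), ∀ θ, momentIntegrand j k (r * Real.cos θ, r * Real.sin θ) =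
      r ^ (2 * (j + k)) * Real.exp (-(1 / 2) * r ^ 2) * T θ := fun r hr θ => by
    have h1 : (r * Real.cos θ) ^ 2 + (r * Real.sin θ) ^ 2 = r ^ 2 := by
      rw [← mul_one (r ^ 2), ← Real.cos_sq_add_sin_sq θ]; ring
    simp only [momentIntegrand, h1, hT]
    rw [← mul_sub, ← mul_add, mul_div_mul_left _ _ hr.ne']
    ring
  rw [moment, moment, ← integral_add (integrable_momentIntegrand _ _)
    (integrable_momentIntegrand _ _), moment, integral_polar key,
    integral_polar (n := j + k + 1) (t := T) fun r hr θ => ?_, Nat.factorial_succ]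
  · push_cast
    ring
  · have h2 : ∀ p : ℝ × ℝ, momentIntegrand (j + 1) k p + momentIntegrand j (k + 1) p =
        (p.1 ^ 2 + p.2 ^ 2) * momentIntegrand j k p := fun p => by
      unfold momentIntegrand; ring
    rw [h2, key r hr]
    have h1 : (r * Real.cos θ) ^ 2 + (r * Real.sin θ) ^ 2 = r ^ 2 := by
      rw [← mul_one (r ^ 2), ← Real.cos_sq_add_sin_sq θ]; ring
    rw [h1, show 2 * (j + k + 1) = 2 * (j + k) + 2 by ring, pow_add]
    ring

lemma ae_add_ne_zero : ∀ᵐ p : ℝ × ℝ, p.1 + p.2 ≠ 0 := by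
  have h : volume {p : ℝ × ℝ | p.1 + p.2 = 0} = 0 := by
    have := Measure.addHaar_submodule (volume : Measure (ℝ × ℝ))
      (LinearMap.ker (LinearMap.fst ℝ ℝ ℝ + LinearMap.snd ℝ ℝ ℝ)) (by
        rw [Ne, LinearMap.ker_eq_top]
        intro h
        have : (LinearMap.fst ℝ ℝ ℝ + LinearMap.snd ℝ ℝ ℝ) (0, 1) =
          (0 : ℝ × ℝ →ₗ[ℝ] ℝ) (0, 1) := by rw [h]
        simp at this)
    exact this
  simpa [ae_iff] using h

/-- The difference carries the factor x² - y², which together with (x - y)/(x + y) becomes (x - y)².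
What remains are products of one-dimensional Gaussian moments; those coming from -2xy are odd and
vanish. -/
lemma moment_sub (j k : ℕ) :
    moment (j + 1) k - moment j (k + 1) =
      8 * Real.pi * (j + k + 1) * (j.factorial * mu j) * (k.factorial * mu k) := by
  have hprod : ∀ m n : ℕ, Integrable (fun p : ℝ × ℝ =>
      (p.1 ^ m * Real.exp (-(1 / 2) * p.1 ^ 2)) * (p.2 ^ n * Real.exp (-(1 / 2) * p.2 ^ 2))) ∧
      ∫ p : ℝ × ℝ, (p.1 ^ m * Real.exp (-(1 / 2) * p.1 ^ 2)) *
        (p.2 ^ n * Real.exp (-(1 / 2) * p.2 ^ 2)) = gaussMoment m * gaussMoment n := fun m n =>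
    ⟨(gaussMoment_integrable m).mul_prod (gaussMoment_integrable n), integral_prod_mul
      (fun x : ℝ => x ^ m * Real.exp (-(1 / 2) * x ^ 2)) fun x : ℝ =>
        x ^ n * Real.exp (-(1 / 2) * x ^ 2)⟩
  set P : ℕ → ℕ → ℝ × ℝ → ℝ := fun m n p =>
    (p.1 ^ m * Real.exp (-(1 / 2) * p.1 ^ 2)) * (p.2 ^ n * Real.exp (-(1 / 2) * p.2 ^ 2)) with hP
  have hae : ∀ᵐ p : ℝ × ℝ, momentIntegrand (j + 1) k p - momentIntegrand j (k + 1) p =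
      (((P (2 * (j + 1)) (2 * k) p + P (2 * j) (2 * (k + 1)) p) +
        (P (2 * k) (2 * (j + 1)) p + P (2 * (k + 1)) (2 * j) p)) +
        (-2) * (P (2 * j + 1) (2 * k + 1) p + P (2 * k + 1) (2 * j + 1) p)) := by
    filter_upwards [ae_add_ne_zero] with p hp
    simp only [momentIntegrand, hP]
    rw [mul_add, Real.exp_add]
    field_simp
    ring
  rw [moment, moment, ← integral_sub (integrable_momentIntegrand _ _)
    (integrable_momentIntegrand _ _), integral_congr_ae hae, integral_add, integral_add,
    integral_add (hprod _ _).1 (hprod _ _).1, integral_add (hprod _ _).1 (hprod _ _).1,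
    integral_const_mul, integral_add (hprod _ _).1 (hprod _ _).1]
  · simp only [(hprod _ _).2, gaussMoment_odd, gaussMoment_even, Nat.factorial_succ]
    have hs := Real.mul_self_sqrt (show (0 : ℝ) ≤ 2 * Real.pi by positivity)
    have h1 := mu_succ j
    have h2 := mu_succ k
    push_cast
    set s := Real.sqrt (2 * Real.pi)
    have e1 : ((j : ℝ) + 1) * j.factorial * mu (j + 1) = j.factorial * ((2 * j + 1) * mu j) := by
      rw [← h1]; ring
    have e2 : ((k : ℝ) + 1) * k.factorial * mu (k + 1) = k.factorial * ((2 * k + 1) * mu k) := by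
      rw [← h2]; ring
    rw [e1, e2]
    linear_combination (4 * (j + k + 1) * (j.factorial * mu j) * (k.factorial * mu k)) * hs
  · exact (hprod _ _).1.add (hprod _ _).1
  · exact (hprod _ _).1.add (hprod _ _).1
  · exact ((hprod _ _).1.add (hprod _ _).1).add ((hprod _ _).1.add (hprod _ _).1)
  · exact ((hprod _ _).1.add (hprod _ _).1).const_mul _

end EllipticGinibre

end

open MeasureTheory Set
open Filter Topology Metric

noncomputable section

namespace EllipticGinibre

/-! ### The coefficients of the skew weight -/

/-- The coefficients of the expansion `𝓔(a, b) = ∑ e_{jk} a^j b^k / (j! k!)`. -/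
def eCoef (j k : ℕ) : ℝ := moment j k / (j.factorial * k.factorial)

lemma eCoef_zero_zero : eCoef 0 0 = 0 := by
  have := moment_swap 0 0
  rw [eCoef, show moment 0 0 = 0 by linarith, zero_div]

lemma eCoef_succ_left (j k : ℕ) :
    (j + 1) * eCoef (j + 1) k = (j + k + 1) * (eCoef j k + 4 * Real.pi * mu j * mu k) := by
  have h1 := moment_add j k
  have h2 := moment_sub j k
  have h3 : moment (j + 1) k = (j + k + 1) * moment j k +
      4 * Real.pi * (j + k + 1) * (j.factorial * mu j) * (k.factorial * mu k) := by linarith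
  have hj : (j.factorial : ℝ) ≠ 0 := by exact_mod_cast j.factorial_ne_zero
  have hk : (k.factorial : ℝ) ≠ 0 := by exact_mod_cast k.factorial_ne_zero
  have hj1 : (j : ℝ) + 1 ≠ 0 := by positivity
  simp only [eCoef, h3, Nat.factorial_succ]
  push_cast
  field_simp

lemma eCoef_succ_right (j k : ℕ) :
    (k + 1) * eCoef j (k + 1) = (j + k + 1) * (eCoef j k - 4 * Real.pi * mu j * mu k) := by
  have h1 := moment_add j k
  have h2 := moment_sub j k
  have h3 : moment j (k + 1) = (j + k + 1) * moment j k -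
      4 * Real.pi * (j + k + 1) * (j.factorial * mu j) * (k.factorial * mu k) := by linarith
  have hj : (j.factorial : ℝ) ≠ 0 := by exact_mod_cast j.factorial_ne_zero
  have hk : (k.factorial : ℝ) ≠ 0 := by exact_mod_cast k.factorial_ne_zero
  have hk1 : (k : ℝ) + 1 ≠ 0 := by positivity
  simp only [eCoef, h3, Nat.factorial_succ]
  push_cast
  field_simp

/-- The recursions in the two indices have left sides adding up to (j + k + 2) e_{j+1,k+1}, and the
factor j + k + 2 cancels. Unlike them, the resulting recursion has coefficients that do not depend
on j and k outside the inhomogeneous term, and a contour integral can reproduce it. -/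
lemma eCoef_succ_succ (j k : ℕ) : eCoef (j + 1) (k + 1) = eCoef j (k + 1) + eCoef (j + 1) k +
    4 * Real.pi * (mu j * mu (k + 1) - mu (j + 1) * mu k) := by
  have h1 := eCoef_succ_left j (k + 1)
  have h2 := eCoef_succ_right (j + 1) k
  push_cast at h1 h2
  have h0 : (j : ℝ) + k + 2 ≠ 0 := by positivity
  refine mul_left_cancel₀ h0 ?_
  linear_combination h1 + h2

lemma eCoef_zero_succ (k : ℕ) : eCoef 0 (k + 1) = eCoef 0 k - 4 * Real.pi * mu k := by
  have h := eCoef_succ_right 0 k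
  rw [mu_zero] at h
  push_cast at h
  have h0 : (k : ℝ) + 1 ≠ 0 := by positivity
  refine mul_left_cancel₀ h0 ?_
  linear_combination h

lemma eCoef_succ_zero (j : ℕ) : eCoef (j + 1) 0 = eCoef j 0 + 4 * Real.pi * mu j := by
  have h := eCoef_succ_left j 0
  rw [mu_zero] at h
  push_cast at h
  have h0 : (j : ℝ) + 1 ≠ 0 := by positivity
  refine mul_left_cancel₀ h0 ?_
  linear_combination h

/-! ### The expansion of the skew weight -/

lemma besselI0_hasSum (x : ℝ) :
    HasSum (fun k : ℕ => (x / 2) ^ (2 * k) / (k.factorial : ℝ) ^ 2) (besselI0 x) := by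
  refine (Summable.of_nonneg_of_le (fun k => by rw [pow_mul]; positivity) (fun k => ?_)
    (Real.summable_pow_div_factorial ((x / 2) ^ 2))).hasSum
  rw [pow_mul]
  have h1 : (1 : ℝ) ≤ k.factorial := by exact_mod_cast k.factorial_pos
  gcongr
  nlinarith

lemma measurable_of_hasSum_nat {α E : Type*} [MeasurableSpace α] [NormedAddCommGroup E]
    [MeasurableSpace E] [BorelSpace E] [SecondCountableTopology E] {F : ℕ → α → E} {f : α → E}
    (hF : ∀ k, Measurable (F k)) (hf : ∀ x, HasSum (fun k => F k x) (f x)) : Measurable f :=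
  measurable_of_tendsto_metrizable
    (fun n => (Finset.measurable_fun_sum (Finset.range n) fun k _ => hF k))
    (tendsto_pi_nhds.2 fun x => (hf x).tendsto_sum_nat)

lemma measurable_besselI0 : Measurable besselI0 :=
  measurable_of_hasSum_nat (fun k => by fun_prop) besselI0_hasSum

lemma besselI0_sqrt_hasSum {a : ℝ} (ha : 0 ≤ a) (x : ℝ) :
    HasSum (fun k : ℕ => x ^ (2 * k) * (a ^ k / (k.factorial : ℝ) ^ 2))
      (besselI0 (2 * x * √a)) := by
  convert besselI0_hasSum (2 * x * √a) using 2 with k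
  rw [show 2 * x * √a / 2 = x * √a by ring, mul_pow, pow_mul (√a), Real.sq_sqrt ha, mul_div_assoc]

lemma weightIntegrand_hasSum {a b : ℝ} (ha : 0 ≤ a) (hb : 0 ≤ b) (p : ℝ × ℝ) :
    HasSum (fun q : ℕ × ℕ => momentIntegrand q.1 q.2 p *
      (a ^ q.1 / (q.1.factorial : ℝ) ^ 2 * (b ^ q.2 / (q.2.factorial : ℝ) ^ 2)))
      (weightIntegrand a b p) := by
  have key : ∀ x y : ℝ, HasSum (fun q : ℕ × ℕ =>
      (x ^ (2 * q.1) * (a ^ q.1 / (q.1.factorial : ℝ) ^ 2)) *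
        (y ^ (2 * q.2) * (b ^ q.2 / (q.2.factorial : ℝ) ^ 2)))
      (besselI0 (2 * x * √a) * besselI0 (2 * y * √b)) := fun x y => by
    have h1 := besselI0_sqrt_hasSum ha x
    have h2 := besselI0_sqrt_hasSum hb y
    refine h1.mul h2 (h1.summable.mul_of_nonneg h2.summable (fun k => ?_) fun k => ?_) <;>
    · simp only [Pi.zero_apply, pow_mul]; positivity
  have h := ((key p.1 p.2).sub (key p.2 p.1)).mul_left
    ((p.1 - p.2) / (p.1 + p.2) * Real.exp (-(1 / 2) * (p.1 ^ 2 + p.2 ^ 2)))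
  refine h.congr_fun fun q => ?_
  unfold momentIntegrand
  ring

lemma factorial_add_le (j k : ℕ) :
    ((j + k).factorial : ℝ) ≤ 2 ^ (j + k) * (j.factorial * k.factorial) := by
  have h1 := Nat.add_choose_mul_factorial_mul_factorial j k
  have h2 : (j + k).choose j ≤ 2 ^ (j + k) := Nat.choose_le_two_pow _ _
  have : (j + k).factorial ≤ 2 ^ (j + k) * (j.factorial * k.factorial) := by
    rw [← h1, mul_assoc, ← Nat.choose_symm_add]
    exact Nat.mul_le_mul_right _ h2
  exact_mod_cast this

/-- Each of 2^(j+k), j + k ≤ 2^(j+k) and (j + k)! ≤ 2^(j+k) j! k! contributes a factor 2^(j+k),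
whence the 8. Of the denominator (j!)² (k!)² of the Bessel series a factor j! k! survives, enough
for convergence. -/
lemma integral_abs_momentIntegrand_le' (j k : ℕ) :
    ∫ p, ‖momentIntegrand j k p‖ ≤
      4 * Real.pi * 8 ^ (j + k) * (j.factorial * k.factorial) := by
  refine (integral_abs_momentIntegrand_le j k).trans ?_
  have h1 := factorial_add_le j k
  have h2 : ((j : ℝ) + k) ≤ 2 ^ (j + k) := by exact_mod_cast (Nat.lt_two_pow_self (n := j + k)).le
  have h3 : (8 : ℝ) ^ (j + k) = 2 ^ (j + k) * (2 ^ (j + k) * 2 ^ (j + k)) := by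
    rw [← mul_pow, ← mul_pow]; norm_num
  calc 4 * Real.pi * (j + k) * (2 ^ (j + k) * (j + k).factorial)
      ≤ 4 * Real.pi * 2 ^ (j + k) *
          (2 ^ (j + k) * (2 ^ (j + k) * (j.factorial * k.factorial))) := by
        gcongr
    _ = _ := by rw [h3]; ring

lemma summable_prod_exp (x y : ℝ) (hx : 0 ≤ x) (hy : 0 ≤ y) :
    Summable fun q : ℕ × ℕ => x ^ q.1 / q.1.factorial * (y ^ q.2 / q.2.factorial) :=
  (Real.summable_pow_div_factorial x).mul_of_nonneg (Real.summable_pow_div_factorial y)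
    (fun k => by positivity) fun k => by positivity

lemma summable_integral_norm {a b : ℝ} (ha : 0 ≤ a) (hb : 0 ≤ b) :
    Summable fun q : ℕ × ℕ => ∫ p, ‖momentIntegrand q.1 q.2 p *
      (a ^ q.1 / (q.1.factorial : ℝ) ^ 2 * (b ^ q.2 / (q.2.factorial : ℝ) ^ 2))‖ := by
  refine Summable.of_nonneg_of_le (fun q => integral_nonneg fun p => norm_nonneg _) (fun q => ?_)
    ((summable_prod_exp (8 * a) (8 * b) (by positivity) (by positivity)).mul_left (4 * Real.pi))
  obtain ⟨j, k⟩ := q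
  have hj : (j.factorial : ℝ) ≠ 0 := by exact_mod_cast j.factorial_ne_zero
  have hk : (k.factorial : ℝ) ≠ 0 := by exact_mod_cast k.factorial_ne_zero
  have h0 : 0 ≤ a ^ j / (j.factorial : ℝ) ^ 2 * (b ^ k / (k.factorial : ℝ) ^ 2) := by positivity
  have h1 : ∀ p, ‖momentIntegrand j k p * (a ^ j / (j.factorial : ℝ) ^ 2 *
      (b ^ k / (k.factorial : ℝ) ^ 2))‖ = ‖momentIntegrand j k p‖ *
      (a ^ j / (j.factorial : ℝ) ^ 2 * (b ^ k / (k.factorial : ℝ) ^ 2)) := fun p => by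
    rw [norm_mul, Real.norm_of_nonneg h0]
  rw [integral_congr_ae (ae_of_all _ h1), integral_mul_const]
  refine (mul_le_mul_of_nonneg_right (integral_abs_momentIntegrand_le' j k) h0).trans_eq ?_
  rw [mul_pow, mul_pow, pow_add]
  field_simp

lemma integrable_weightIntegrand {a b : ℝ} (ha : 0 ≤ a) (hb : 0 ≤ b) :
    Integrable (weightIntegrand a b) := by
  refine integrable_of_hasSum (F := fun (q : ℕ × ℕ) p => momentIntegrand q.1 q.2 p *
      (a ^ q.1 / (q.1.factorial : ℝ) ^ 2 * (b ^ q.2 / (q.2.factorial : ℝ) ^ 2)))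
    (fun q => (integrable_momentIntegrand q.1 q.2).mul_const _)
    (summable_integral_norm ha hb) (ae_of_all _ (weightIntegrand_hasSum ha hb)) ?_
  have := measurable_besselI0
  unfold weightIntegrand
  exact (by fun_prop : Measurable _).aestronglyMeasurable

lemma weightE_hasSum {a b : ℝ} (ha : 0 ≤ a) (hb : 0 ≤ b) :
    HasSum (fun q : ℕ × ℕ => eCoef q.1 q.2 *
      (a ^ q.1 / q.1.factorial * (b ^ q.2 / q.2.factorial))) (weightE a b) := by
  have h := hasSum_integral_of_summable_integral_norm
    (fun q : ℕ × ℕ => (integrable_momentIntegrand q.1 q.2).mul_const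
      (a ^ q.1 / (q.1.factorial : ℝ) ^ 2 * (b ^ q.2 / (q.2.factorial : ℝ) ^ 2)))
    (summable_integral_norm ha hb)
  rw [show (fun p => ∑' q : ℕ × ℕ, momentIntegrand q.1 q.2 p *
      (a ^ q.1 / (q.1.factorial : ℝ) ^ 2 * (b ^ q.2 / (q.2.factorial : ℝ) ^ 2))) =
      weightIntegrand a b from funext fun p => (weightIntegrand_hasSum ha hb p).tsum_eq] at h
  refine h.congr_fun fun q => ?_
  have hj : (q.1.factorial : ℝ) ≠ 0 := by exact_mod_cast q.1.factorial_ne_zero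
  have hk : (q.2.factorial : ℝ) ≠ 0 := by exact_mod_cast q.2.factorial_ne_zero
  rw [integral_mul_const, eCoef, moment]
  field_simp

lemma measurable_weightE (a : ℝ) : Measurable (weightE a) := by
  have h1 := measurable_besselI0
  have : Measurable fun x : ℝ × (ℝ × ℝ) => weightIntegrand a x.1 x.2 := by
    unfold weightIntegrand
    fun_prop
  exact (this.stronglyMeasurable.integral_prod_right (ν := volume)).measurable

/-! ### Exponential generating functions -/

/-- The exponential generating function of a sequence. -/
def egf (c : ℕ → ℂ) (s : ℝ) : ℂ := ∑' k, c k * ((s : ℂ) ^ k / k.factorial)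

variable {c : ℕ → ℂ} {K q : ℝ}

lemma norm_egf_term_le (hc : ∀ k, ‖c k‖ ≤ K * q ^ k) (s : ℝ) (k : ℕ) :
    ‖c k * ((s : ℂ) ^ k / k.factorial)‖ ≤ K * ((q * |s|) ^ k / k.factorial) := by
  rw [norm_mul, norm_div, norm_pow, Complex.norm_real, Complex.norm_natCast, Real.norm_eq_abs,
    mul_pow]
  calc ‖c k‖ * (|s| ^ k / k.factorial) ≤ K * q ^ k * (|s| ^ k / k.factorial) := by
        gcongr; exact hc k
    _ = _ := by ring

lemma summable_egf_norm (hc : ∀ k, ‖c k‖ ≤ K * q ^ k) (s : ℝ) :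
    Summable fun k => ‖c k * ((s : ℂ) ^ k / k.factorial)‖ :=
  Summable.of_nonneg_of_le (fun _ => norm_nonneg _) (norm_egf_term_le hc s)
    ((Real.summable_pow_div_factorial (q * |s|)).mul_left K)

lemma egf_hasSum (hc : ∀ k, ‖c k‖ ≤ K * q ^ k) (s : ℝ) :
    HasSum (fun k => c k * ((s : ℂ) ^ k / k.factorial)) (egf c s) :=
  (summable_egf_norm hc s).of_norm.hasSum

lemma egf_zero (c : ℕ → ℂ) : egf c 0 = c 0 := by
  rw [egf, tsum_eq_single 0]
  · simp
  · intro k hk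
    simp [hk]

lemma norm_egf_le (hc : ∀ k, ‖c k‖ ≤ K * q ^ k) (s : ℝ) :
    ‖egf c s‖ ≤ K * Real.exp (q * |s|) := by
  have h : HasSum (fun k : ℕ => (q * |s|) ^ k / k.factorial) (Real.exp (q * |s|)) := by
    rw [Real.exp_eq_exp_ℝ]
    exact NormedSpace.expSeries_div_hasSum_exp (q * |s|)
  exact tsum_of_norm_bounded (h.mul_left K) (norm_egf_term_le hc s)

lemma egf_hasDerivAt (hc : ∀ k, ‖c k‖ ≤ K * q ^ k) (s : ℝ) :
    HasDerivAt (egf c) (egf (fun k => c (k + 1)) s) s := by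
  set T : ℝ := |s| + 1 with hT
  have hT0 : 0 ≤ T := by positivity
  have hcs : ∀ k, ‖c (k + 1)‖ ≤ (K * q) * q ^ k := fun k => by
    rw [mul_assoc, ← pow_succ']
    exact hc _
  have hg' : ∀ n (y : ℝ), HasDerivAt (fun y : ℝ => c n * ((y : ℂ) ^ n / n.factorial))
      (c n * ((n * (y : ℂ) ^ (n - 1)) / n.factorial)) y := fun n y => by
    have := ((hasDerivAt_pow n (y : ℂ)).comp_ofReal.div_const (n.factorial : ℂ)).const_mul (c n)
    exact this
  have hterm : ∀ n (y : ℝ), c (n + 1) * (((n + 1 : ℕ) * (y : ℂ) ^ (n + 1 - 1)) /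
      (n + 1).factorial) = c (n + 1) * ((y : ℂ) ^ n / n.factorial) := fun n y => by
    have h1 : ((n : ℂ) + 1) ≠ 0 := by exact_mod_cast n.succ_ne_zero
    have h2 : (n.factorial : ℂ) ≠ 0 := by exact_mod_cast n.factorial_ne_zero
    rw [Nat.factorial_succ, Nat.add_sub_cancel]
    push_cast
    field_simp
  -- The differentiated terms at T = |s| + 1 dominate those on the whole ball of radius T, which
  -- contains s.
  set u : ℕ → ℝ := fun n => ‖c n * ((n * (T : ℂ) ^ (n - 1)) / n.factorial)‖ with hu
  have husum : Summable u := by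
    rw [← summable_nat_add_iff 1]
    refine (summable_egf_norm hcs T).congr fun n => ?_
    simp only [hu, hterm]
  have h := hasDerivAt_tsum_of_isPreconnected (t := ball (0 : ℝ) T) husum isOpen_ball
    (convex_ball _ _).isPreconnected (fun n y _ => hg' n y) (fun n y hy => ?_) (y₀ := s) (y := s)
    (by simp [hT]) (egf_hasSum hc s).summable (by simp [hT])
  · have hs : Summable fun n => c n * ((n * (s : ℂ) ^ (n - 1)) / n.factorial) := by
      rw [← summable_nat_add_iff 1]
      exact (egf_hasSum hcs s).summable.congr fun n => (hterm n s).symm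
    rw [hs.tsum_eq_zero_add] at h
    simp only [hterm, Nat.cast_zero, zero_mul, zero_div, mul_zero, zero_add] at h
    exact h
  · simp only [hu]
    rw [mem_ball_zero_iff, Real.norm_eq_abs] at hy
    simp only [norm_mul, norm_div, norm_pow, Complex.norm_real, Real.norm_eq_abs]
    refine mul_le_mul_of_nonneg_left (div_le_div_of_nonneg_right (mul_le_mul_of_nonneg_left
      (pow_le_pow_left₀ (abs_nonneg y) ?_ _) (norm_nonneg _)) (norm_nonneg _)) (norm_nonneg _)
    rw [abs_of_nonneg hT0]
    exact hy.le

lemma continuous_egf (hc : ∀ k, ‖c k‖ ≤ K * q ^ k) : Continuous (egf c) :=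
  continuous_iff_continuousAt.2 fun s => (egf_hasDerivAt hc s).continuousAt

end EllipticGinibre

end

open MeasureTheory Set
open Filter Topology Metric

noncomputable section

namespace EllipticGinibre

/-! ### The Kummer function and the function `g` as exponential generating functions -/

lemma ascPochhammer_half (k : ℕ) :
    (ascPochhammer ℂ k).eval (1 / 2) * 2 ^ k = k.factorial * mu k := by
  induction k with
  | zero => simp [mu_zero]
  | succ k ih =>
    have h : ((k : ℂ) + 1) * (mu (k + 1) : ℂ) = (2 * k + 1) * mu k := by exact_mod_cast mu_succ k
    rw [ascPochhammer_succ_eval, Nat.factorial_succ, pow_succ]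
    push_cast
    linear_combination (2 * k + 1) * ih - (k.factorial : ℂ) * h

lemma ascPochhammer_one (k : ℕ) : (ascPochhammer ℂ k).eval 1 = k.factorial := by
  rw [ascPochhammer_eval_one]

/-- The function `s ↦ M(1/2, 1, 2s)`. -/
def kummerHalf (s : ℝ) : ℂ := egf (fun k => (mu k : ℂ)) s

lemma norm_mu_le (k : ℕ) : ‖(mu k : ℂ)‖ ≤ 1 * 2 ^ k := by
  rw [Complex.norm_real, Real.norm_of_nonneg (mu_nonneg k), one_mul]
  exact mu_le k

lemma kummerM_eq (s : ℝ) : kummerM (1 / 2) 1 (2 * s) = kummerHalf s := by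
  unfold kummerM kummerHalf egf
  congr 1
  ext k
  have h : (k.factorial : ℂ) ≠ 0 := by exact_mod_cast k.factorial_ne_zero
  rw [ascPochhammer_one, mul_pow]
  field_simp
  linear_combination (s : ℂ) ^ k * ascPochhammer_half k

lemma kummerHalf_zero : kummerHalf 0 = 1 := by
  simp [kummerHalf, egf_zero, mu_zero]

/-- The coefficients of the expansion `g(z, v) = ∑ γ_k(z) v^k / k!`. -/
def gCoef (z : ℂ) : ℕ → ℂ
  | 0 => -z
  | k + 1 => (1 + z) * gCoef z k + (1 + z) * mu k - z * mu (k + 1)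

lemma gCoef_one (k : ℕ) : gCoef 1 k = -mu k := by
  induction k with
  | zero => simp [gCoef, mu_zero]
  | succ k ih => rw [gCoef, ih]; ring

lemma gCoef_neg_one (k : ℕ) : gCoef (-1) k = mu k := by
  cases k with
  | zero => simp [gCoef, mu_zero]
  | succ k => rw [gCoef]; ring

lemma differentiable_gCoef (k : ℕ) : Differentiable ℂ fun z => gCoef z k := by
  induction k with
  | zero => unfold gCoef; fun_prop
  | succ k ih => unfold gCoef; fun_prop

/-- The recursion multiplies by at most 1 + R and its inhomogeneous terms are O(2^k), so every q > 1
+ R ≥ 2 is a growth rate. Being able to take q close to 1 + R lets the Laplace transform of g(z, ·)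
at p + 1 converge as soon as Re p > max(1, ‖z‖). -/
lemma exists_gCoef_bound {R q : ℝ} (hR : 1 ≤ R) (hq : 1 + R < q) :
    ∃ K, 0 ≤ K ∧ ∀ z : ℂ, ‖z‖ ≤ R → ∀ k, ‖gCoef z k‖ ≤ K * q ^ k := by
  have hq' : 0 < q - 1 - R := by linarith
  -- The first summand gives 1 + 3R ≤ K (q - 1 - R), which absorbs the inhomogeneous terms in the
  -- induction step; the second bounds γ_0 = -z.
  refine ⟨(1 + 3 * R) / (q - 1 - R) + R, by positivity, fun z hz k => ?_⟩
  induction k with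
  | zero =>
    have : 0 ≤ (1 + 3 * R) / (q - 1 - R) := by positivity
    simp only [gCoef, norm_neg, pow_zero, mul_one]
    linarith
  | succ k ih =>
    set K := (1 + 3 * R) / (q - 1 - R) + R with hK
    have h1z : ‖1 + z‖ ≤ 1 + R := (norm_add_le _ _).trans (by simpa using hz)
    have h2 : (2 : ℝ) ^ k ≤ q ^ k := by gcongr; linarith
    have hmu : ‖(mu k : ℂ)‖ ≤ q ^ k := (norm_mu_le k).trans (by linarith)
    have hmu' : ‖(mu (k + 1) : ℂ)‖ ≤ 2 * q ^ k := (norm_mu_le (k + 1)).trans (by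
      rw [pow_succ]; linarith)
    have hKq : 1 + 3 * R ≤ K * (q - 1 - R) := by
      rw [hK, add_mul, div_mul_cancel₀ _ hq'.ne']
      have : 0 ≤ R * (q - 1 - R) := by positivity
      linarith
    have hqk : 0 ≤ q ^ k := by have : 0 ≤ q := by linarith
                               positivity
    calc ‖gCoef z (k + 1)‖
        ≤ ‖1 + z‖ * ‖gCoef z k‖ + ‖1 + z‖ * ‖(mu k : ℂ)‖ + ‖z‖ * ‖(mu (k + 1) : ℂ)‖ := by
          rw [gCoef]
          refine (norm_sub_le _ _).trans ?_
          rw [norm_mul z]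
          gcongr
          refine (norm_add_le _ _).trans ?_
          rw [norm_mul, norm_mul]
      _ ≤ (1 + R) * (K * q ^ k) + (1 + R) * q ^ k + R * (2 * q ^ k) := by gcongr
      _ = ((1 + R) * K + (1 + 3 * R)) * q ^ k := by ring
      _ ≤ ((1 + R) * K + K * (q - 1 - R)) * q ^ k := by gcongr
      _ = K * q ^ (k + 1) := by rw [pow_succ]; ring

lemma exists_gCoef_bound_at (z : ℂ) : ∃ K q : ℝ, ∀ k, ‖gCoef z k‖ ≤ K * q ^ k := by
  obtain ⟨K, _, hK⟩ := exists_gCoef_bound (R := 1 + ‖z‖) (q := 3 + ‖z‖)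
    (by linarith [norm_nonneg z]) (by linarith)
  exact ⟨K, _, hK z (by linarith)⟩

/-- With M for s ↦ M(1/2, 1, 2s) and G for the generating function, the recursion reads G' = (1 +
z)G + (1 + z)M - zM', G(0) = -z. Hence e^{-s(z+1)}(G + zM) vanishes at 0 and has derivative (1 - z²)
e^{-s(z+1)} M; integrating gives the defining formula of g. -/
lemma gFun_eq (z : ℂ) (v : ℝ) : gFun z v = egf (gCoef z) v := by
  obtain ⟨K, q, hK⟩ := exists_gCoef_bound_at z
  have hG := egf_hasDerivAt hK
  have hM := egf_hasDerivAt norm_mu_le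
  have hK' : ∀ k, ‖gCoef z (k + 1)‖ ≤ (K * q) * q ^ k := fun k => by
    rw [mul_assoc, ← pow_succ']; exact hK _
  have hmu' : ∀ k, ‖(mu (k + 1) : ℂ)‖ ≤ 2 * 2 ^ k := fun k => by
    rw [← pow_succ']; simpa using norm_mu_le (k + 1)
  have hrec : ∀ s, egf (fun k => gCoef z (k + 1)) s =
      (1 + z) * egf (gCoef z) s + (1 + z) * kummerHalf s -
        z * egf (fun k => (mu (k + 1) : ℂ)) s := fun s => by
    have h1 := egf_hasSum hK s
    have h2 := egf_hasSum norm_mu_le s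
    have h3 := egf_hasSum hmu' s
    refine (egf_hasSum hK' s).unique ?_
    refine (((h1.mul_left (1 + z)).add (h2.mul_left (1 + z))).sub (h3.mul_left z)).congr_fun
      fun k => ?_
    rw [gCoef]
    ring
  have hexp : ∀ s : ℝ, HasDerivAt (fun s : ℝ => Complex.exp (-(s * (z + 1))))
      (-(z + 1) * Complex.exp (-(s * (z + 1)))) s := fun s => by
    have : HasDerivAt (fun s : ℝ => -((s : ℂ) * (z + 1))) (-(z + 1)) s := by
      refine ((Complex.ofRealCLM.hasDerivAt (x := s)).mul_const (z + 1)).neg.congr_deriv ?_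
      simp
    simpa [mul_comm] using this.cexp
  have hΦ : ∀ s : ℝ, HasDerivAt
      (fun s : ℝ => Complex.exp (-(s * (z + 1))) * (egf (gCoef z) s + z * kummerHalf s))
      ((1 - z ^ 2) * (Complex.exp (-(s * (z + 1))) * kummerHalf s)) s := fun s => by
    refine ((hexp s).mul ((hG s).add ((hM s).const_mul z))).congr_deriv ?_
    rw [hrec]
    simp only [kummerHalf, Pi.add_apply]
    ring
  have hcont : Continuous fun s : ℝ =>
      (1 - z ^ 2) * (Complex.exp (-(s * (z + 1))) * kummerHalf s) := by
    have := continuous_egf norm_mu_le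
    unfold kummerHalf
    fun_prop
  have hFTC := intervalIntegral.integral_eq_sub_of_hasDerivAt (fun s _ => hΦ s)
    (hcont.intervalIntegrable 0 v)
  rw [intervalIntegral.integral_const_mul] at hFTC
  have h0 : egf (gCoef z) 0 + z * kummerHalf 0 = 0 := by
    rw [egf_zero, kummerHalf_zero, gCoef]; ring
  rw [Complex.ofReal_zero, h0, mul_zero, sub_zero] at hFTC
  have hint : (∫ s in (0 : ℝ)..v, Complex.exp ((v - s) * (z + 1)) * kummerM (1 / 2) 1 (2 * s)) =
      Complex.exp (v * (z + 1)) *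
        ∫ s in (0 : ℝ)..v, Complex.exp (-(s * (z + 1))) * kummerHalf s := by
    rw [← intervalIntegral.integral_const_mul]
    congr 1
    ext s
    rw [kummerM_eq, ← mul_assoc, ← Complex.exp_add]
    congr 2
    ring
  rw [gFun, hint, kummerM_eq, mul_left_comm, hFTC, ← mul_assoc, ← Complex.exp_add]
  simp

lemma gFun_one (v : ℝ) : gFun 1 v = -kummerHalf v := by
  rw [gFun, kummerM_eq]; ring

lemma gFun_neg_one (v : ℝ) : gFun (-1) v = kummerHalf v := by
  rw [gFun, kummerM_eq]; ring

lemma differentiable_gFun (v : ℝ) : Differentiable ℂ fun z => gFun z v := by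
  intro z₀
  obtain ⟨K, _, hK⟩ := exists_gCoef_bound (R := 1 + ‖z₀‖) (q := 3 + ‖z₀‖)
    (by linarith [norm_nonneg z₀]) (by linarith)
  have h := Complex.differentiableOn_tsum_of_summable_norm (U := ball (0 : ℂ) (1 + ‖z₀‖))
    (F := fun k z => gCoef z k * ((v : ℂ) ^ k / k.factorial))
    ((Real.summable_pow_div_factorial ((3 + ‖z₀‖) * |v|)).mul_left K)
    (fun k => ((differentiable_gCoef k).mul_const _).differentiableOn) isOpen_ball
    fun k z hz => norm_egf_term_le (hK z (by simpa using (mem_ball_zero_iff.1 hz).le)) v k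
  simp only [gFun_eq]
  exact h.differentiableAt (isOpen_ball.mem_nhds (by simp))

lemma measurable_gFun : Measurable fun p : ℂ × ℝ => gFun p.1 p.2 := by
  refine measurable_of_hasSum_nat
    (F := fun k p => gCoef p.1 k * ((p.2 : ℂ) ^ k / k.factorial)) (fun k => ?_) fun p => ?_
  · have := (differentiable_gCoef k).continuous.measurable
    exact (this.comp measurable_fst).mul (by fun_prop)
  · obtain ⟨K, q, hK⟩ := exists_gCoef_bound_at p.1
    rw [gFun_eq]
    exact egf_hasSum hK p.2

/-! ### Laplace transforms -/

lemma laplace_pow_norm {x : ℝ} (hx : 0 < x) (k : ℕ) :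
    Integrable (fun s : ℝ => s ^ k / k.factorial * Real.exp (-(x * s)))
      (volume.restrict (Ioi 0)) ∧
    ∫ s in Ioi (0 : ℝ), s ^ k / k.factorial * Real.exp (-(x * s)) = (x ^ (k + 1))⁻¹ := by
  have h := Real.integral_rpow_mul_exp_neg_mul_Ioi (a := k + 1) (r := x) (by positivity) hx
  have hk : (k.factorial : ℝ) ≠ 0 := by exact_mod_cast k.factorial_ne_zero
  have h2 : ∫ s in Ioi (0 : ℝ), s ^ k / k.factorial * Real.exp (-(x * s)) = (x ^ (k + 1))⁻¹ := by
    have h3 : ∀ s : ℝ, s ^ k / k.factorial * Real.exp (-(x * s)) =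
        (k.factorial : ℝ)⁻¹ * (s ^ ((k : ℝ) + 1 - 1) * Real.exp (-(x * s))) := fun s => by
      rw [add_sub_cancel_right, Real.rpow_natCast]; ring
    simp only [h3]
    rw [integral_const_mul, h, Real.Gamma_nat_eq_factorial]
    have : ((k : ℝ) + 1) = ((k + 1 : ℕ) : ℝ) := by push_cast; rfl
    rw [this, Real.rpow_natCast, one_div, inv_pow]
    field_simp
  exact ⟨Integrable.of_integral_ne_zero (by rw [h2]; positivity), h2⟩

lemma norm_laplace_integrand (p : ℂ) (k : ℕ) {s : ℝ} (hs : 0 < s) :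
    ‖(s : ℂ) ^ k / k.factorial * Complex.exp (-(p * s))‖ =
      s ^ k / k.factorial * Real.exp (-(p.re * s)) := by
  rw [norm_mul, norm_div, norm_pow, Complex.norm_real, Complex.norm_natCast,
    Real.norm_of_nonneg hs.le, Complex.norm_exp]
  simp

lemma integrable_laplace_pow {p : ℂ} (hp : 0 < p.re) (k : ℕ) :
    IntegrableOn (fun s : ℝ => (s : ℂ) ^ k / k.factorial * Complex.exp (-(p * s))) (Ioi 0) := by
  refine (laplace_pow_norm hp k).1.mono' (by fun_prop : Continuous _).aestronglyMeasurable ?_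
  filter_upwards [ae_restrict_mem measurableSet_Ioi] with s hs
  rw [norm_laplace_integrand p k hs]

/-- Induction by integrating the derivative of s^(k+1)/(k+1)! e^{-ps}, which vanishes at 0 and at
infinity. -/
lemma laplace_pow {p : ℂ} (hp : 0 < p.re) (k : ℕ) :
    ∫ s in Ioi (0 : ℝ), (s : ℂ) ^ k / k.factorial * Complex.exp (-(p * s)) =
      (p ^ (k + 1))⁻¹ := by
  have hp0 : p ≠ 0 := fun h => by simp [h] at hp
  induction k with
  | zero =>
    have h := integral_exp_mul_complex_Ioi (a := -p) (by simpa using hp) 0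
    simp only [neg_mul] at h
    simp [h]
  | succ k ih =>
    have hd : ∀ s : ℝ, HasDerivAt
        (fun s : ℝ => (s : ℂ) ^ (k + 1) / (k + 1).factorial * Complex.exp (-(p * s)))
        ((s : ℂ) ^ k / k.factorial * Complex.exp (-(p * s)) -
          p * ((s : ℂ) ^ (k + 1) / (k + 1).factorial * Complex.exp (-(p * s)))) s := fun s => by
      have h1 : HasDerivAt (fun s : ℝ => -(p * (s : ℂ))) (-p) s := by
        refine ((Complex.ofRealCLM.hasDerivAt (x := s)).const_mul p).neg.congr_deriv ?_
        simp
      have h2 := ((hasDerivAt_pow (k + 1) (s : ℂ)).comp_ofReal.div_const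
        ((k + 1).factorial : ℂ)).mul h1.cexp
      refine h2.congr_deriv ?_
      have h3 : ((k : ℂ) + 1) ≠ 0 := by exact_mod_cast k.succ_ne_zero
      have h4 : (k.factorial : ℂ) ≠ 0 := by exact_mod_cast k.factorial_ne_zero
      rw [Nat.factorial_succ, Nat.add_sub_cancel]
      push_cast
      field_simp
      ring
    have hi1 := integrable_laplace_pow hp k
    have hi2 := (integrable_laplace_pow hp (k + 1)).const_mul p
    have hlim := tendsto_zero_of_hasDerivAt_of_integrableOn_Ioi (fun s _ => hd s)
      (hi1.sub hi2) (integrable_laplace_pow hp (k + 1))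
    have h := integral_Ioi_of_hasDerivAt_of_tendsto' (fun s _ => hd s) (hi1.sub hi2) hlim
    rw [integral_sub hi1 hi2, integral_const_mul, ih] at h
    simp only [Complex.ofReal_zero, ne_eq, Nat.add_eq_zero_iff, one_ne_zero, and_false,
      not_false_eq_true, zero_pow, zero_div, zero_mul, sub_zero, sub_eq_zero] at h
    rw [pow_succ p (k + 1), mul_inv, h]
    field_simp

lemma laplace_egf {c : ℕ → ℂ} {K q : ℝ} (hq : 0 ≤ q) (hc : ∀ k, ‖c k‖ ≤ K * q ^ k)
    {p : ℂ} (hp : q < p.re) :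
    HasSum (fun k => c k * (p ^ (k + 1))⁻¹)
      (∫ s in Ioi (0 : ℝ), egf c s * Complex.exp (-(p * s))) := by
  have hp0 : 0 < p.re := hq.trans_lt hp
  have hnorm : ∀ k, ∀ s ∈ Ioi (0 : ℝ),
      ‖c k * ((s : ℂ) ^ k / k.factorial) * Complex.exp (-(p * s))‖ =
      ‖c k‖ * (s ^ k / k.factorial * Real.exp (-(p.re * s))) := fun k s hs => by
    rw [mul_assoc, norm_mul, norm_laplace_integrand p k hs]
  have hint : ∀ k, Integrable
      (fun s : ℝ => c k * ((s : ℂ) ^ k / k.factorial) * Complex.exp (-(p * s)))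
      (volume.restrict (Ioi 0)) := fun k => by
    simpa only [mul_assoc] using! (integrable_laplace_pow hp0 k).const_mul (c k)
  have h := hasSum_integral_of_summable_integral_norm hint ?_
  · have h2 : ∀ s : ℝ, ∑' k, c k * ((s : ℂ) ^ k / k.factorial) * Complex.exp (-(p * s)) =
        egf c s * Complex.exp (-(p * s)) := fun s => by rw [tsum_mul_right, egf]
    simp only [h2] at h
    refine h.congr_fun fun k => ?_
    rw [← laplace_pow hp0, ← integral_const_mul]
    simp only [mul_assoc]
  · have hr : Summable fun k => K / p.re * (q / p.re) ^ k :=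
      (summable_geometric_of_lt_one (by positivity) ((div_lt_one hp0).2 hp)).mul_left _
    refine Summable.of_nonneg_of_le (fun k => integral_nonneg fun _ => norm_nonneg _)
      (fun k => ?_) hr
    rw [setIntegral_congr_fun measurableSet_Ioi (hnorm k), integral_const_mul,
      (laplace_pow_norm hp0 k).2, pow_succ, div_pow]
    calc ‖c k‖ * (p.re ^ k * p.re)⁻¹ ≤ K * q ^ k * (p.re ^ k * p.re)⁻¹ := by gcongr; exact hc k
      _ = _ := by field_simp

/-- The transform, taken term by term, is the binomial series of p⁻¹ (1 - 2/p)^(-1/2). -/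
lemma laplace_kummerHalf {p : ℂ} (hp : 2 < p.re) :
    ∫ s in Ioi (0 : ℝ), kummerHalf s * Complex.exp (-(p * s)) =
      (p ^ (1 / 2 : ℂ) * (p - 2) ^ (1 / 2 : ℂ))⁻¹ := by
  have h1 := laplace_egf zero_le_two norm_mu_le hp
  have hpn : 2 < ‖p‖ := hp.trans_le (Complex.re_le_norm p)
  have hp0 : p ≠ 0 := norm_pos_iff.1 (by linarith)
  have hx : ‖2 / p‖ < 1 := by rw [norm_div, div_lt_one (by linarith)]; simpa using hpn
  have h2 := (Complex.one_div_one_sub_cpow_hasFPowerSeriesOnBall_zero (1 / 2)).hasSum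
    (y := 2 / p) (by simpa [← ofReal_norm] using hx)
  have hcoef : ∀ k : ℕ, Ring.choose ((1 / 2 : ℂ) + k - 1) k * 2 ^ k = mu k := fun k => by
    have h3 := Ring.factorial_nsmul_multichoose_eq_ascPochhammer (1 / 2 : ℂ) k
    have h4 := ascPochhammer_half k
    have hk : (k.factorial : ℂ) ≠ 0 := by exact_mod_cast k.factorial_ne_zero
    rw [Polynomial.ascPochhammer_smeval_eq_eval, nsmul_eq_mul] at h3
    have h5 : Ring.choose ((1 / 2 : ℂ) + k - 1) k = Ring.multichoose (1 / 2) k := by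
      rw [Ring.choose]
      congr 1
      ring
    rw [h5]
    refine mul_left_cancel₀ hk ?_
    linear_combination h4 + 2 ^ k * h3
  have h6 : HasSum (fun k : ℕ => (mu k : ℂ) * (p ^ (k + 1))⁻¹)
      (p⁻¹ * (1 / (1 - 2 / p) ^ (1 / 2 : ℂ))) := by
    rw [zero_add] at h2
    refine (h2.mul_left p⁻¹).congr_fun fun k => ?_
    rw [← hcoef]
    simp only [FormalMultilinearSeries.ofScalars, smul_apply,
      ContinuousMultilinearMap.mkPiAlgebraFin_apply, List.ofFn_const, List.prod_replicate,
      smul_eq_mul, div_pow, pow_succ]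
    field_simp
  have h7 : (1 - 2 / p) * p = p - 2 := by field_simp
  have hre : 0 < (1 - 2 / p).re := by
    have := (Complex.abs_re_le_norm (2 / p)).trans_lt hx
    rw [Complex.sub_re, Complex.one_re]
    linarith [(abs_lt.1 this).2]
  have hne : (1 - 2 / p) ≠ 0 := fun h => by simp [h] at hre
  have hp2 : p - 2 ≠ 0 := h7 ▸ mul_ne_zero hne hp0
  -- Both 1 - 2/p and p have positive real part, so their arguments add without leaving the
  -- principal range and the square root is multiplicative.
  have harg : (1 - 2 / p).arg + p.arg ∈ Ioc (-Real.pi) Real.pi := by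
    have a1 := abs_lt.1 (Complex.abs_arg_lt_pi_div_two_iff.2 (Or.inl hre))
    have a2 := abs_lt.1 (Complex.abs_arg_lt_pi_div_two_iff.2
      (Or.inl (by linarith : 0 < p.re)))
    constructor <;> linarith [a1.1, a1.2, a2.1, a2.2]
  have hroot : (p - 2) ^ (1 / 2 : ℂ) = (1 - 2 / p) ^ (1 / 2 : ℂ) * p ^ (1 / 2 : ℂ) := by
    rw [Complex.cpow_def_of_ne_zero hp2, Complex.cpow_def_of_ne_zero hne,
      Complex.cpow_def_of_ne_zero hp0, ← Complex.exp_add, ← h7, Complex.log_mul hne hp0 harg]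
    ring_nf
  have hsq : p ^ (1 / 2 : ℂ) * p ^ (1 / 2 : ℂ) = p := by
    rw [← Complex.cpow_add _ _ hp0]
    norm_num
  refine (h1.unique h6).trans ?_
  rw [hroot, one_div ((1 - 2 / p) ^ (1 / 2 : ℂ)), ← mul_inv]
  congr 1
  linear_combination (-(1 - 2 / p) ^ (1 / 2 : ℂ)) * hsq

end EllipticGinibre

end

open MeasureTheory Set
open Filter Topology Metric

noncomputable section

namespace EllipticGinibre

/-! ### The skew weight as a contour integral, and its Laplace transform -/

/-- Dividing the recursion for γ_{k+1} by (p + 1)^(k+1) and summing gives (p - z) X = (1 - zp) Y,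
where X and Y are the transforms of g(z, ·) and of the Kummer function. -/
lemma laplace_gFun {z p : ℂ} (h1 : 1 < p.re) (hz : ‖z‖ < p.re) :
    ∫ s in Ioi (0 : ℝ), gFun z s * Complex.exp (-((p + 1) * s)) =
      (1 - z * p) / (p - z) / sqrtSqSubOne p := by
  obtain ⟨R, hR, hRp⟩ := exists_between (max_lt h1 hz)
  obtain ⟨q, hq, hqp⟩ := exists_between (show 1 + R < 1 + p.re by linarith)
  have hR1 : 1 ≤ R := (le_max_left _ _).trans hR.le
  obtain ⟨K, -, hK⟩ := exists_gCoef_bound hR1 hq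
  have hre : (p + 1).re = p.re + 1 := by simp
  have e1 := laplace_egf (by linarith) (hK z ((le_max_right _ _).trans hR.le))
    (p := p + 1) (by rw [hre]; linarith)
  have e2 := laplace_egf zero_le_two norm_mu_le (p := p + 1) (by rw [hre]; linarith)
  have e3 := laplace_kummerHalf (p := p + 1) (by rw [hre]; linarith)
  have e3' : ∫ s in Ioi (0 : ℝ), egf (fun k => (mu k : ℂ)) s * Complex.exp (-((p + 1) * s)) =
      (sqrtSqSubOne p)⁻¹ := by
    rw [sqrtSqSubOne, show p - 1 = p + 1 - 2 by ring, ← e3]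
    rfl
  rw [e3'] at e2
  simp only [gFun_eq]
  set X := ∫ s in Ioi (0 : ℝ), egf (gCoef z) s * Complex.exp (-((p + 1) * s))
  set Y := (sqrtSqSubOne p)⁻¹
  have hp0 : p + 1 ≠ 0 := fun h => by
    have := congrArg Complex.re h
    rw [hre, Complex.zero_re] at this
    linarith
  have f1 := ((hasSum_nat_add_iff' 1).2 e1).mul_left (p + 1)
  have f2 := ((hasSum_nat_add_iff' 1).2 e2).mul_left (p + 1)
  have f3 := ((e1.mul_left (1 + z)).add (e2.mul_left (1 + z))).sub (f2.mul_left z)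
  have f4 := f1.unique (f3.congr_fun fun k => ?_)
  · simp only [Finset.sum_range_one, gCoef, mu_zero, zero_add, pow_one, Complex.ofReal_one] at f4
    have hpz : p - z ≠ 0 := fun h => by
      have := Complex.re_le_norm p
      rw [sub_eq_zero.1 h] at this
      rw [sub_eq_zero.1 h] at hz
      linarith
    rw [div_eq_mul_inv _ (sqrtSqSubOne p), div_mul_eq_mul_div, eq_div_iff hpz]
    field_simp at f4
    linear_combination f4
  · have hpk : (p + 1) ^ (k + 1) ≠ 0 := pow_ne_zero _ hp0
    rw [gCoef]
    field_simp
    ring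

namespace Contour

/-! ### Contours around the unit disc and the contour integral for the skew weight -/

variable {γ : Contour}

lemma hasSum_integral {ι : Type*} [Countable ι] {F : ι → ℂ → ℂ} {f : ℂ → ℂ} {B : ι → ℝ}
    (hc : ∀ i, ContinuousOn (F i) γ.trace) (hB : ∀ i, ∀ z ∈ γ.trace, ‖F i z‖ ≤ B i)
    (hs : Summable B) (hf : ∀ z ∈ γ.trace, HasSum (fun i => F i z) (f z)) :
    HasSum (fun i => γ.integral (F i)) (γ.integral f) := by
  have h := hasSum_integral_of_summable_integral_norm
    (F := fun i t => F i (γ.pt t) * γ.dens t) (μ := volume.restrict (Ioc (0 : ℝ) 1))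
    (fun i => integrable_of_continuousOn (hc i)) ?_
  · have e : γ.integral f = ∫ t in Ioc (0 : ℝ) 1, ∑' i, F i (γ.pt t) * γ.dens t := by
      rw [integral_eq]
      congr 1
      ext t
      rw [tsum_mul_right, (hf _ (γ.pt_mem t)).tsum_eq]
    rw [e]
    simpa only [integral_eq] using h
  · refine Summable.of_nonneg_of_le (fun i => integral_nonneg fun _ => norm_nonneg _)
      (fun i => ?_) (hs.mul_right γ.mass)
    rw [mass, ← MeasureTheory.integral_const_mul]
    refine integral_mono (integrable_of_continuousOn (hc i)).norm
      (γ.integrable_dens.norm.const_mul _) fun t => ?_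
    rw [norm_mul]
    gcongr
    exact hB i _ (γ.pt_mem t)

lemma cauchy_entire {f : ℂ → ℂ} (hf : Differentiable ℂ f) {x : ℂ} (hx : x ∉ γ.trace) :
    (γ.integral fun w => f w / (w - x)) = γ.index x * f x := by
  have h := (cauchy_formula isOpen_univ hf.differentiableOn (subset_univ γ.trace) (c := 0)
    (fun x hx => absurd (mem_univ x) hx) (by simp) hx).1 (mem_univ x)
  rw [h, sub_zero]

/-- The contour lies outside the closed unit disc and goes once around it. -/
structure AroundDisc (γ : Contour) : Prop where
  one_lt : ∀ z ∈ γ.trace, 1 < ‖z‖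
  index_zero : γ.index 0 = 1

namespace AroundDisc

lemma notMem (hγ : γ.AroundDisc) {x : ℂ} (hx : ‖x‖ ≤ 1) : x ∉ γ.trace :=
  fun h => (hγ.one_lt x h).not_ge hx

lemma ne_zero (hγ : γ.AroundDisc) {z : ℂ} (hz : z ∈ γ.trace) : z ≠ 0 :=
  norm_pos_iff.1 (zero_lt_one.trans (hγ.one_lt z hz))

lemma one_sub_sq_ne_zero (hγ : γ.AroundDisc) {z : ℂ} (hz : z ∈ γ.trace) : 1 - z ^ 2 ≠ 0 := by
  intro h
  have h1 : ‖z‖ ^ 2 = 1 := by rw [← norm_pow, ← sub_eq_zero.1 h, norm_one]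
  nlinarith [hγ.one_lt z hz]

lemma index_eq_one (hγ : γ.AroundDisc) {x : ℂ} (hx : ‖x‖ ≤ 1) : γ.index x = 1 := by
  rw [index_eq_of_norm_lt (x₀ := 0), hγ.index_zero]
  intro w hw
  simpa using hx.trans_lt (hγ.one_lt w hw)

lemma continuousOn_div (hγ : γ.AroundDisc) {f : ℂ → ℂ} (hf : ContinuousOn f γ.trace) :
    ContinuousOn (fun z => f z / (1 - z ^ 2)) γ.trace :=
  hf.div (by fun_prop) fun _ => hγ.one_sub_sq_ne_zero

lemma continuousOn_comp_inv (hγ : γ.AroundDisc) {f : ℂ → ℂ} (hf : Continuous f) :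
    ContinuousOn (fun z => f z⁻¹) γ.trace :=
  hf.comp_continuousOn (continuousOn_inv₀.mono fun _ => hγ.ne_zero)

/-- Partial fractions, 1/(1 - z²) = (1/(z + 1) - 1/(z - 1))/2; both poles have index 1. -/
lemma integral_entire (hγ : γ.AroundDisc) {f : ℂ → ℂ} (hf : Differentiable ℂ f) :
    (γ.integral fun z => f z / (1 - z ^ 2)) = (f (-1) - f 1) / 2 := by
  have h1 : (1 : ℂ) ∉ γ.trace := hγ.notMem (by simp)
  have h2 : (-1 : ℂ) ∉ γ.trace := hγ.notMem (by simp)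
  have hc := hf.continuous.continuousOn (s := γ.trace)
  have e : (γ.integral fun z => f z / (1 - z ^ 2)) =
      γ.integral fun z => 1 / 2 * (f z / (z - (-1)) - f z / (z - 1)) :=
    integral_congr fun z hz => by
      have a1 := sub_ne_zero_of_notMem h1 hz
      have a2 := sub_ne_zero_of_notMem h2 hz
      have a3 : 1 - z ^ 2 = -((z - 1) * (z - (-1))) := by ring
      rw [a3]
      field_simp
      ring
  rw [e, integral_const_mul, integral_sub (continuousOn_div_sub hc h2) (continuousOn_div_sub hc h1),
    cauchy_entire hf h1, cauchy_entire hf h2, hγ.index_eq_one (by simp), hγ.index_eq_one (by simp)]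
  ring

lemma inv_trace_subset (hγ : γ.AroundDisc) (h0 : (0 : ℂ) ∉ γ.trace) :
    (γ.inv h0).trace ⊆ ball 0 1 := by
  rw [inv_trace]
  rintro _ ⟨z, hz, rfl⟩
  rw [mem_ball_zero_iff, norm_inv]
  exact inv_lt_one_of_one_lt₀ (hγ.one_lt z hz)

lemma inv_index_eq_zero (hγ : γ.AroundDisc) (h0 : (0 : ℂ) ∉ γ.trace) :
    ∀ x ∉ ball (0 : ℂ) 1, (γ.inv h0).index x = 0 := fun x hx => by
  refine index_eq_zero_of_norm_lt (c := 0) fun w hw => ?_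
  have h1 := hγ.inv_trace_subset h0 hw
  rw [mem_ball_zero_iff] at h1 hx
  simp only [sub_zero]
  linarith [not_lt.1 hx]

lemma one_sub_sq_ne_zero_of_mem_ball {z : ℂ} (hz : z ∈ ball (0 : ℂ) 1) : 1 - z ^ 2 ≠ 0 := by
  intro h
  rw [mem_ball_zero_iff] at hz
  have h1 : ‖z‖ ^ 2 = 1 := by rw [← norm_pow, ← sub_eq_zero.1 h, norm_one]
  nlinarith [norm_nonneg z]

/-- Inversion carries the contour into the open unit disc, where f(y)/(1 - y²) is holomorphic. -/
lemma integral_comp_inv (hγ : γ.AroundDisc) {f : ℂ → ℂ} (hf : Differentiable ℂ f) :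
    (γ.integral fun z => f z⁻¹ / (1 - z ^ 2)) = 0 := by
  have h0 : (0 : ℂ) ∉ γ.trace := hγ.notMem (by simp)
  have h1 : (γ.inv h0).integral (fun z => f z / (1 - z ^ 2)) = 0 :=
    integral_eq_zero isOpen_ball (hf.differentiableOn.div (by fun_prop)
      fun z hz => one_sub_sq_ne_zero_of_mem_ball hz) (hγ.inv_trace_subset h0)
      (hγ.inv_index_eq_zero h0)
  rw [← h1, inv_integral h0]
  refine integral_congr fun z hz => ?_
  have a1 := hγ.ne_zero hz
  have a2 := hγ.one_sub_sq_ne_zero hz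
  have a3 : 1 - (z⁻¹) ^ 2 = -(1 - z ^ 2) / z ^ 2 := by field_simp; ring
  rw [a3]
  field_simp

/-- One step of a recursion: the integrand may change by an entire function of z and an entire
function of z⁻¹, and only the former contributes. -/
lemma integral_shift (hγ : γ.AroundDisc) {f g p q : ℂ → ℂ} (hg : ContinuousOn g γ.trace)
    (hp : Differentiable ℂ p) (hq : Differentiable ℂ q)
    (hf : ∀ z ∈ γ.trace, f z = g z + p z + q z⁻¹) :
    (γ.integral fun z => f z / (1 - z ^ 2)) =
      (γ.integral fun z => g z / (1 - z ^ 2)) + (p (-1) - p 1) / 2 := by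
  have hpc := hγ.continuousOn_div hp.continuous.continuousOn
  have hqc := hγ.continuousOn_div (hγ.continuousOn_comp_inv hq.continuous)
  have hgc := hγ.continuousOn_div hg
  have e : (γ.integral fun z => f z / (1 - z ^ 2)) =
      γ.integral fun z => g z / (1 - z ^ 2) + (p z / (1 - z ^ 2) + q z⁻¹ / (1 - z ^ 2)) :=
    integral_congr fun z hz => by
      rw [hf z hz]
      ring
  have hpq : ContinuousOn (fun z => p z / (1 - z ^ 2) + q z⁻¹ / (1 - z ^ 2)) γ.trace := hpc.add hqc
  rw [e, integral_add hgc hpq, integral_add hpc hqc, hγ.integral_entire hp,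
    hγ.integral_comp_inv hq, add_zero]

lemma continuousOn_gCoef_mul (hγ : γ.AroundDisc) (j k : ℕ) :
    ContinuousOn (fun z => gCoef z k * gCoef z⁻¹ j) γ.trace :=
  (differentiable_gCoef k).continuous.continuousOn.mul
    (hγ.continuousOn_comp_inv (differentiable_gCoef j).continuous)

/-- The integrals satisfy the recursion of `eCoef_succ_succ` because (1 + z)(1 + z⁻¹) = (1 + z) + (1
+ z⁻¹): modulo entire functions of z and of z⁻¹, the product of order (j+1, k+1) is the sum of those
of orders (j, k+1) and (j+1, k). The residues of the corrections at ±1 give the terms with μ, since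
γ_k(±1) = ∓μ_k. The two boundary recursions arise in the same way. -/
lemma eCoef_eq (hγ : γ.AroundDisc) (j k : ℕ) : (eCoef j k : ℂ) =
    4 * Real.pi * γ.integral fun z => gCoef z k * gCoef z⁻¹ j / (1 - z ^ 2) := by
  induction j generalizing k with
  | zero =>
    induction k with
    | zero =>
      rw [hγ.integral_shift (g := fun _ => 0) (p := fun _ => 1) (q := fun _ => 0)
        continuousOn_const (by fun_prop) (by fun_prop) fun z hz => ?_]
      · simp [eCoef_zero_zero, Contour.integral_eq]
      · have := hγ.ne_zero hz
        simp only [gCoef]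
        field_simp
        simp
    | succ k ih =>
      rw [hγ.integral_shift (g := fun z => gCoef z k * gCoef z⁻¹ 0)
        (p := fun z => -gCoef z k - mu k + mu (k + 1)) (q := fun z => -(mu k * z))
        (hγ.continuousOn_gCoef_mul 0 k)
        ((((differentiable_gCoef k).fun_neg).sub_const _).add_const _) (by fun_prop)
        fun z hz => ?_]
      · rw [mul_add, ← ih, eCoef_zero_succ, gCoef_one, gCoef_neg_one]
        push_cast
        ring
      · have := hγ.ne_zero hz
        simp only [gCoef]
        field_simp
        ring
  | succ j ihj =>
    induction k with
    | zero =>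
      rw [hγ.integral_shift (g := fun z => gCoef z 0 * gCoef z⁻¹ j)
        (p := fun z => -(mu j * z) - mu j + mu (j + 1)) (q := fun z => -gCoef z j)
        (hγ.continuousOn_gCoef_mul j 0) (by fun_prop) (differentiable_gCoef j).fun_neg
        fun z hz => ?_]
      · rw [mul_add, ← ihj, eCoef_succ_zero]
        push_cast
        ring
      · have := hγ.ne_zero hz
        simp only [gCoef]
        field_simp
        ring
    | succ k ihk =>
      -- With α, β the affine parts of γ_{k+1}(z), γ_{j+1}(z⁻¹), the correction is zβ γ_k(z) + z⁻¹α
      -- γ_j(z⁻¹) + αβ. Here zβ is affine in z and z⁻¹α is affine in z⁻¹; `p` and `q` separate the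
      -- two kinds of terms.
      rw [hγ.integral_shift
        (g := fun z => gCoef z (k + 1) * gCoef z⁻¹ j + gCoef z k * gCoef z⁻¹ (j + 1))
        (p := fun z => gCoef z k * ((1 + z) * mu j - mu (j + 1)) + mu j * mu k +
          (mu j - mu (j + 1)) * (mu k - mu (k + 1)) + mu j * (mu k - mu (k + 1)) * z)
        (q := fun z => gCoef z j * ((1 + z) * mu k - mu (k + 1)) + (mu j - mu (j + 1)) * mu k * z)
        ((hγ.continuousOn_gCoef_mul j (k + 1)).add (hγ.continuousOn_gCoef_mul (j + 1) k))
        ?_ ?_ fun z hz => ?_]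
      · simp only [add_div]
        rw [integral_add (hγ.continuousOn_div (hγ.continuousOn_gCoef_mul j (k + 1)))
          (hγ.continuousOn_div (hγ.continuousOn_gCoef_mul (j + 1) k)), mul_add, mul_add, ← ihj,
          ← ihk, eCoef_succ_succ, gCoef_one, gCoef_neg_one]
        push_cast
        ring
      · have := differentiable_gCoef k
        fun_prop
      · have := differentiable_gCoef j
        fun_prop
      · have h : z * z⁻¹ = 1 := mul_inv_cancel₀ (hγ.ne_zero hz)
        rw [gCoef, gCoef]
        linear_combination (gCoef z k * gCoef z⁻¹ j + gCoef z k * (mu j - mu (j + 1)) +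
          gCoef z⁻¹ j * (mu k - mu (k + 1)) + (mu k - mu (k + 1)) * (mu j - mu (j + 1))) * h

lemma exists_gCoef_bound_trace (γ : Contour) :
    ∃ K q : ℝ, 0 ≤ K ∧ 0 ≤ q ∧ ∀ z ∈ γ.trace, ∀ k, ‖gCoef z k‖ ≤ K * q ^ k := by
  obtain ⟨R, hR, h⟩ := γ.exists_norm_lt
  obtain ⟨K, hK, hb⟩ := exists_gCoef_bound (R := 1 + R) (q := 3 + R) (by linarith) (by linarith)
  exact ⟨K, _, hK, by linarith, fun z hz => hb z (by linarith [h z hz])⟩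

/-- `eCoef_eq` summed against a^j b^k/(j! k!); geometric bounds on γ_k, uniform on the contour and
on its inverse, allow termwise integration. -/
lemma weightE_eq (hγ : γ.AroundDisc) {a b : ℝ} (ha : 0 ≤ a) (hb : 0 ≤ b) : (weightE a b : ℂ) =
    4 * Real.pi * γ.integral fun z => gFun z b * gFun z⁻¹ a / (1 - z ^ 2) := by
  have h0 : (0 : ℂ) ∉ γ.trace := hγ.notMem (by simp)
  obtain ⟨K, q, hK, hq, hKq⟩ := exists_gCoef_bound_trace γ
  obtain ⟨K', q', hK', hq', hKq'⟩ := exists_gCoef_bound_trace (γ.inv h0)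
  replace hKq' : ∀ z ∈ γ.trace, ∀ k, ‖gCoef z⁻¹ k‖ ≤ K' * q' ^ k := fun z hz =>
    hKq' _ (by rw [inv_trace]; exact mem_image_of_mem _ hz)
  obtain ⟨C, hC⟩ := γ.exists_bound (f := fun z => 1 / (1 - z ^ 2))
    (hγ.continuousOn_div continuousOn_const)
  have h1 := (Complex.hasSum_ofReal.2 (weightE_hasSum ha hb))
  have h2 := (hasSum_integral (γ := γ) (ι := ℕ × ℕ)
    (F := fun q z => gCoef z q.2 * gCoef z⁻¹ q.1 / (1 - z ^ 2) *
      ((a : ℂ) ^ q.1 / q.1.factorial * ((b : ℂ) ^ q.2 / q.2.factorial)))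
    (f := fun z => gFun z b * gFun z⁻¹ a / (1 - z ^ 2))
    (B := fun k => K * K' * C * ((q' * a) ^ k.1 / k.1.factorial * ((q * b) ^ k.2 / k.2.factorial)))
    (fun k => (hγ.continuousOn_div (hγ.continuousOn_gCoef_mul _ _)).mul continuousOn_const)
    (fun k z hz => ?_) ((summable_prod_exp _ _ (by positivity) (by positivity)).mul_left _)
    fun z hz => ?_).mul_left (4 * Real.pi : ℂ)
  · refine h1.unique (h2.congr_fun fun k => ?_)
    rw [integral_mul_const, ← mul_assoc (4 * Real.pi : ℂ), ← hγ.eCoef_eq]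
    push_cast
    ring
  · have e1 := hKq z hz k.2
    have e2 := hKq' z hz k.1
    have e3 := hC z hz
    have hC0 : 0 ≤ C := (norm_nonneg _).trans e3
    rw [norm_div, norm_one] at e3
    rw [norm_mul, norm_div, norm_mul, div_eq_mul_one_div]
    have e4 : ‖(a : ℂ) ^ k.1 / k.1.factorial * ((b : ℂ) ^ k.2 / k.2.factorial)‖ =
        a ^ k.1 / k.1.factorial * (b ^ k.2 / k.2.factorial) := by
      simp [abs_of_nonneg ha, abs_of_nonneg hb]
    rw [e4]
    calc _ ≤ K * q ^ k.2 * (K' * q' ^ k.1) * C *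
          (a ^ k.1 / k.1.factorial * (b ^ k.2 / k.2.factorial)) := by gcongr
      _ = _ := by rw [mul_pow, mul_pow]; ring
  · have s1 := egf_hasSum (hKq z hz) b
    have s2 := egf_hasSum (hKq' z hz) a
    have s0 := summable_mul_of_summable_norm (summable_egf_norm (hKq' z hz) a)
      (summable_egf_norm (hKq z hz) b)
    have s3 := (s2.mul s1 s0).div_const (1 - z ^ 2)
    rw [gFun_eq, gFun_eq, mul_comm (egf (gCoef z) b)]
    refine s3.congr_fun fun k => ?_
    ring

/-- In y = z⁻¹ the only pole inside the unit disc is p⁻¹. The inverted contour has index 0 - 1 = -1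
there, and the factor (p⁻¹ - p)/(p(1 - p⁻²)) is another -1. -/
lemma integral_reproducing (hγ : γ.AroundDisc) {f : ℂ → ℂ} (hf : Differentiable ℂ f) {p : ℂ}
    (hp : p ∉ γ.trace) (hp1 : 1 < ‖p‖) (hi : γ.index p = 0) :
    (γ.integral fun z => f z⁻¹ / (1 - z ^ 2) * ((1 - z * p) / (p - z))) = f p⁻¹ := by
  have h0 : (0 : ℂ) ∉ γ.trace := hγ.notMem (by simp)
  have hp0 : p ≠ 0 := norm_pos_iff.1 (zero_lt_one.trans hp1)
  have hpb : p⁻¹ ∈ ball (0 : ℂ) 1 := by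
    rw [mem_ball_zero_iff, norm_inv]
    exact inv_lt_one_of_one_lt₀ hp1
  have hpt : p⁻¹ ∉ (γ.inv h0).trace := by
    rw [inv_trace]
    rintro ⟨z, hz, h⟩
    exact hp (inv_injective h ▸ hz)
  have h1 := (cauchy_formula isOpen_ball (f := fun z => f z * (z - p) / (p * (1 - z ^ 2)))
    ((hf.mul (by fun_prop)).differentiableOn.fun_div (by fun_prop)
      fun z hz => mul_ne_zero hp0 (one_sub_sq_ne_zero_of_mem_ball hz)) (hγ.inv_trace_subset h0)
      (hγ.inv_index_eq_zero h0) (by simp) hpt).1 hpb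
  rw [inv_index h0 hpt, if_neg (inv_ne_zero hp0), inv_inv, hi, hγ.index_zero, inv_integral h0] at h1
  have hp2 : p ^ 2 - 1 ≠ 0 := fun h => by
    have h1 : ‖p‖ ^ 2 = 1 := by rw [← norm_pow, sub_eq_zero.1 h, norm_one]
    nlinarith
  have e : (0 - 1 - 0) * (f p⁻¹ * (p⁻¹ - p) / (p * (1 - p⁻¹ ^ 2))) = f p⁻¹ := by
    field_simp
    ring
  rw [e] at h1
  rw [← h1]
  refine integral_congr fun z hz => ?_
  have a1 := hγ.ne_zero hz
  have a2 := hγ.one_sub_sq_ne_zero hz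
  have a4 : p - z ≠ 0 := fun h => hp (sub_eq_zero.1 h ▸ hz)
  have a3 : 1 - (z⁻¹) ^ 2 = -(1 - z ^ 2) / z ^ 2 := by field_simp; ring
  have a5 : z⁻¹ - p⁻¹ = (p - z) / (z * p) := by field_simp
  rw [a3, a5]
  field_simp

end AroundDisc

lemma circle_aroundDisc {R : ℝ} (hR : 1 < R) : (circle 0 R).AroundDisc where
  one_lt z hz := by
    have := circle_trace 0 (by linarith) hz
    rw [mem_sphere_zero_iff_norm] at this
    rwa [this]
  index_zero := circle_index_of_mem (by simp; linarith)

end Contour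

-- On the circle of radius q/2 > 1, g(z, b) grows in b at most at the rate q, because q > 1 + q/2;
-- the contour representation passes this bound on to the weight.
open Contour in
lemma exists_weightE_bound {a : ℝ} (ha : 0 ≤ a) {q : ℝ} (hq : 2 < q) :
    ∃ C, 0 ≤ C ∧ ∀ b, 0 ≤ b → ‖(weightE a b : ℂ)‖ ≤ C * Real.exp (q * b) := by
  have hγ := circle_aroundDisc (R := q / 2) (by linarith)
  obtain ⟨K, hK, hKq⟩ := exists_gCoef_bound (R := q / 2) (q := q) (by linarith) (by linarith)
  obtain ⟨C, hC⟩ := (circle 0 (q / 2)).exists_bound (f := fun z => gFun z⁻¹ a / (1 - z ^ 2))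
    (hγ.continuousOn_div (hγ.continuousOn_comp_inv (differentiable_gFun a).continuous))
  have hC0 : 0 ≤ C := (norm_nonneg _).trans (hC _ ((circle 0 (q / 2)).pt_mem 0))
  have hm := (circle 0 (q / 2)).mass_nonneg
  refine ⟨4 * Real.pi * (K * C * (circle 0 (q / 2)).mass), by positivity, fun b hb => ?_⟩
  rw [hγ.weightE_eq ha hb, norm_mul]
  have h4 : ‖(4 * Real.pi : ℂ)‖ = 4 * Real.pi := by
    rw [norm_mul, Complex.norm_real, Real.norm_of_nonneg Real.pi_nonneg]
    simp
  have h5 : ‖(circle 0 (q / 2)).integral fun z => gFun z b * gFun z⁻¹ a / (1 - z ^ 2)‖ ≤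
      K * Real.exp (q * b) * C * (circle 0 (q / 2)).mass := norm_integral_le fun z hz => ?_
  · rw [h4]
    calc _ ≤ 4 * Real.pi * (K * Real.exp (q * b) * C * (circle 0 (q / 2)).mass) := by gcongr
      _ = _ := by ring
  rw [mul_div_assoc, norm_mul]
  have hz' := circle_trace 0 (by linarith) hz
  rw [mem_sphere_zero_iff_norm] at hz'
  have h1 := norm_egf_le (hKq z hz'.le) b
  rw [abs_of_nonneg hb, ← gFun_eq] at h1
  gcongr
  exact hC z hz

-- The representation is transformed under the integral sign on a circle of radius R with 1 < R < Re
-- p. There `laplace_gFun` applies, and p lies outside the circle, so `integral_reproducing`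
-- evaluates the result at p⁻¹.
open Contour in
lemma laplace_weightE {a : ℝ} (ha : 0 ≤ a) {p : ℂ} (hp : 1 < p.re) :
    ∫ b in Ioi (0 : ℝ), (weightE a b : ℂ) * Complex.exp (-((p + 1) * b)) =
      4 * Real.pi * (gFun p⁻¹ a / sqrtSqSubOne p) := by
  obtain ⟨R, hR, hRp⟩ := exists_between hp
  obtain ⟨q, hq, hqp⟩ := exists_between (show 1 + R < 1 + p.re by linarith)
  have hγ := circle_aroundDisc hR
  have hpn : R < ‖p‖ := hRp.trans_le (Complex.re_le_norm p)
  obtain ⟨K, hK, hKq⟩ := exists_gCoef_bound hR.le hq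
  set γ := circle 0 R with hγd
  have htr : ∀ z ∈ γ.trace, ‖z‖ = R := fun z hz => by
    have := circle_trace 0 (by linarith) hz
    rwa [mem_sphere_zero_iff_norm] at this
  obtain ⟨C, hC⟩ := γ.exists_bound (f := fun z => gFun z⁻¹ a / (1 - z ^ 2))
    (hγ.continuousOn_div (hγ.continuousOn_comp_inv (differentiable_gFun a).continuous))
  have hpt := γ.continuous_pt.measurable
  have h1 : ∫ b in Ioi (0 : ℝ), (weightE a b : ℂ) * Complex.exp (-((p + 1) * b)) =
      ∫ b in Ioi (0 : ℝ), 4 * Real.pi * γ.integral fun z => gFun z⁻¹ a / (1 - z ^ 2) *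
        (gFun z b * Complex.exp (-((p + 1) * b))) := by
    refine setIntegral_congr_fun measurableSet_Ioi fun b hb => ?_
    rw [hγ.weightE_eq ha (le_of_lt hb), mul_assoc, ← Contour.integral_mul_const]
    congr 2
    ext z
    ring
  have h2 := (integral_swap (γ := γ) (μ := volume.restrict (Ioi (0 : ℝ)))
    (F := fun b z => gFun z⁻¹ a / (1 - z ^ 2) * (gFun z b * Complex.exp (-((p + 1) * b))))
    (b := fun b => C * (K * Real.exp (-(p.re + 1 - q) * b))) ?_ ?_ ?_).2
  · rw [h1, MeasureTheory.integral_const_mul, h2]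
    congr 1
    rw [← hγ.integral_reproducing (differentiable_gFun a) (p := p)
      (fun h => hpn.ne' (htr p h)) (hR.trans hpn)
      (circle_index_of_notMem (by linarith) (by simpa using hpn)), div_eq_mul_inv,
      ← Contour.integral_mul_const]
    refine integral_congr fun z hz => ?_
    rw [MeasureTheory.integral_const_mul, laplace_gFun hp (by rwa [htr z hz])]
    ring
  · have m1 : Measurable fun x : ℝ × ℝ => gFun (γ.pt x.2) x.1 :=
      measurable_gFun.comp ((hpt.comp measurable_snd).prodMk measurable_fst)
    have m2 : Measurable fun x : ℝ × ℝ => gFun (γ.pt x.2)⁻¹ a :=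
      measurable_gFun.comp ((hpt.comp measurable_snd).inv.prodMk measurable_const)
    have m3 : Measurable fun x : ℝ × ℝ => γ.pt x.2 := hpt.comp measurable_snd
    refine Measurable.aestronglyMeasurable ?_
    fun_prop
  · exact ((exp_neg_integrableOn_Ioi 0 (by linarith)).const_mul _).const_mul _
  · refine (ae_restrict_mem measurableSet_Ioi).mono fun b hb z hz => ?_
    have h3 := norm_egf_le (hKq z (htr z hz).le) b
    rw [abs_of_nonneg (le_of_lt hb), ← gFun_eq] at h3
    rw [norm_mul, norm_mul, Complex.norm_exp]
    have h4 : (-((p + 1) * (b : ℂ))).re = -((p.re + 1) * b) := by simp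
    have h5 : Real.exp (-(p.re + 1 - q) * b) = Real.exp (q * b) * Real.exp (-((p.re + 1) * b)) := by
      rw [← Real.exp_add]
      ring_nf
    have hC0 : 0 ≤ C := (norm_nonneg _).trans (hC z hz)
    rw [h4, h5, ← mul_assoc K]
    gcongr
    exact hC z hz

end EllipticGinibre

end

open MeasureTheory Set
open Filter Topology Metric

noncomputable section

namespace EllipticGinibre

/-! ### Integrals of functions with finitely many poles -/

variable {ι : Type*} {a : ι → ℂ}

namespace Contour

/-- The contour lies in `U`, goes once around each `a k`, and around no point outside `U`. -/
structure Around (γ : Contour) (a : ι → ℂ) (U : Set ℂ) : Prop where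
  subset : γ.trace ⊆ U
  index_one : ∀ k, a k ∉ γ.trace ∧ γ.index (a k) = 1
  index_zero : ∀ x ∉ U, γ.index x = 0

variable {γ : Contour} {U : Set ℂ}

lemma Around.ne (hγ : γ.Around a U) {z : ℂ} (hz : z ∈ γ.trace) (k : ι) : z ≠ a k :=
  fun h => (hγ.index_one k).1 (h ▸ hz)

lemma Around.ne_of_index_eq_zero (hγ : γ.Around a U) {x : ℂ} (hx : γ.index x = 0) (k : ι) :
    x ≠ a k := fun h => by
  have := (hγ.index_one k).2
  rw [← h, hx] at this
  exact zero_ne_one this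

end Contour

variable [Fintype ι]

/-- The monic polynomial function with roots `a k`. -/
def poleProd (a : ι → ℂ) (z : ℂ) : ℂ := ∏ k, (z - a k)

lemma poleProd_ne_zero {z : ℂ} (h : ∀ k, z ≠ a k) : poleProd a z ≠ 0 :=
  Finset.prod_ne_zero_iff.2 fun k _ => sub_ne_zero.2 (h k)

lemma differentiable_poleProd : Differentiable ℂ (poleProd a) := by
  unfold poleProd
  fun_prop

namespace Contour

variable {γ : Contour} {U : Set ℂ}

lemma Around.poleProd_ne_zero (hγ : γ.Around a U) {z : ℂ} (hz : z ∈ γ.trace) :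
    poleProd a z ≠ 0 := EllipticGinibre.poleProd_ne_zero (hγ.ne hz)

lemma Around.continuousOn_div (hγ : γ.Around a U) {h : ℂ → ℂ} (hh : ContinuousOn h γ.trace) :
    ContinuousOn (fun z => h z / poleProd a z) γ.trace :=
  hh.div differentiable_poleProd.continuous.continuousOn fun _ => hγ.poleProd_ne_zero

/-- Division by the pole polynomial and the resulting values of Cauchy-type integrals. -/
lemma exists_residue (hU : IsOpen U) {h : ℂ → ℂ} (hh : DifferentiableOn ℂ h U)
    (ha : ∀ k, a k ∈ U) :
    ∃ (p : Polynomial ℂ) (r : ℂ → ℂ), p.degree < Fintype.card ι ∧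
      (∀ x ∈ U, h x = p.eval x + poleProd a x * r x) ∧
      ∀ γ : Contour, γ.Around a U → ∀ x ∉ γ.trace,
        (γ.index x = 0 → (γ.integral fun w => h w / poleProd a w / (w - x)) =
          -(p.eval x / poleProd a x)) ∧
        (x ∈ U → γ.index x = 1 →
          (γ.integral fun w => h w / poleProd a w / (w - x)) = r x) := by
  obtain ⟨p, r, h1, -, h2, h3⟩ := exists_residue_formula a hU hh ha
  refine ⟨p, r, h1, h2, fun γ hγ x hx => ?_⟩
  simp only [div_div]
  exact h3 γ hγ.subset hγ.index_one hγ.index_zero x hx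

/-- The residue formula for w h(w) at x = 0, a point off U and hence of index 0; the value does not
mention the contour. -/
lemma exists_integral_div_eq (hU : IsOpen U) (h0 : (0 : ℂ) ∉ U) {h : ℂ → ℂ}
    (hh : DifferentiableOn ℂ h U) (ha : ∀ k, a k ∈ U) :
    ∃ c, ∀ γ : Contour, γ.Around a U → (γ.integral fun w => h w / poleProd a w) = c := by
  obtain ⟨p, r, -, -, h3⟩ := exists_residue hU (h := fun w => w * h w)
    (differentiableOn_id.mul hh) ha
  refine ⟨-(p.eval 0 / poleProd a 0), fun γ hγ => ?_⟩
  have h0γ : (0 : ℂ) ∉ γ.trace := fun h => h0 (hγ.subset h)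
  rw [← (h3 γ hγ 0 h0γ).1 (hγ.index_zero 0 h0)]
  refine integral_congr fun w hw => ?_
  have := ne_zero_of_mem_trace h0γ hw
  have := hγ.poleProd_ne_zero hw
  rw [sub_zero]
  field_simp

/-- The decomposition (1 - xw)/(w - x) = -x + (1 - x²)/(w - x) reduces the kernel to two integrals
that are already evaluated. -/
lemma exists_integral_kernel_eq (hU : IsOpen U) (h0 : (0 : ℂ) ∉ U) {h : ℂ → ℂ}
    (hh : DifferentiableOn ℂ h U) (ha : ∀ k, a k ∈ U) :
    ∃ (p : Polynomial ℂ) (c : ℂ), ∀ γ : Contour, γ.Around a U → ∀ x ∉ γ.trace, γ.index x = 0 →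
      (γ.integral fun w => h w / poleProd a w * ((1 - x * w) / (w - x))) =
        -(x * c) - (1 - x ^ 2) * (p.eval x / poleProd a x) := by
  obtain ⟨p, r, -, -, h3⟩ := exists_residue hU hh ha
  obtain ⟨c, hc⟩ := exists_integral_div_eq hU h0 hh ha
  refine ⟨p, c, fun γ hγ x hx hi => ?_⟩
  have hcont := hγ.continuousOn_div (hh.continuousOn.mono hγ.subset)
  have e : (γ.integral fun w => h w / poleProd a w * ((1 - x * w) / (w - x))) =
      γ.integral fun w => -x * (h w / poleProd a w) +
        (1 - x ^ 2) * (h w / poleProd a w / (w - x)) := integral_congr fun w hw => by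
    have h1 := sub_ne_zero_of_notMem hx hw
    have h2 : (1 - x * w) / (w - x) = -x + (1 - x ^ 2) / (w - x) := by
      field_simp
      ring
    rw [h2]
    ring
  rw [e, integral_add (hcont.const_mul _) ((continuousOn_div_sub hcont hx).const_mul _),
    integral_const_mul, integral_const_mul, hc γ hγ, (h3 γ hγ x hx).1 hi]
  ring

/-- Since (z - w)/(1 - zw) = -(1 - z⁻¹w)/(w - z⁻¹), the inner integral is the preceding one at x =
z⁻¹. Its value is holomorphic for z in U because the inverses of the poles avoid U, so the outer
integral is again independent of the contour. -/
lemma exists_integral_integral_eq (hU : IsOpen U) (h0 : (0 : ℂ) ∉ U) {h₁ h₂ : ℂ → ℂ}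
    (hh₁ : DifferentiableOn ℂ h₁ U) (hh₂ : DifferentiableOn ℂ h₂ U) (ha : ∀ k, a k ∈ U)
    (ha' : ∀ k, (a k)⁻¹ ∉ U) :
    ∃ c, ∀ γ₁ γ₂ : Contour, γ₁.Around a U → γ₂.Around a U →
      (∀ z ∈ γ₁.trace, z⁻¹ ∉ γ₂.trace ∧ γ₂.index z⁻¹ = 0) →
      (γ₁.integral fun z => γ₂.integral fun w =>
        h₁ z / poleProd a z * (h₂ w / poleProd a w) * ((z - w) / (1 - z * w))) = c := by
  obtain ⟨p, c, hpc⟩ := exists_integral_kernel_eq hU h0 hh₂ ha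
  have hU0 : ∀ z ∈ U, z ≠ 0 := fun z hz h => h0 (h ▸ hz)
  have hd : DifferentiableOn ℂ (fun z => h₁ z * (z⁻¹ * c +
      (1 - z⁻¹ ^ 2) * (p.eval z⁻¹ / poleProd a z⁻¹))) U := by
    have hinv : DifferentiableOn ℂ (fun z : ℂ => z⁻¹) U := differentiableOn_inv.mono hU0
    refine hh₁.mul ((hinv.mul_const c).add (((hinv.pow 2).const_sub 1).mul
      ((p.differentiable.comp_differentiableOn hinv).div
        (differentiable_poleProd.comp_differentiableOn hinv) fun z hz => ?_)))
    exact poleProd_ne_zero fun k hk => ha' k (by rw [← hk, inv_inv]; exact hz)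
  obtain ⟨d, hd⟩ := exists_integral_div_eq hU h0 hd ha
  refine ⟨d, fun γ₁ γ₂ hγ₁ hγ₂ h12 => ?_⟩
  rw [← hd γ₁ hγ₁]
  refine integral_congr fun z hz => ?_
  have hz0 := hU0 z (hγ₁.subset hz)
  have e : (γ₂.integral fun w =>
      h₁ z / poleProd a z * (h₂ w / poleProd a w) * ((z - w) / (1 - z * w))) =
      γ₂.integral fun w => -(h₁ z / poleProd a z) *
        (h₂ w / poleProd a w * ((1 - z⁻¹ * w) / (w - z⁻¹))) := integral_congr fun w hw => by
    have h1 := sub_ne_zero_of_notMem (h12 z hz).1 hw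
    have h2 : (z - w) / (1 - z * w) = -((1 - z⁻¹ * w) / (w - z⁻¹)) := by
      have h3 : 1 - z * w ≠ 0 := fun h => h1 (by field_simp; linear_combination -h)
      have h4 : w - z⁻¹ = -(1 - z * w) / z := by field_simp; ring
      rw [h4]
      field_simp
    rw [h2]
    ring
  rw [e, integral_const_mul, hpc γ₂ hγ₂ _ (h12 z hz).1 (h12 z hz).2]
  ring

lemma integral_div_one_sub_sq {f : ℂ → ℂ} (hf : ContinuousOn f γ.trace)
    (h1 : (1 : ℂ) ∉ γ.trace) (h2 : (-1 : ℂ) ∉ γ.trace) :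
    (γ.integral fun z => f z / (1 - z ^ 2)) =
      1 / 2 * ((γ.integral fun z => f z / (z - (-1))) - γ.integral fun z => f z / (z - 1)) := by
  rw [← integral_sub (continuousOn_div_sub hf h2) (continuousOn_div_sub hf h1),
    ← integral_const_mul]
  refine integral_congr fun z hz => ?_
  have a1 := sub_ne_zero_of_notMem h1 hz
  have a2 := sub_ne_zero_of_notMem h2 hz
  have a3 : 1 - z ^ 2 = -((z - 1) * (z - (-1))) := by ring
  rw [a3]
  field_simp
  ring

/-- Partial fractions in w: the coefficients are 1/2 at ±1 and -1 at z⁻¹. -/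
lemma integral_kernel_split {f : ℂ → ℂ} (hf : ContinuousOn f γ.trace) (h1 : (1 : ℂ) ∉ γ.trace)
    (h2 : (-1 : ℂ) ∉ γ.trace) {z : ℂ} (hz0 : z ≠ 0) (hz : z⁻¹ ∉ γ.trace) :
    (γ.integral fun w => f w / (1 - w ^ 2) * ((z - w) / (1 - z * w))) =
      1 / 2 * ((γ.integral fun w => f w / (w - 1)) + γ.integral fun w => f w / (w - (-1))) -
        γ.integral fun w => f w / (w - z⁻¹) := by
  have c1 := continuousOn_div_sub hf h1
  have c2 := continuousOn_div_sub hf h2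
  have c3 := continuousOn_div_sub hf hz
  have c4 : ContinuousOn (fun w => 1 / 2 * (f w / (w - 1) + f w / (w - (-1)))) γ.trace :=
    (c1.add c2).const_mul _
  rw [← integral_add c1 c2, ← integral_const_mul, ← integral_sub c4 c3]
  refine integral_congr fun w hw => ?_
  have a1 := sub_ne_zero_of_notMem h1 hw
  have a2 := sub_ne_zero_of_notMem h2 hw
  have a3 := sub_ne_zero_of_notMem hz hw
  have a4 : 1 - w ^ 2 = -((w - 1) * (w - (-1))) := by ring
  have a5 : 1 - z * w ≠ 0 := fun h => a3 (by field_simp; linear_combination -h)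
  have a6 : w - z⁻¹ = -(1 - z * w) / z := by field_simp; ring
  rw [a4, a6]
  obtain ⟨d, hd⟩ : ∃ d, d = 1 - z * w := ⟨_, rfl⟩
  rw [← hd] at a5 ⊢
  field_simp
  rw [hd]
  ring

/-- The two sides differ by the residues at ±1, whose sum is half the difference of the two sides of
`h`. -/
lemma integral_eq_of_residues_cancel {γ γ' : Contour} {f : ℂ → ℂ} (hf : Differentiable ℂ f)
    (hγ : γ.Around a univ) (hγ' : γ'.Around a univ) (ha : ∀ k, a k ^ 2 ≠ 1)
    (h1 : (1 : ℂ) ∉ γ.trace ∧ γ.index 1 = 1) (h2 : (-1 : ℂ) ∉ γ.trace ∧ γ.index (-1) = 1)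
    (h1' : (1 : ℂ) ∉ γ'.trace ∧ γ'.index 1 = 0) (h2' : (-1 : ℂ) ∉ γ'.trace ∧ γ'.index (-1) = 0)
    (h : f (-1) / poleProd a (-1) = f 1 / poleProd a 1) :
    (γ.integral fun z => f z / poleProd a z / (1 - z ^ 2)) =
      γ'.integral fun z => f z / poleProd a z / (1 - z ^ 2) := by
  obtain ⟨p, r, -, hr, h3⟩ := exists_residue isOpen_univ hf.differentiableOn
    fun k => mem_univ (a k)
  have hc := hf.continuous.continuousOn (s := γ.trace)
  have hc' := hf.continuous.continuousOn (s := γ'.trace)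
  have d1 : poleProd a 1 ≠ 0 := poleProd_ne_zero fun k hk => ha k (by rw [← hk]; ring)
  have d2 : poleProd a (-1) ≠ 0 := poleProd_ne_zero fun k hk => ha k (by rw [← hk]; ring)
  rw [integral_div_one_sub_sq (hγ.continuousOn_div hc) h1.1 h2.1,
    integral_div_one_sub_sq (hγ'.continuousOn_div hc') h1'.1 h2'.1,
    (h3 γ hγ _ h1.1).2 (mem_univ _) h1.2, (h3 γ hγ _ h2.1).2 (mem_univ _) h2.2,
    (h3 γ' hγ' _ h1'.1).1 h1'.2, (h3 γ' hγ' _ h2'.1).1 h2'.2]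
  rw [hr _ (mem_univ _), hr _ (mem_univ _), add_div, add_div, mul_div_cancel_left₀ _ d1,
    mul_div_cancel_left₀ _ d2] at h
  linear_combination h / 2

lemma integral_swap₂ {γ γ' : Contour} {X : Type*} [MeasurableSpace X] {μ : Measure X} [SFinite μ]
    {F : X → ℂ → ℂ → ℂ} {b : X → ℝ}
    (hm : Measurable fun q : (X × ℝ) × ℝ => F q.1.1 (γ.pt q.1.2) (γ'.pt q.2))
    (hb : Integrable b μ) (hF : ∀ᵐ x ∂μ, ∀ z ∈ γ.trace, ∀ w ∈ γ'.trace, ‖F x z w‖ ≤ b x) :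
    Integrable (fun x => γ.integral fun z => γ'.integral (F x z)) μ ∧
      ∫ x, γ.integral (fun z => γ'.integral (F x z)) ∂μ =
        γ.integral fun z => γ'.integral fun w => ∫ x, F x z w ∂μ := by
  have h1 := integral_swap (γ := γ) (μ := μ) (F := fun x z => γ'.integral (F x z))
    (b := fun x => b x * γ'.mass) ?_ (hb.mul_const _)
    (hF.mono fun x hx z hz => norm_integral_le (hx z hz))
  · refine ⟨h1.1, h1.2.trans (integral_congr fun z hz => ?_)⟩
    obtain ⟨t, rfl⟩ : ∃ t, γ.pt t = z := by
      obtain ⟨t, rfl⟩ := hz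
      exact ⟨t, γ.path.extend_apply t.2⟩
    refine (integral_swap (γ := γ') (μ := μ) (F := fun x w => F x (γ.pt t) w) (b := b) ?_ hb
      (hF.mono fun x hx w hw => hx _ hz w hw)).2
    exact (hm.comp ((measurable_fst.prodMk measurable_const).prodMk
      measurable_snd)).aestronglyMeasurable
  · simp only [integral_eq]
    exact (hm.aestronglyMeasurable.mul
      (γ'.integrable_dens.aestronglyMeasurable.comp_quasiMeasurePreserving
        Measure.quasiMeasurePreserving_snd)).integral_prod_right'

end Contour

end EllipticGinibre

end

open MeasureTheory Set
open Filter Topology Metric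

noncomputable section

namespace EllipticGinibre

/-! ### The square root -/

lemma cpow_half_sq (z : ℂ) : (z ^ (1 / 2 : ℂ)) ^ 2 = z := by
  have h := Complex.cpow_nat_inv_pow z (n := 2) two_ne_zero
  rw [one_div]
  exact_mod_cast h

lemma sqrtSqSubOne_sq (z : ℂ) : sqrtSqSubOne z ^ 2 = z ^ 2 - 1 := by
  rw [sqrtSqSubOne, mul_pow, cpow_half_sq, cpow_half_sq]
  ring

lemma isClosed_cut : IsClosed cut :=
  (isCompact_Icc.image Complex.continuous_ofReal).isClosed

lemma mem_cut_iff {z : ℂ} : z ∈ cut ↔ z.im = 0 ∧ -1 ≤ z.re ∧ z.re ≤ 1 := by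
  constructor
  · rintro ⟨x, ⟨h1, h2⟩, rfl⟩
    exact ⟨Complex.ofReal_im x, h1, h2⟩
  · rintro ⟨h1, h2, h3⟩
    exact ⟨z.re, ⟨h2, h3⟩, Complex.ext rfl (by simp [h1])⟩

lemma zero_mem_cut : (0 : ℂ) ∈ cut := by simp [mem_cut_iff]

lemma sqrtSqSubOne_ne_zero {z : ℂ} (hz : z ∉ cut) : sqrtSqSubOne z ≠ 0 := fun h => by
  have h1 := sqrtSqSubOne_sq z
  rw [h] at h1
  have h2 : (z - 1) * (z + 1) = 0 := by linear_combination -h1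
  rcases mul_eq_zero.1 h2 with h3 | h3
  · exact hz (mem_cut_iff.2 (by simp [sub_eq_zero.1 h3]))
  · exact hz (mem_cut_iff.2 (by simp [eq_neg_of_add_eq_zero_left h3]))

/-- For Re z < -1 the logarithms of z + 1 and z - 1 differ from those of their negatives by the same
±πi, as the imaginary parts agree; after halving, the two shifts combine to a factor -1. The
right-hand side is visibly holomorphic across (-∞, -1). -/
lemma sqrtSqSubOne_eq_neg {z : ℂ} (hz : z.re < -1) :
    sqrtSqSubOne z = -((-(z + 1)) ^ (1 / 2 : ℂ) * (-(z - 1)) ^ (1 / 2 : ℂ)) := by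
  have hp : z + 1 ≠ 0 := fun h => by
    have := congrArg Complex.re h
    simp at this
    linarith
  have hm : z - 1 ≠ 0 := fun h => by
    have := congrArg Complex.re h
    simp at this
    linarith
  have key : ∃ ε : ℂ, Complex.exp (ε * Real.pi * Complex.I) = -1 ∧ ∀ w : ℂ, w.im = z.im → w.re < 0 →
      Complex.log w = Complex.log (-w) + ε * Real.pi * Complex.I := by
    rcases le_or_gt 0 z.im with h | h
    · refine ⟨1, by simp [Complex.exp_pi_mul_I], fun w hw hre => ?_⟩
      have h1 : (-w).arg = w.arg - Real.pi := by
        rw [Complex.arg_neg_eq_arg_sub_pi_iff, hw]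
        rcases h.eq_or_lt with h | h
        · exact Or.inr ⟨h.symm, hre⟩
        · exact Or.inl h
      rw [Complex.log, Complex.log, h1, norm_neg]
      push_cast
      ring
    · refine ⟨-1, by rw [neg_one_mul, neg_mul, Complex.exp_neg, Complex.exp_pi_mul_I]; norm_num,
        fun w hw hre => ?_⟩
      have h1 : (-w).arg = w.arg + Real.pi := by
        rw [Complex.arg_neg_eq_arg_add_pi_iff, hw]
        exact Or.inl h
      rw [Complex.log, Complex.log, h1, norm_neg]
      push_cast
      ring
  obtain ⟨ε, h1, h2⟩ := key
  rw [sqrtSqSubOne, Complex.cpow_def_of_ne_zero hp, Complex.cpow_def_of_ne_zero hm,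
    Complex.cpow_def_of_ne_zero (neg_ne_zero.2 hp), Complex.cpow_def_of_ne_zero (neg_ne_zero.2 hm),
    ← Complex.exp_add, ← Complex.exp_add, h2 (z + 1) (by simp) (by simp; linarith),
    h2 (z - 1) (by simp) (by simp; linarith)]
  have e : ∀ x y : ℂ, Complex.exp ((x + ε * Real.pi * Complex.I) * (1 / 2) +
      (y + ε * Real.pi * Complex.I) * (1 / 2)) = -Complex.exp (x * (1 / 2) + y * (1 / 2)) :=
    fun x y => by
      rw [← neg_one_mul (Complex.exp _), ← h1, ← Complex.exp_add]
      ring_nf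
  exact e _ _

lemma differentiableOn_sqrtSqSubOne : DifferentiableOn ℂ sqrtSqSubOne cutᶜ := by
  intro z hz
  refine DifferentiableAt.differentiableWithinAt ?_
  rcases lt_or_ge z.re (-1) with h | h
  · have h1 : sqrtSqSubOne =ᶠ[𝓝 z]
        fun z => -((-(z + 1)) ^ (1 / 2 : ℂ) * (-(z - 1)) ^ (1 / 2 : ℂ)) := by
      filter_upwards [(isOpen_lt Complex.continuous_re continuous_const).mem_nhds h] with w hw
      exact sqrtSqSubOne_eq_neg hw
    refine DifferentiableAt.congr_of_eventuallyEq ?_ h1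
    refine ((DifferentiableAt.cpow_const (by fun_prop) (Or.inl ?_)).mul
      (DifferentiableAt.cpow_const (by fun_prop) (Or.inl ?_))).neg
    · simp; linarith
    · simp; linarith
  · have h1 : z.im ≠ 0 ∨ 1 < z.re := by
      by_contra! hc
      exact hz (mem_cut_iff.2 ⟨hc.1, h, hc.2⟩)
    unfold sqrtSqSubOne
    refine (DifferentiableAt.cpow_const (by fun_prop) ?_).mul
      (DifferentiableAt.cpow_const (by fun_prop) ?_)
    · rcases h1 with h1 | h1
      · exact Or.inr (by simpa using h1)
      · exact Or.inl (by simp; linarith)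
    · rcases h1 with h1 | h1
      · exact Or.inr (by simpa using h1)
      · exact Or.inl (by simp; linarith)

/-! ### Parameters -/

lemma etaMinus_pos {τ : ℝ} (hτ : τ ∈ Ioo (0 : ℝ) 1) : 0 < etaMinus τ :=
  div_pos hτ.1 (by nlinarith [hτ.1, hτ.2])

lemma etaMinus_div_etaPlus {τ : ℝ} (hτ : τ ∈ Ioo (0 : ℝ) 1) : etaMinus τ / etaPlus τ = τ := by
  have : 1 - τ ^ 2 ≠ 0 := by nlinarith [hτ.1, hτ.2]
  rw [etaMinus, etaPlus]
  field_simp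

/-- The points `σ_k / τ` as a family. -/
def ratio {N : ℕ} (τ : ℝ) (σ : Fin N → ℝ) (k : Fin N) : ℂ := (σ k : ℂ) / (τ : ℂ)

/-- The points `τ / σ_k` as a family. -/
def ratioInv {N : ℕ} (τ : ℝ) (σ : Fin N → ℝ) (k : Fin N) : ℂ := (τ : ℂ) / (σ k : ℂ)

/-- The numerator `∏ (a_k z - 1)`. -/
def revProd {ι : Type*} [Fintype ι] (a : ι → ℂ) (z : ℂ) : ℂ := ∏ k, (a k * z - 1)

section

variable {N : ℕ} {τ : ℝ} {σ : Fin N → ℝ}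

lemma ratio_inv (k : Fin N) : (ratio τ σ k)⁻¹ = ratioInv τ σ k := by
  rw [ratio, ratioInv, inv_div]

lemma ratioInv_inv (k : Fin N) : (ratioInv τ σ k)⁻¹ = ratio τ σ k := by
  rw [ratio, ratioInv, inv_div]

lemma differentiable_revProd {ι : Type*} [Fintype ι] {a : ι → ℂ} :
    Differentiable ℂ (revProd a) := by
  unfold revProd
  fun_prop

lemma sigmaProd_eq (hτ : 0 < τ) (z : ℂ) :
    sigmaProd τ σ z = revProd (ratio τ σ) z / poleProd (ratio τ σ) z := by
  have h : (τ : ℂ) ≠ 0 := by exact_mod_cast hτ.ne'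
  rw [sigmaProd, revProd, poleProd, ← Finset.prod_div_distrib]
  refine Finset.prod_congr rfl fun k _ => ?_
  rw [ratio, ← mul_div_mul_left (_ / _ * z - 1) _ h]
  congr 1 <;> field_simp

lemma sigmaProdInv_eq (hτ : 0 < τ) (hσ : ∀ k, τ < σ k) (z : ℂ) :
    sigmaProdInv τ σ z =
      poleProd (ratio τ σ) z / (∏ k, ratio τ σ k) / poleProd (ratioInv τ σ) z := by
  have h : (τ : ℂ) ≠ 0 := by exact_mod_cast hτ.ne'
  rw [sigmaProdInv, poleProd, poleProd, ← Finset.prod_div_distrib, ← Finset.prod_div_distrib]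
  refine Finset.prod_congr rfl fun k _ => ?_
  have h' : (σ k : ℂ) ≠ 0 := by exact_mod_cast (hτ.trans (hσ k)).ne'
  rw [ratio, ratioInv, div_div, ← mul_div_mul_left _ ((σ k : ℂ) / τ * _) h]
  congr 1 <;> field_simp

lemma sigmaProdInv_inv {z : ℂ} (hz : z ≠ 0) : sigmaProdInv τ σ z⁻¹ = sigmaProd τ σ z := by
  refine Finset.prod_congr rfl fun k _ => ?_
  rw [← mul_div_mul_left _ _ (neg_ne_zero.2 hz)]
  congr 1 <;> field_simp <;> ring

lemma one_lt_ratio_re (hτ : 0 < τ) (hσ : ∀ k, τ < σ k) (k : Fin N) : 1 < (ratio τ σ k).re := by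
  rw [ratio, ← Complex.ofReal_div, Complex.ofReal_re, one_lt_div hτ]
  exact hσ k

lemma one_lt_norm_ratio (hτ : 0 < τ) (hσ : ∀ k, τ < σ k) (k : Fin N) : 1 < ‖ratio τ σ k‖ :=
  (one_lt_ratio_re hτ hσ k).trans_le (Complex.re_le_norm _)

lemma ratio_ne_zero (hτ : 0 < τ) (hσ : ∀ k, τ < σ k) (k : Fin N) : ratio τ σ k ≠ 0 :=
  norm_pos_iff.1 (zero_lt_one.trans (one_lt_norm_ratio hτ hσ k))

lemma norm_ratioInv_lt_one (hτ : 0 < τ) (hσ : ∀ k, τ < σ k) (k : Fin N) :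
    ‖ratioInv τ σ k‖ < 1 := by
  rw [← ratio_inv, norm_inv]
  exact inv_lt_one_of_one_lt₀ (one_lt_norm_ratio hτ hσ k)

lemma ratioInv_ne_zero (hτ : 0 < τ) (hσ : ∀ k, τ < σ k) (k : Fin N) : ratioInv τ σ k ≠ 0 := by
  rw [← ratio_inv]
  exact inv_ne_zero (ratio_ne_zero hτ hσ k)

lemma ratio_notMem_cut (hτ : 0 < τ) (hσ : ∀ k, τ < σ k) (k : Fin N) : ratio τ σ k ∈ cutᶜ :=
  fun h => (mem_cut_iff.1 h).2.2.not_gt (one_lt_ratio_re hτ hσ k)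

lemma ratio_inv_notMem (hτ : 0 < τ) (hσ : ∀ k, τ < σ k) (k : Fin N) :
    (ratio τ σ k)⁻¹ ∉ cutᶜ := by
  rw [ratio_inv, notMem_compl_iff, ratioInv, ← Complex.ofReal_div, mem_cut_iff]
  have h := hτ.trans (hσ k)
  refine ⟨Complex.ofReal_im _, ?_, ?_⟩
  · rw [Complex.ofReal_re]; have := div_pos hτ h; linarith
  · rw [Complex.ofReal_re, div_le_one h]; exact (hσ k).le

/-! ### The punctured disc and the reference circle -/

/-- The punctured unit disc. -/
def puncturedDisc : Set ℂ := ball 0 1 \ {0}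

lemma isOpen_puncturedDisc : IsOpen puncturedDisc := isOpen_ball.sdiff isClosed_singleton

lemma zero_notMem_puncturedDisc : (0 : ℂ) ∉ puncturedDisc := fun h => h.2 rfl

lemma ratioInv_mem (hτ : 0 < τ) (hσ : ∀ k, τ < σ k) (k : Fin N) :
    ratioInv τ σ k ∈ puncturedDisc :=
  ⟨by simpa using norm_ratioInv_lt_one hτ hσ k, ratioInv_ne_zero hτ hσ k⟩

lemma ratioInv_inv_notMem (hτ : 0 < τ) (hσ : ∀ k, τ < σ k) (k : Fin N) :
    (ratioInv τ σ k)⁻¹ ∉ puncturedDisc := by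
  rw [ratioInv_inv]
  intro h
  have := h.1
  rw [mem_ball_zero_iff] at this
  exact this.not_gt (one_lt_norm_ratio hτ hσ k)

lemma Contour.Encircles.around_cut {Γ : Contour} {B : Set ℂ}
    (h : Γ.Encircles (outerPoles τ σ) (cut ∪ B)) : Γ.Around (ratio τ σ) cutᶜ where
  subset z hz hc := (h.outside z (Or.inl hc)).1 hz
  index_one k := h.inside _ ⟨k, rfl⟩
  index_zero x hx := (h.outside x (Or.inl (not_notMem.1 hx))).2

lemma Contour.index_eq_zero_of_one_le_norm {Γ : Contour} (hΓ : ∀ z ∈ Γ.trace, ‖z‖ < 1) {x : ℂ}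
    (hx : 1 ≤ ‖x‖) : Γ.index x = 0 :=
  Contour.index_eq_zero_of_norm_lt (c := 0) fun w hw => by
    simpa using (hΓ w hw).trans_le hx

lemma Contour.Encircles.around_disc {Γ : Contour} {B : Set ℂ}
    (h : Γ.Encircles (innerPoles τ σ) ({0, 1, -1} ∪ B)) (hΓ : ∀ z ∈ Γ.trace, ‖z‖ < 1) :
    Γ.Around (ratioInv τ σ) puncturedDisc where
  subset z hz := ⟨by simpa using hΓ z hz,
    fun h0 => (h.outside 0 (by simp)).1 (by rwa [mem_singleton_iff.1 h0] at hz)⟩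
  index_one k := h.inside _ ⟨k, rfl⟩
  index_zero x hx := by
    by_cases h0 : x = 0
    · rw [h0]; exact (h.outside 0 (by simp)).2
    · refine Contour.index_eq_zero_of_one_le_norm hΓ (not_lt.1 fun h1 => hx ⟨by simpa using h1, h0⟩)

/-- The reference circle lies in Re z ≥ l > 1, where the Laplace transforms converge, and has index
0 on Re x ≤ 1, hence about the cut and about the inverses of its own points. -/
lemma exists_outer_contour (hN : 1 ≤ N) (hτ : 0 < τ) (hσ : ∀ k, τ < σ k) :
    ∃ (C : Contour) (l : ℝ), 1 < l ∧ C.Around (ratio τ σ) cutᶜ ∧ (∀ z ∈ C.trace, l ≤ z.re) ∧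
      ∀ x : ℂ, x.re ≤ 1 → x ∉ C.trace ∧ C.index x = 0 := by
  have : Nonempty (Fin N) := ⟨⟨0, hN⟩⟩
  obtain ⟨i, hi⟩ := Finite.exists_min fun k => (ratio τ σ k).re
  obtain ⟨j, hj⟩ := Finite.exists_max fun k => (ratio τ σ k).re
  have h1 := one_lt_ratio_re hτ hσ i
  -- The leftmost point l of the circle is halfway between 1 and the smallest pole; the radius r
  -- exceeds the distance from l to the largest pole, so all poles lie in the disc with centre l +
  -- r.
  set l := (1 + (ratio τ σ i).re) / 2 with hl
  set r := (ratio τ σ j).re + 1 - l with hr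
  have hij := hi j
  have hr0 : 0 < r := by linarith
  have htr : ∀ z ∈ (Contour.circle (l + r : ℝ) r).trace, l ≤ z.re := fun z hz => by
    have h2 := Contour.circle_trace _ hr0.le hz
    rw [mem_sphere_iff_norm] at h2
    have h3 := (Complex.abs_re_le_norm (z - (l + r : ℝ))).trans_eq h2
    rw [Complex.sub_re, Complex.ofReal_re] at h3
    linarith [(abs_le.1 h3).1]
  have hout : ∀ x : ℂ, x.re ≤ 1 → x ∉ (Contour.circle (l + r : ℝ) r).trace ∧
      (Contour.circle (l + r : ℝ) r).index x = 0 := fun x hx => by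
    refine ⟨fun h => by linarith [htr x h], Contour.circle_index_of_notMem hr0.le fun h => ?_⟩
    rw [mem_closedBall_iff_norm] at h
    have h3 := (Complex.abs_re_le_norm (x - (l + r : ℝ))).trans h
    rw [Complex.sub_re, Complex.ofReal_re] at h3
    linarith [(abs_le.1 h3).1]
  have hball : ∀ k, ratio τ σ k ∈ ball (((l + r : ℝ)) : ℂ) r := fun k => by
    have e : ratio τ σ k = ((ratio τ σ k).re : ℂ) := by
      rw [ratio, ← Complex.ofReal_div, Complex.ofReal_re]
    rw [mem_ball_iff_norm, e, ← Complex.ofReal_sub, Complex.norm_real, Real.norm_eq_abs, abs_lt]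
    have := hi k
    have := hj k
    constructor <;> linarith
  refine ⟨Contour.circle (l + r : ℝ) r, l, by linarith, ⟨fun z hz hc => ?_, fun k => ?_,
    fun x hx => ?_⟩, htr, hout⟩
  · linarith [htr z hz, (mem_cut_iff.1 hc).2.2]
  · refine ⟨fun h => ?_, Contour.circle_index_of_mem (hball k)⟩
    have h2 := Contour.circle_trace _ hr0.le h
    have h3 := hball k
    rw [mem_sphere] at h2
    rw [mem_ball] at h3
    linarith
  · exact (hout x (mem_cut_iff.1 (not_notMem.1 hx)).2.2).2

lemma Contour.Around.inv {C : Contour} (hC : C.Around (ratio τ σ) cutᶜ)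
    (hr : ∀ z ∈ C.trace, 1 < z.re) (ho : ∀ x : ℂ, x.re ≤ 1 → x ∉ C.trace ∧ C.index x = 0)
    (h0 : (0 : ℂ) ∉ C.trace) (hτ : 0 < τ) (hσ : ∀ k, τ < σ k) :
    (C.inv h0).Around (ratioInv τ σ) puncturedDisc := by
  have hsub : (C.inv h0).trace ⊆ puncturedDisc := by
    rw [inv_trace]
    rintro _ ⟨z, hz, rfl⟩
    have h1 := (hr z hz).trans_le (Complex.re_le_norm z)
    refine ⟨?_, inv_ne_zero (ne_zero_of_mem_trace h0 hz)⟩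
    rw [mem_ball_zero_iff, norm_inv]
    exact inv_lt_one_of_one_lt₀ h1
  refine ⟨hsub, fun k => ?_, fun x hx => ?_⟩
  · have h1 : ratioInv τ σ k ∉ (C.inv h0).trace := by
      rw [inv_trace]
      rintro ⟨z, hz, h⟩
      rw [← ratio_inv, inv_inj] at h
      exact (hC.index_one k).1 (h ▸ hz)
    refine ⟨h1, ?_⟩
    rw [inv_index h0 h1, if_neg (ratioInv_ne_zero hτ hσ k), ratioInv_inv, (hC.index_one k).2,
      (ho 0 (by simp)).2, sub_zero]
  · rw [inv_index h0 fun h => hx (hsub h), (ho 0 (by simp)).2]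
    split_ifs with h
    · simp
    · rw [sub_zero]
      refine (ho _ ?_).2
      have h1 : 1 ≤ ‖x‖ := not_lt.1 fun h1 => hx ⟨by simpa using h1, h⟩
      refine (Complex.re_le_norm _).trans ?_
      rw [norm_inv]
      exact inv_le_one_of_one_le₀ h1

end

end EllipticGinibre

end

open MeasureTheory Set
open Filter Topology Metric

noncomputable section

namespace EllipticGinibre

/-! ### The sub-kernels as contour integrals over a fixed circle and its inverse -/

/-- The product of the skew weight with an exponential. -/
def weightExp (η a t : ℝ) (z : ℂ) : ℂ :=
  (weightE a (η * t) : ℂ) * Complex.exp (-η * t * (z + 1))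

lemma measurable_weightExp_comp (η a : ℝ) {X : Type*} [MeasurableSpace X] {s : X → ℝ} {f : X → ℂ}
    (hs : Measurable s) (hf : Measurable f) : Measurable fun q => weightExp η a (s q) (f q) := by
  unfold weightExp
  have h : Measurable fun q => (weightE a (η * s q) : ℂ) :=
    Complex.measurable_ofReal.comp ((measurable_weightE a).comp (hs.const_mul η))
  refine h.mul ?_
  fun_prop

lemma integral_weightExp {η a : ℝ} (hη : 0 < η) (ha : 0 ≤ a) {p : ℂ} (hp : 1 < p.re) :
    ∫ t in Ioi (0 : ℝ), weightExp η a t p = 4 * Real.pi / η * (gFun p⁻¹ a / sqrtSqSubOne p) := by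
  have h := integral_comp_mul_left_Ioi
    (fun b : ℝ => (weightE a b : ℂ) * Complex.exp (-((p + 1) * b))) 0 hη
  rw [mul_zero, laplace_weightE ha hp, Complex.real_smul] at h
  rw [div_mul_eq_mul_div, div_eq_inv_mul, ← Complex.ofReal_inv, ← h]
  congr 1
  ext t
  rw [weightExp]
  push_cast
  ring_nf

lemma exists_weightExp_bound {η a l : ℝ} (hη : 0 < η) (ha : 0 ≤ a) (hl : 1 < l) :
    ∃ B δ : ℝ, 0 ≤ B ∧ 0 < δ ∧ ∀ t > 0, ∀ z : ℂ, l ≤ z.re →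
      ‖weightExp η a t z‖ ≤ B * Real.exp (-δ * t) := by
  obtain ⟨q, hq, hql⟩ := exists_between (show 2 < 1 + l by linarith)
  obtain ⟨B, hB, h⟩ := exists_weightE_bound ha hq
  refine ⟨B, η * (1 + l - q), hB, mul_pos hη (by linarith), fun t ht z hz => ?_⟩
  have h1 : ‖Complex.exp (-η * t * (z + 1))‖ ≤ Real.exp (-(η * t * (l + 1))) := by
    rw [Complex.norm_exp, Real.exp_le_exp]
    have e : (-η * t * (z + 1) : ℂ).re = -(η * t * (z.re + 1)) := by simp
    rw [e]
    have : 0 < η * t := mul_pos hη ht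
    nlinarith
  rw [weightExp, norm_mul]
  calc _ ≤ B * Real.exp (q * (η * t)) * Real.exp (-(η * t * (l + 1))) := by
        gcongr
        exact h _ (mul_pos hη ht).le
    _ = _ := by rw [mul_assoc, ← Real.exp_add]; ring_nf

section

variable {N : ℕ}

/-- One factor of the integrand of `DS_N`, without the exponential. -/
def dsFactor (m : ℕ) (τ : ℝ) (σ : Fin N → ℝ) (z : ℂ) : ℂ :=
  (sqrtSqSubOne z)⁻¹ * z ^ m * sigmaProd τ σ z

/-- The integrand of `DS_N` without the exponentials. -/
def dsKernel (m : ℕ) (τ : ℝ) (σ : Fin N → ℝ) (z w : ℂ) : ℂ :=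
  dsFactor m τ σ z * dsFactor m τ σ w * ((z - w) / (1 - z * w))

/-- The integrand of the contour integral for `S_N`. -/
def sKernel (m : ℕ) (τ : ℝ) (σ : Fin N → ℝ) (u v : ℝ) (z w : ℂ) : ℂ :=
  gFun z (etaMinus τ * v) / (1 - z ^ 2) *
    (Complex.exp (-etaMinus τ * u * (w + 1)) / sqrtSqSubOne w) *
    (w / z) ^ m * ((1 - z * w) / (w - z)) * (sigmaProdInv τ σ z * sigmaProd τ σ w)

/-- The integrand of the contour integral for `IS_N`. -/
def isKernel (m : ℕ) (τ : ℝ) (σ : Fin N → ℝ) (u v : ℝ) (z w : ℂ) : ℂ :=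
  gFun z (etaMinus τ * v) / (1 - z ^ 2) * (gFun w (etaMinus τ * u) / (1 - w ^ 2)) *
    (1 / (z * w)) ^ m * ((z - w) / (1 - z * w)) * (sigmaProdInv τ σ z * sigmaProdInv τ σ w)

variable {τ : ℝ} {σ : Fin N → ℝ}

lemma kernelDS_eq (M : ℕ) (Γz Γw : Contour) (u v : ℝ) : kernelDS M τ σ Γz Γw u v =
    Γz.integral fun z => Γw.integral fun w => (etaMinus τ : ℂ) ^ 2 / (4 * Real.pi) *
      (Complex.exp (-etaMinus τ * v * (z + 1)) * Complex.exp (-etaMinus τ * u * (w + 1)) *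
        dsKernel (M - N) τ σ z w) := by
  simp only [Contour.integral_const_mul]
  rw [kernelDS]
  congr 2
  ext z
  congr 1
  ext w
  rw [dsKernel, dsFactor, dsFactor, mul_pow]
  ring

/-- Arbitrary admissible contours may enter Re z ≤ 1, where the exponentials do not control the
growth of the skew weight. Independence of the contours allows the reference circle to be used
instead. -/
lemma kernelDS_congr (M : ℕ) (hτ : 0 < τ) (hσ : ∀ k, τ < σ k) {Γ₁ Γ₂ C : Contour}
    (hΓ : DSContours τ σ Γ₁ Γ₂) (hC : C.Around (ratio τ σ) cutᶜ)
    (hC' : ∀ z ∈ C.trace, z⁻¹ ∉ C.trace ∧ C.index z⁻¹ = 0) (u v : ℝ) :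
    kernelDS M τ σ Γ₁ Γ₂ u v = kernelDS M τ σ C C u v := by
  have hd : ∀ s : ℝ, DifferentiableOn ℂ (fun z => Complex.exp (-etaMinus τ * s * (z + 1)) /
      sqrtSqSubOne z * z ^ (M - N) * revProd (ratio τ σ) z) cutᶜ := fun s => by
    refine ((DifferentiableOn.fun_div (by fun_prop) differentiableOn_sqrtSqSubOne
      fun z hz => sqrtSqSubOne_ne_zero hz).fun_mul (by fun_prop)).fun_mul
      differentiable_revProd.differentiableOn
  obtain ⟨c, hc⟩ := Contour.exists_integral_integral_eq isClosed_cut.isOpen_compl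
    (not_not.2 zero_mem_cut) (hd v) (hd u) (ratio_notMem_cut hτ hσ) (ratio_inv_notMem hτ hσ)
  have h1 := hc Γ₁ Γ₂ hΓ.1.around_cut hΓ.2.around_cut
    fun z hz => hΓ.2.outside _ (Or.inr (mem_image_of_mem _ hz))
  have h2 := hc C C hC hC hC'
  rw [kernelDS, kernelDS]
  congr 1
  simp only [sigmaProd_eq hτ, mul_pow]
  convert h1.trans h2.symm using 5 <;> ring

lemma continuousOn_dsFactor (m : ℕ) (hτ : 0 < τ) {C : Contour} (hC : C.Around (ratio τ σ) cutᶜ) :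
    ContinuousOn (dsFactor m τ σ) C.trace := by
  unfold dsFactor
  refine ((differentiableOn_sqrtSqSubOne.continuousOn.mono hC.subset).inv₀
    fun z hz => sqrtSqSubOne_ne_zero (hC.subset hz)).mul (by fun_prop) |>.mul ?_
  simp only [funext fun z => sigmaProd_eq (σ := σ) hτ z]
  exact hC.continuousOn_div differentiable_revProd.continuous.continuousOn

lemma one_sub_mul_ne_zero {z w : ℂ} (hz : 1 < ‖z‖) (hw : 1 < ‖w‖) : 1 - z * w ≠ 0 := fun h => by
  have h1 : ‖z‖ * ‖w‖ = 1 := by rw [← norm_mul, ← sub_eq_zero.1 h, norm_one]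
  nlinarith

lemma continuousOn_dsKernel (m : ℕ) (hτ : 0 < τ) {C : Contour} (hC : C.Around (ratio τ σ) cutᶜ)
    (hn : ∀ z ∈ C.trace, 1 < ‖z‖) :
    ContinuousOn (fun q : ℂ × ℂ => dsKernel m τ σ q.1 q.2) (C.trace ×ˢ C.trace) := by
  have h := continuousOn_dsFactor m hτ hC
  unfold dsKernel
  refine ((h.comp continuousOn_fst fun q hq => hq.1).mul
    (h.comp continuousOn_snd fun q hq => hq.2)).mul (ContinuousOn.div (by fun_prop) (by fun_prop)
    fun q hq => one_sub_mul_ne_zero (hn _ hq.1) (hn _ hq.2))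

lemma measurable_comp_pt₂ {f : ℂ × ℂ → ℂ} {C : Contour}
    (hf : ContinuousOn f (C.trace ×ˢ C.trace)) {X : Type*} [MeasurableSpace X] :
    Measurable fun q : (X × ℝ) × ℝ => f (C.pt q.1.2, C.pt q.2) := by
  have h : Continuous fun q : ℝ × ℝ => f (C.pt q.1, C.pt q.2) :=
    hf.comp_continuous ((C.continuous_pt.comp continuous_fst).prodMk
      (C.continuous_pt.comp continuous_snd)) fun q => ⟨C.pt_mem _, C.pt_mem _⟩
  exact h.measurable.comp ((measurable_snd.comp measurable_fst).prodMk measurable_snd)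

lemma one_sub_inv_sq {z : ℂ} (hz : z ≠ 0) : 1 - z⁻¹ ^ 2 = sqrtSqSubOne z ^ 2 / z ^ 2 := by
  rw [sqrtSqSubOne_sq]
  field_simp

/-- The square root from the Laplace transform and the one in `dsFactor` multiply to z² - 1 = z² (1
- z⁻²), which gives the denominator of `sKernel` at z⁻¹. -/
lemma sKernel_inv {m : ℕ} {u v : ℝ} (hη : 0 < etaMinus τ) {z w : ℂ} (hzc : z ∉ cut)
    (hz : 1 < ‖z‖) (hw : 1 < ‖w‖) :
    4 * Real.pi / etaMinus τ * (gFun z⁻¹ (etaMinus τ * v) / sqrtSqSubOne z) *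
      ((etaMinus τ : ℂ) ^ 2 / (4 * Real.pi) *
        (Complex.exp (-etaMinus τ * u * (w + 1)) * dsKernel m τ σ z w)) =
      -(etaMinus τ / z ^ 2) * sKernel m τ σ u v z⁻¹ w := by
  have hηc : (etaMinus τ : ℂ) ≠ 0 := by exact_mod_cast hη.ne'
  have hpi : (Real.pi : ℂ) ≠ 0 := by exact_mod_cast Real.pi_ne_zero
  have hz0 : z ≠ 0 := norm_pos_iff.1 (zero_lt_one.trans hz)
  have hs := sqrtSqSubOne_ne_zero hzc
  have hzw := one_sub_mul_ne_zero hz hw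
  have e3 : (1 - z⁻¹ * w) / (w - z⁻¹) = -((z - w) / (1 - z * w)) := by
    have h4 : w - z⁻¹ = -(1 - z * w) / z := by field_simp; ring
    have h5 : 1 - z⁻¹ * w = (z - w) / z := by field_simp
    rw [h4, h5, div_div_div_cancel_right₀ hz0, div_neg]
  have e4 : w / z⁻¹ = z * w := by field_simp
  rw [sKernel, dsKernel, dsFactor, dsFactor, sigmaProdInv_inv hz0, one_sub_inv_sq hz0, e3, e4,
    mul_pow]
  generalize (z - w) / (1 - z * w) = κ
  field_simp

lemma isKernel_inv {m : ℕ} {u v : ℝ} (hη : 0 < etaMinus τ) {z w : ℂ} (hzc : z ∉ cut)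
    (hwc : w ∉ cut) (hz : 1 < ‖z‖) (hw : 1 < ‖w‖) :
    4 * Real.pi / etaMinus τ * (gFun w⁻¹ (etaMinus τ * u) / sqrtSqSubOne w) *
      (4 * Real.pi / etaMinus τ * (gFun z⁻¹ (etaMinus τ * v) / sqrtSqSubOne z)) *
      ((etaMinus τ : ℂ) ^ 2 / (4 * Real.pi) * dsKernel m τ σ z w) =
      -(4 * Real.pi / z ^ 2) * -(isKernel m τ σ u v z⁻¹ w⁻¹ / w ^ 2) := by
  have hηc : (etaMinus τ : ℂ) ≠ 0 := by exact_mod_cast hη.ne'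
  have hpi : (Real.pi : ℂ) ≠ 0 := by exact_mod_cast Real.pi_ne_zero
  have hz0 : z ≠ 0 := norm_pos_iff.1 (zero_lt_one.trans hz)
  have hw0 : w ≠ 0 := norm_pos_iff.1 (zero_lt_one.trans hw)
  have hs := sqrtSqSubOne_ne_zero hzc
  have hs' := sqrtSqSubOne_ne_zero hwc
  have e3 : (z⁻¹ - w⁻¹) / (1 - z⁻¹ * w⁻¹) = (z - w) / (1 - z * w) := by
    have h4 : 1 - z⁻¹ * w⁻¹ = -(1 - z * w) / (z * w) := by field_simp; ring
    have h5 : z⁻¹ - w⁻¹ = -(z - w) / (z * w) := by field_simp; ring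
    rw [h4, h5, div_div_div_cancel_right₀ (mul_ne_zero hz0 hw0), neg_div_neg_eq]
  have e4 : 1 / (z⁻¹ * w⁻¹) = z * w := by field_simp
  rw [isKernel, dsKernel, dsFactor, dsFactor, sigmaProdInv_inv hz0, sigmaProdInv_inv hw0,
    one_sub_inv_sq hz0, one_sub_inv_sq hw0, e3, e4, mul_pow]
  generalize (z - w) / (1 - z * w) = κ
  field_simp

/-- For Re z ≥ l the weight times the exponential decays exponentially in t, uniformly in z, so
Fubini applies and `integral_weightExp` evaluates the t-integral. -/
lemma kernelS_circle (M : ℕ) (hτ : τ ∈ Ioo (0 : ℝ) 1) {C : Contour} {l : ℝ} (hl : 1 < l)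
    (hC : C.Around (ratio τ σ) cutᶜ) (hre : ∀ z ∈ C.trace, l ≤ z.re) (h0 : (0 : ℂ) ∉ C.trace)
    (u : ℝ) {v : ℝ} (hv : 0 < v) :
    IntegrableOn (kernelSIntegrand M τ σ C C u v) (Ioi 0) ∧
      kernelS M τ σ C C u v = etaMinus τ *
        (C.inv h0).integral fun z => C.integral (sKernel (M - N) τ σ u v z) := by
  have hη := etaMinus_pos hτ
  have ha : 0 ≤ etaMinus τ * v := (mul_pos hη hv).le
  have hn : ∀ z ∈ C.trace, 1 < ‖z‖ := fun z hz =>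
    (hl.trans_le (hre z hz)).trans_le (Complex.re_le_norm z)
  have hKc : ContinuousOn (fun q : ℂ × ℂ => (etaMinus τ : ℂ) ^ 2 / (4 * Real.pi) *
      (Complex.exp (-etaMinus τ * u * (q.2 + 1)) * dsKernel (M - N) τ σ q.1 q.2))
      (C.trace ×ˢ C.trace) :=
    continuousOn_const.mul (ContinuousOn.mul (by fun_prop)
      (continuousOn_dsKernel (M - N) hτ.1 hC hn))
  obtain ⟨K, hK⟩ := (C.isCompact_trace.prod C.isCompact_trace).exists_bound_of_continuousOn hKc
  obtain ⟨B, δ, hB, hδ, hb⟩ := exists_weightExp_bound hη ha hl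
  have hint : kernelSIntegrand M τ σ C C u v = fun t => C.integral fun z => C.integral fun w =>
      weightExp (etaMinus τ) (etaMinus τ * v) t z *
        ((etaMinus τ : ℂ) ^ 2 / (4 * Real.pi) *
          (Complex.exp (-etaMinus τ * u * (w + 1)) * dsKernel (M - N) τ σ z w)) := by
    ext t
    rw [kernelSIntegrand, kernelDS_eq, ← Contour.integral_const_mul]
    congr 1
    ext z
    rw [← Contour.integral_const_mul]
    congr 1
    ext w
    rw [weightExp]
    ring
  have hswap := Contour.integral_swap₂ (γ := C) (γ' := C) (μ := volume.restrict (Ioi (0 : ℝ)))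
    (F := fun t z w => weightExp (etaMinus τ) (etaMinus τ * v) t z *
        ((etaMinus τ : ℂ) ^ 2 / (4 * Real.pi) *
          (Complex.exp (-etaMinus τ * u * (w + 1)) * dsKernel (M - N) τ σ z w)))
    (b := fun t => B * Real.exp (-δ * t) * K) ?_
    (((exp_neg_integrableOn_Ioi 0 hδ).const_mul B).mul_const K)
    ((ae_restrict_mem measurableSet_Ioi).mono fun t ht z hz w hw => ?_)
  · rw [kernelS, hint]
    refine ⟨hswap.1, hswap.2.trans ?_⟩
    rw [Contour.inv_integral, ← Contour.integral_const_mul]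
    refine Contour.integral_congr fun z hz => ?_
    have e1 : ∀ X : ℂ, (etaMinus τ : ℂ) * -(X / z ^ 2) = -(etaMinus τ / z ^ 2) * X :=
      fun X => by ring
    rw [e1, ← Contour.integral_const_mul]
    refine Contour.integral_congr fun w hw => ?_
    rw [MeasureTheory.integral_mul_const, integral_weightExp hη ha (hl.trans_le (hre z hz))]
    exact sKernel_inv hη (hC.subset hz) (hn z hz) (hn w hw)
  · have m1 : Measurable fun q : (ℝ × ℝ) × ℝ =>
        weightExp (etaMinus τ) (etaMinus τ * v) q.1.1 (C.pt q.1.2) :=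
      measurable_weightExp_comp _ _ (measurable_fst.comp measurable_fst)
        (C.continuous_pt.measurable.comp (measurable_snd.comp measurable_fst))
    exact m1.mul (measurable_comp_pt₂ hKc)
  · rw [norm_mul]
    have h1 := hb t ht z (hre z hz)
    exact mul_le_mul h1 (hK (z, w) ⟨hz, hw⟩) (norm_nonneg _) (by positivity)

lemma kernelIS_circle (M : ℕ) (hτ : τ ∈ Ioo (0 : ℝ) 1) {C : Contour} {l : ℝ} (hl : 1 < l)
    (hC : C.Around (ratio τ σ) cutᶜ) (hre : ∀ z ∈ C.trace, l ≤ z.re) (h0 : (0 : ℂ) ∉ C.trace)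
    {u v : ℝ} (hu : 0 < u) (hv : 0 < v) :
    IntegrableOn (kernelISIntegrand M τ σ C C u v) (Ioi 0 ×ˢ Ioi 0) ∧
      kernelIS M τ σ C C u v = -(weightE (etaMinus τ * u) (etaMinus τ * v) : ℂ) + 4 * Real.pi *
        (C.inv h0).integral fun z => (C.inv h0).integral (isKernel (M - N) τ σ u v z) := by
  have hη := etaMinus_pos hτ
  have ha : 0 ≤ etaMinus τ * v := (mul_pos hη hv).le
  have ha' : 0 ≤ etaMinus τ * u := (mul_pos hη hu).le
  have hn : ∀ z ∈ C.trace, 1 < ‖z‖ := fun z hz =>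
    (hl.trans_le (hre z hz)).trans_le (Complex.re_le_norm z)
  have hKc : ContinuousOn (fun q : ℂ × ℂ => (etaMinus τ : ℂ) ^ 2 / (4 * Real.pi) *
      dsKernel (M - N) τ σ q.1 q.2) (C.trace ×ˢ C.trace) :=
    continuousOn_const.mul (continuousOn_dsKernel (M - N) hτ.1 hC hn)
  obtain ⟨K, hK⟩ := (C.isCompact_trace.prod C.isCompact_trace).exists_bound_of_continuousOn hKc
  obtain ⟨B, δ, hB, hδ, hb⟩ := exists_weightExp_bound hη ha hl
  obtain ⟨B', δ', hB', hδ', hb'⟩ := exists_weightExp_bound hη ha' hl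
  have hint : kernelISIntegrand M τ σ C C u v = fun p => C.integral fun z => C.integral fun w =>
      weightExp (etaMinus τ) (etaMinus τ * u) p.1 w *
        weightExp (etaMinus τ) (etaMinus τ * v) p.2 z *
        ((etaMinus τ : ℂ) ^ 2 / (4 * Real.pi) * dsKernel (M - N) τ σ z w) := by
    ext p
    rw [kernelISIntegrand, kernelDS_eq, ← Contour.integral_const_mul,
      ← Contour.integral_mul_const]
    congr 1
    ext z
    rw [← Contour.integral_const_mul, ← Contour.integral_mul_const]
    congr 1
    ext w
    rw [weightExp, weightExp]
    ring
  have hμ : (volume.restrict (Ioi (0 : ℝ) ×ˢ Ioi (0 : ℝ)) : Measure (ℝ × ℝ)) =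
      (volume.restrict (Ioi 0)).prod (volume.restrict (Ioi 0)) := by
    rw [Measure.prod_restrict, Measure.volume_eq_prod]
  have hswap := Contour.integral_swap₂ (γ := C) (γ' := C)
    (μ := volume.restrict (Ioi (0 : ℝ) ×ˢ Ioi (0 : ℝ)))
    (F := fun p z w => weightExp (etaMinus τ) (etaMinus τ * u) p.1 w *
        weightExp (etaMinus τ) (etaMinus τ * v) p.2 z *
        ((etaMinus τ : ℂ) ^ 2 / (4 * Real.pi) * dsKernel (M - N) τ σ z w))
    (b := fun p => B' * Real.exp (-δ' * p.1) * (B * Real.exp (-δ * p.2)) * K) ?_ ?_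
    ((ae_restrict_mem (measurableSet_Ioi.prod measurableSet_Ioi)).mono fun p hp z hz w hw => ?_)
  · rw [kernelIS, hint]
    refine ⟨hswap.1, congrArg _ (hswap.2.trans ?_)⟩
    simp only [Contour.inv_integral]
    rw [← Contour.integral_const_mul]
    refine Contour.integral_congr fun z hz => ?_
    have e1 : ∀ X : ℂ, (4 * Real.pi : ℂ) * -(X / z ^ 2) = -(4 * Real.pi / z ^ 2) * X :=
      fun X => by ring
    rw [e1, ← Contour.integral_const_mul]
    refine Contour.integral_congr fun w hw => ?_
    rw [MeasureTheory.integral_mul_const, hμ, integral_prod_mul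
      (fun s => weightExp (etaMinus τ) (etaMinus τ * u) s w)
      (fun t => weightExp (etaMinus τ) (etaMinus τ * v) t z),
      integral_weightExp hη ha (hl.trans_le (hre z hz)),
      integral_weightExp hη ha' (hl.trans_le (hre w hw))]
    exact isKernel_inv hη (hC.subset hz) (hC.subset hw) (hn z hz) (hn w hw)
  · have m1 : Measurable fun q : ((ℝ × ℝ) × ℝ) × ℝ =>
        weightExp (etaMinus τ) (etaMinus τ * u) q.1.1.1 (C.pt q.2) :=
      measurable_weightExp_comp _ _ (measurable_fst.comp (measurable_fst.comp measurable_fst))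
        (C.continuous_pt.measurable.comp measurable_snd)
    have m2 : Measurable fun q : ((ℝ × ℝ) × ℝ) × ℝ =>
        weightExp (etaMinus τ) (etaMinus τ * v) q.1.1.2 (C.pt q.1.2) :=
      measurable_weightExp_comp _ _ (measurable_snd.comp (measurable_fst.comp measurable_fst))
        (C.continuous_pt.measurable.comp (measurable_snd.comp measurable_fst))
    exact (m1.mul m2).mul (measurable_comp_pt₂ hKc)
  · rw [hμ]
    exact (((exp_neg_integrableOn_Ioi 0 hδ').const_mul B').mul_prod
      ((exp_neg_integrableOn_Ioi 0 hδ).const_mul B)).mul_const K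
  · rw [norm_mul, norm_mul]
    have h1 := hb p.2 hp.2 z (hre z hz)
    have h1' := hb' p.1 hp.1 w (hre w hw)
    exact mul_le_mul (mul_le_mul h1' h1 (norm_nonneg _) (by positivity)) (hK (z, w) ⟨hz, hw⟩)
      (norm_nonneg _) (by positivity)

end

end EllipticGinibre

end

open MeasureTheory Set
open Filter Topology Metric

noncomputable section

namespace EllipticGinibre

/-! ### Deformation of the contours -/

section

variable {N : ℕ} {τ : ℝ} {σ : Fin N → ℝ}

lemma Contour.Around.univ {ι : Type*} {a : ι → ℂ} {U : Set ℂ} {Γ : Contour} (h : Γ.Around a U) :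
    Γ.Around a univ :=
  ⟨subset_univ _, h.index_one, fun x hx => absurd (mem_univ x) hx⟩

lemma Contour.Encircles.around_univ {Γ : Contour} {B : Set ℂ}
    (h : Γ.Encircles ({1, -1} ∪ innerPoles τ σ) B) : Γ.Around (ratioInv τ σ) univ :=
  ⟨subset_univ _, fun k => h.inside _ (Or.inr ⟨k, rfl⟩), fun x hx => absurd (mem_univ x) hx⟩

lemma Contour.Encircles.aroundDisc {Γ : Contour} {B : Set ℂ}
    (h : Γ.Encircles ({1, -1} ∪ innerPoles τ σ) B) (hΓ : ∀ z ∈ Γ.trace, 1 < ‖z‖) :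
    Γ.AroundDisc where
  one_lt := hΓ
  index_zero := by
    rw [← (h.inside 1 (by simp)).2, eq_comm]
    exact Contour.index_eq_of_norm_lt fun w hw => by simpa using hΓ w hw

lemma ratioInv_sq_ne_one (hτ : 0 < τ) (hσ : ∀ k, τ < σ k) (k : Fin N) :
    ratioInv τ σ k ^ 2 ≠ 1 := fun h => by
  have h1 : ‖ratioInv τ σ k‖ ^ 2 = 1 := by rw [← norm_pow, h, norm_one]
  nlinarith [norm_ratioInv_lt_one hτ hσ k, norm_nonneg (ratioInv τ σ k)]

lemma prod_ratio_ne_zero (hτ : 0 < τ) (hσ : ∀ k, τ < σ k) : ∏ k, ratio τ σ k ≠ 0 :=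
  Finset.prod_ne_zero_iff.2 fun k _ => ratio_ne_zero hτ hσ k

/-- Each factor is z - a = -z · a · (z⁻¹ - a⁻¹), and the sign (-1)^N is 1. -/
lemma poleProd_ratio (hτ : 0 < τ) (hσ : ∀ k, τ < σ k) (hN : Even N) {z : ℂ} (hz : z ≠ 0) :
    poleProd (ratio τ σ) z =
      (∏ k, ratio τ σ k) * (z ^ N * poleProd (ratioInv τ σ) z⁻¹) := by
  have h : z ^ N = ∏ _k : Fin N, -z := by
    rw [Finset.prod_const, Finset.card_univ, Fintype.card_fin, hN.neg_pow]
  rw [poleProd, poleProd, h, ← Finset.prod_mul_distrib, ← Finset.prod_mul_distrib]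
  refine Finset.prod_congr rfl fun k _ => ?_
  have := ratio_ne_zero hτ hσ k
  rw [← ratio_inv]
  field_simp
  ring

lemma poleProd_ratioInv_one_ne_zero (hτ : 0 < τ) (hσ : ∀ k, τ < σ k) :
    poleProd (ratioInv τ σ) 1 ≠ 0 :=
  poleProd_ne_zero fun k hk => ratioInv_sq_ne_one hτ hσ k (by rw [← hk]; ring)

lemma poleProd_ratioInv_neg_one_ne_zero (hτ : 0 < τ) (hσ : ∀ k, τ < σ k) :
    poleProd (ratioInv τ σ) (-1) ≠ 0 :=
  poleProd_ne_zero fun k hk => ratioInv_sq_ne_one hτ hσ k (by rw [← hk]; ring)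

lemma poleProd_ratio_one (hτ : 0 < τ) (hσ : ∀ k, τ < σ k) (hN : Even N) :
    poleProd (ratio τ σ) 1 = (∏ k, ratio τ σ k) * poleProd (ratioInv τ σ) 1 := by
  rw [poleProd_ratio hτ hσ hN one_ne_zero]
  simp

lemma poleProd_ratio_neg_one (hτ : 0 < τ) (hσ : ∀ k, τ < σ k) (hN : Even N) :
    poleProd (ratio τ σ) (-1) = (∏ k, ratio τ σ k) * poleProd (ratioInv τ σ) (-1) := by
  rw [poleProd_ratio hτ hσ hN (by simp), hN.neg_one_pow, one_mul]
  norm_num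

/-- The numerator ∏ (z - a_k) of `sigmaProdInv` cancels the denominator in the value of the inner
integral. The remaining function of z is singular at most at 0, ±1 and the points τ/σ_k, and no
longer involves `γw`. -/
lemma exists_sKernel_inner (m : ℕ) (hτ : 0 < τ) (hσ : ∀ k, τ < σ k) (u v : ℝ) :
    ∃ (p : Polynomial ℂ) (c : ℂ), ∀ γz γw : Contour, γw.Around (ratio τ σ) cutᶜ →
      (∀ z ∈ γz.trace, z ∉ γw.trace ∧ γw.index z = 0) →
      (γz.integral fun z => γw.integral (sKernel m τ σ u v z)) =
        γz.integral fun z => gFun z (etaMinus τ * v) * (1 / z) ^ m *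
          ((-(z * c) * poleProd (ratio τ σ) z - (1 - z ^ 2) * p.eval z) / ∏ k, ratio τ σ k) /
          poleProd (ratioInv τ σ) z / (1 - z ^ 2) := by
  have hd : DifferentiableOn ℂ (fun w => Complex.exp (-etaMinus τ * u * (w + 1)) /
      sqrtSqSubOne w * w ^ m * revProd (ratio τ σ) w) cutᶜ := by
    refine ((DifferentiableOn.fun_div (by fun_prop) differentiableOn_sqrtSqSubOne
      fun z hz => sqrtSqSubOne_ne_zero hz).fun_mul (by fun_prop)).fun_mul
      differentiable_revProd.differentiableOn
  obtain ⟨p, c, hpc⟩ := Contour.exists_integral_kernel_eq isClosed_cut.isOpen_compl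
    (not_not.2 zero_mem_cut) hd (ratio_notMem_cut hτ hσ)
  refine ⟨p, c, fun γz γw hw hzw => Contour.integral_congr fun z hz => ?_⟩
  have e : γw.integral (sKernel m τ σ u v z) = γw.integral fun w =>
      gFun z (etaMinus τ * v) / (1 - z ^ 2) * (1 / z) ^ m * sigmaProdInv τ σ z *
      (Complex.exp (-etaMinus τ * u * (w + 1)) / sqrtSqSubOne w * w ^ m *
        revProd (ratio τ σ) w / poleProd (ratio τ σ) w * ((1 - z * w) / (w - z))) := by
    congr 1
    ext w
    rw [sKernel, sigmaProd_eq hτ w, div_eq_mul_one_div w z, mul_pow]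
    ring
  have hD : poleProd (ratio τ σ) z ≠ 0 :=
    poleProd_ne_zero (hw.ne_of_index_eq_zero (hzw z hz).2)
  rw [e, Contour.integral_const_mul, hpc γw hw z (hzw z hz).1 (hzw z hz).2,
    sigmaProdInv_eq hτ hσ]
  have h2 : -(z * c) * poleProd (ratio τ σ) z - (1 - z ^ 2) * p.eval z = poleProd (ratio τ σ) z *
      (-(z * c) - (1 - z ^ 2) * (p.eval z / poleProd (ratio τ σ) z)) := by
    field_simp
  rw [h2]
  ring

lemma differentiableOn_div_puncturedDisc {f : ℂ → ℂ} (hf : Differentiable ℂ f) (m : ℕ) :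
    DifferentiableOn ℂ (fun z => f z * (1 / z) ^ m / (1 - z ^ 2)) puncturedDisc := by
  have h1 : DifferentiableOn ℂ (fun z : ℂ => 1 / z) puncturedDisc :=
    DifferentiableOn.fun_div (by fun_prop) (by fun_prop) fun z hz => hz.2
  exact (hf.differentiableOn.fun_mul (h1.fun_pow m)).fun_div (by fun_prop)
    fun z hz => Contour.AroundDisc.one_sub_sq_ne_zero_of_mem_ball hz.1

lemma integral_sKernel_congr (m : ℕ) (hτ : 0 < τ) (hσ : ∀ k, τ < σ k) (u v : ℝ)
    {γz γw γz' γw' : Contour} (hz : γz.Around (ratioInv τ σ) puncturedDisc)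
    (hw : γw.Around (ratio τ σ) cutᶜ) (hzw : ∀ z ∈ γz.trace, z ∉ γw.trace ∧ γw.index z = 0)
    (hz' : γz'.Around (ratioInv τ σ) puncturedDisc) (hw' : γw'.Around (ratio τ σ) cutᶜ)
    (hzw' : ∀ z ∈ γz'.trace, z ∉ γw'.trace ∧ γw'.index z = 0) :
    (γz.integral fun z => γw.integral (sKernel m τ σ u v z)) =
      γz'.integral fun z => γw'.integral (sKernel m τ σ u v z) := by
  obtain ⟨p, c, hpc⟩ := exists_sKernel_inner (σ := σ) m hτ hσ u v
  have hd := differentiableOn_div_puncturedDisc (f := fun z => gFun z (etaMinus τ * v) *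
    ((-(z * c) * poleProd (ratio τ σ) z - (1 - z ^ 2) * p.eval z) / ∏ k, ratio τ σ k)) (by
      have h1 := differentiable_gFun (etaMinus τ * v)
      have h2 := differentiable_poleProd (a := ratio τ σ)
      have h3 := p.differentiable
      fun_prop) m
  obtain ⟨d, hd⟩ := Contour.exists_integral_div_eq isOpen_puncturedDisc zero_notMem_puncturedDisc
    hd (ratioInv_mem hτ hσ)
  rw [hpc γz γw hw hzw, hpc γz' γw' hw' hzw']
  refine Eq.trans ?_ ((hd γz hz).trans ((hd γz' hz').symm.trans ?_))
  · congr 1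
    ext z
    ring
  · congr 1
    ext z
    ring

lemma integral_sKernel_congr_square (hτ : 0 < τ) (hσ : ∀ k, τ < σ k) (hN : Even N) (u v : ℝ)
    {γz γw γz' γw' : Contour} (hz : γz.Around (ratioInv τ σ) univ)
    (h1 : (1 : ℂ) ∉ γz.trace ∧ γz.index 1 = 1) (h2 : (-1 : ℂ) ∉ γz.trace ∧ γz.index (-1) = 1)
    (hw : γw.Around (ratio τ σ) cutᶜ) (hzw : ∀ z ∈ γz.trace, z ∉ γw.trace ∧ γw.index z = 0)
    (hz' : γz'.Around (ratioInv τ σ) univ) (h1' : (1 : ℂ) ∉ γz'.trace ∧ γz'.index 1 = 0)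
    (h2' : (-1 : ℂ) ∉ γz'.trace ∧ γz'.index (-1) = 0) (hw' : γw'.Around (ratio τ σ) cutᶜ)
    (hzw' : ∀ z ∈ γz'.trace, z ∉ γw'.trace ∧ γw'.index z = 0) :
    (γz.integral fun z => γw.integral (sKernel 0 τ σ u v z)) =
      γz'.integral fun z => γw'.integral (sKernel 0 τ σ u v z) := by
  obtain ⟨p, c, hpc⟩ := exists_sKernel_inner (σ := σ) 0 hτ hσ u v
  rw [hpc γz γw hw hzw, hpc γz' γw' hw' hzw']
  simp only [pow_zero, mul_one]
  refine Contour.integral_eq_of_residues_cancel ?_ hz hz' (ratioInv_sq_ne_one hτ hσ) h1 h2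
    h1' h2' ?_
  · have h1 := differentiable_gFun (etaMinus τ * v)
    have h2 := differentiable_poleProd (a := ratio τ σ)
    have h3 := p.differentiable
    fun_prop
  -- At z = ±1 the term with `p` carries the factor 1 - z² = 0. In the other term the sign change of
  -- -zc is compensated by that of g.
  · have hA := prod_ratio_ne_zero hτ hσ
    have d1 := poleProd_ratioInv_one_ne_zero hτ hσ
    have d2 := poleProd_ratioInv_neg_one_ne_zero hτ hσ
    rw [gFun_one, gFun_neg_one, poleProd_ratio_one hτ hσ hN, poleProd_ratio_neg_one hτ hσ hN]
    field_simp
    ring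

lemma integral_isKernel_congr (m : ℕ) (hτ : 0 < τ) (hσ : ∀ k, τ < σ k) (u v : ℝ)
    {γz γw γz' γw' : Contour} (hz : γz.Around (ratioInv τ σ) puncturedDisc)
    (hw : γw.Around (ratioInv τ σ) puncturedDisc)
    (hzw : ∀ z ∈ γz.trace, z⁻¹ ∉ γw.trace ∧ γw.index z⁻¹ = 0)
    (hz' : γz'.Around (ratioInv τ σ) puncturedDisc) (hw' : γw'.Around (ratioInv τ σ) puncturedDisc)
    (hzw' : ∀ z ∈ γz'.trace, z⁻¹ ∉ γw'.trace ∧ γw'.index z⁻¹ = 0) :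
    (γz.integral fun z => γw.integral (isKernel m τ σ u v z)) =
      γz'.integral fun z => γw'.integral (isKernel m τ σ u v z) := by
  have hd := fun s => differentiableOn_div_puncturedDisc (f := fun z => gFun z (etaMinus τ * s) *
    (poleProd (ratio τ σ) z / ∏ k, ratio τ σ k)) (by
      have h1 := differentiable_gFun (etaMinus τ * s)
      have h2 := differentiable_poleProd (a := ratio τ σ)
      fun_prop) m
  obtain ⟨c, hc⟩ := Contour.exists_integral_integral_eq isOpen_puncturedDisc
    zero_notMem_puncturedDisc (hd v) (hd u) (ratioInv_mem hτ hσ) (ratioInv_inv_notMem hτ hσ)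
  refine Eq.trans ?_ ((hc γz γw hz hw hzw).trans ((hc γz' γw' hz' hw' hzw').symm.trans ?_))
  · congr 1
    ext z
    congr 1
    ext w
    rw [isKernel, sigmaProdInv_eq hτ hσ, sigmaProdInv_eq hτ hσ, ← one_div_mul_one_div, mul_pow]
    ring
  · congr 1
    ext z
    congr 1
    ext w
    rw [isKernel, sigmaProdInv_eq hτ hσ, sigmaProdInv_eq hτ hσ, ← one_div_mul_one_div, mul_pow]
    ring

/-- The reversed polynomial: degree below N leaves no negative powers in z^N p(z⁻¹). -/
lemma exists_reverse {p : Polynomial ℂ} (hp : p.degree < N) :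
    ∃ P : ℂ → ℂ, Differentiable ℂ P ∧ ∀ z ≠ 0, P z = z ^ N * p.eval z⁻¹ := by
  rcases eq_or_ne p 0 with rfl | h0
  · exact ⟨fun _ => 0, by fun_prop, by simp⟩
  · refine ⟨fun z => ∑ i ∈ Finset.range N, p.coeff i * z ^ (N - i), by fun_prop, fun z hz => ?_⟩
    rw [Polynomial.eval_eq_sum_range' ((Polynomial.natDegree_lt_iff_degree_lt h0).2 hp),
      Finset.mul_sum]
    refine Finset.sum_congr rfl fun i hi => ?_
    rw [pow_sub₀ z hz (Finset.mem_range.1 hi).le, inv_pow]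
    ring

/-- The inner integrals over the large and the small contour differ only by the residue at w = z⁻¹,
whose outer integral is the skew weight. In the remaining outer integral the residues at ±1 cancel.
-/
lemma integral_isKernel_congr_square (hτ : 0 < τ) (hσ : ∀ k, τ < σ k) (hN : Even N) {u v : ℝ}
    (hu : 0 ≤ etaMinus τ * u) (hv : 0 ≤ etaMinus τ * v)
    {γz γw γ : Contour} (hz : γz.Around (ratioInv τ σ) univ) (hzd : γz.AroundDisc)
    (hw : γw.Around (ratioInv τ σ) univ) (hwd : γw.AroundDisc)
    (hγ : γ.Around (ratioInv τ σ) puncturedDisc) :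
    4 * Real.pi * (γz.integral fun z => γw.integral (isKernel 0 τ σ u v z)) =
      -(weightE (etaMinus τ * u) (etaMinus τ * v) : ℂ) +
        4 * Real.pi * γ.integral fun z => γ.integral (isKernel 0 τ σ u v z) := by
  have hA := prod_ratio_ne_zero hτ hσ
  have d1 := poleProd_ratioInv_one_ne_zero hτ hσ
  have d2 := poleProd_ratioInv_neg_one_ne_zero hτ hσ
  have hg := fun s => differentiable_gFun (etaMinus τ * s)
  have hD := differentiable_poleProd (a := ratio τ σ)
  have hH : Differentiable ℂ fun w => gFun w (etaMinus τ * u) *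
      (poleProd (ratio τ σ) w / ∏ k, ratio τ σ k) := by
    have := hg u
    fun_prop
  obtain ⟨p, r, hdeg, hr, hres⟩ := Contour.exists_residue isOpen_univ hH.differentiableOn
    fun k => mem_univ (ratioInv τ σ k)
  rw [Fintype.card_fin] at hdeg
  obtain ⟨P, hP, hPe⟩ := exists_reverse hdeg
  set A := ∏ k, ratio τ σ k with hAdef
  -- The contribution of w = ±1 to the inner integral over the small contour.
  obtain ⟨c, hc⟩ : ∃ c, c = -(1 / 2) * (p.eval 1 / poleProd (ratioInv τ σ) 1 +
    p.eval (-1) / poleProd (ratioInv τ σ) (-1)) := ⟨_, rfl⟩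
  have hr1 := hr 1 (mem_univ _)
  have hr2 := hr (-1) (mem_univ _)
  rw [gFun_one, poleProd_ratio_one hτ hσ hN, mul_div_cancel_left₀ _ hA] at hr1
  rw [gFun_neg_one, poleProd_ratio_neg_one hτ hσ hN, mul_div_cancel_left₀ _ hA] at hr2
  -- The same contribution over the large contour. The two agree because g(1, ·) + g(-1, ·) = 0 and
  -- the σ-product is 1 at ±1.
  have hc' : c = 1 / 2 * (r 1 + r (-1)) := by
    rw [hc]
    field_simp
    linear_combination poleProd (ratioInv τ σ) (-1) * hr1 + poleProd (ratioInv τ σ) 1 * hr2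
  have hb : ∀ z ∈ γ.trace, ‖z‖ < 1 := fun z hz => by simpa using (hγ.subset hz).1
  have hout : ∀ x : ℂ, 1 ≤ ‖x‖ → x ∉ γ.trace ∧ γ.index x = 0 := fun x hx =>
    ⟨fun h => hx.not_gt (hb x h), Contour.index_eq_zero_of_one_le_norm hb hx⟩
  have hin : ∀ x : ℂ, ‖x‖ ≤ 1 → x ∉ γw.trace ∧ γw.index x = 1 := fun x hx =>
    ⟨hwd.notMem hx, hwd.index_eq_one hx⟩
  have hin' : ∀ x : ℂ, ‖x‖ ≤ 1 → x ∉ γz.trace ∧ γz.index x = 1 := fun x hx =>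
    ⟨hzd.notMem hx, hzd.index_eq_one hx⟩
  have hfac : ∀ (Γ : Contour) (z : ℂ), Γ.integral (isKernel 0 τ σ u v z) =
      gFun z (etaMinus τ * v) / (1 - z ^ 2) *
        (poleProd (ratio τ σ) z / A / poleProd (ratioInv τ σ) z) *
        Γ.integral fun w => gFun w (etaMinus τ * u) * (poleProd (ratio τ σ) w / A) /
          poleProd (ratioInv τ σ) w / (1 - w ^ 2) * ((z - w) / (1 - z * w)) := fun Γ z => by
    rw [← Contour.integral_const_mul]
    congr 1
    ext w
    rw [isKernel, sigmaProdInv_eq hτ hσ, sigmaProdInv_eq hτ hσ, pow_zero]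
    ring
  have hn1 : ‖(1 : ℂ)‖ = 1 := norm_one
  have hn2 : ‖(-1 : ℂ)‖ = 1 := by rw [norm_neg, norm_one]
  have hcont := fun Γ : Contour => hH.continuous.continuousOn (s := Γ.trace)
  have inner_out : ∀ z ∈ γz.trace, γw.integral (isKernel 0 τ σ u v z) =
      gFun z (etaMinus τ * v) * ((c * poleProd (ratio τ σ) z + A * P z) / A) /
        poleProd (ratioInv τ σ) z / (1 - z ^ 2) -
      gFun z (etaMinus τ * v) * gFun z⁻¹ (etaMinus τ * u) / (1 - z ^ 2) := fun z hz' => by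
    have hz0 := hzd.ne_zero hz'
    have hzi : ‖z⁻¹‖ ≤ 1 := by
      rw [norm_inv]
      exact inv_le_one_of_one_le₀ (hzd.one_lt z hz').le
    rw [hfac, Contour.integral_kernel_split (hw.continuousOn_div (hcont γw)) (hin _ hn1.le).1
      (hin _ hn2.le).1 hz0 (hin _ hzi).1,
      (hres γw hw _ (hin _ hn1.le).1).2 (mem_univ _) (hin _ hn1.le).2,
      (hres γw hw _ (hin _ hn2.le).1).2 (mem_univ _) (hin _ hn2.le).2,
      (hres γw hw _ (hin _ hzi).1).2 (mem_univ _) (hin _ hzi).2, ← hc', hPe z hz0]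
    have e1 := hr z⁻¹ (mem_univ _)
    rw [poleProd_ratio hτ hσ hN (inv_ne_zero hz0), inv_inv, inv_pow,
      mul_div_cancel_left₀ _ hA] at e1
    have e2 := poleProd_ratio hτ hσ hN hz0
    have hD' := hz.poleProd_ne_zero hz'
    have hzN := pow_ne_zero N hz0
    -- Reflection z ↦ z⁻¹ exchanges the two pole products up to A and z^N; this isolates g(z⁻¹, η₋u)
    -- from the part with the reversed polynomial `P`.
    have e3 : poleProd (ratio τ σ) z * r z⁻¹ = A * (gFun z⁻¹ (etaMinus τ * u) *
        poleProd (ratioInv τ σ) z - z ^ N * p.eval z⁻¹) := by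
      have e4 : z ^ N * (gFun z⁻¹ (etaMinus τ * u) * ((z ^ N)⁻¹ * poleProd (ratioInv τ σ) z)) =
        gFun z⁻¹ (etaMinus τ * u) * poleProd (ratioInv τ σ) z := by field_simp
      rw [e2]
      linear_combination A * e4 - A * z ^ N * e1
    have hs := hzd.one_sub_sq_ne_zero hz'
    generalize z⁻¹ = y at e3 ⊢
    field_simp
    linear_combination -gFun z (etaMinus τ * v) * e3
  have inner_in : ∀ z ∈ γ.trace, γ.integral (isKernel 0 τ σ u v z) =
      gFun z (etaMinus τ * v) * ((c * poleProd (ratio τ σ) z + A * P z) / A) /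
        poleProd (ratioInv τ σ) z / (1 - z ^ 2) := fun z hz' => by
    have hz0 : z ≠ 0 := (hγ.subset hz').2
    have hzi : 1 ≤ ‖z⁻¹‖ := by
      rw [norm_inv]
      exact (one_le_inv₀ (norm_pos_iff.2 hz0)).2 (hb z hz').le
    have hDi : poleProd (ratioInv τ σ) z⁻¹ ≠ 0 := poleProd_ne_zero fun k hk =>
      (hk ▸ hzi).not_gt (norm_ratioInv_lt_one hτ hσ k)
    rw [hfac, Contour.integral_kernel_split (hγ.continuousOn_div (hcont γ)) (hout _ hn1.ge).1
      (hout _ hn2.ge).1 hz0 (hout _ hzi).1,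
      (hres γ hγ.univ _ (hout _ hn1.ge).1).1 (hout _ hn1.ge).2,
      (hres γ hγ.univ _ (hout _ hn2.ge).1).1 (hout _ hn2.ge).2,
      (hres γ hγ.univ _ (hout _ hzi).1).1 (hout _ hzi).2, hPe z hz0]
    have e1 : 1 / 2 * (-(p.eval 1 / poleProd (ratioInv τ σ) 1) +
        -(p.eval (-1) / poleProd (ratioInv τ σ) (-1))) = c := by
      rw [hc]
      ring
    have e2 := poleProd_ratio hτ hσ hN hz0
    have e3 : poleProd (ratio τ σ) z * (p.eval z⁻¹ / poleProd (ratioInv τ σ) z⁻¹) =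
        A * (z ^ N * p.eval z⁻¹) := by
      rw [e2, ← hAdef]
      generalize z⁻¹ = y at hDi ⊢
      field_simp
    rw [e1, ← e3]
    ring
  have hdiff : Differentiable ℂ fun z =>
      gFun z (etaMinus τ * v) * ((c * poleProd (ratio τ σ) z + A * P z) / A) := by
    have := hg v
    fun_prop
  -- With D the polynomial with roots τ/σ_k, the residue condition reads 2c + p(1)/D(1) +
  -- p(-1)/D(-1) = 0 after removing a common factor, which is the definition of `c`.
  have hcancel := Contour.integral_eq_of_residues_cancel hdiff hz hγ.univ
    (ratioInv_sq_ne_one hτ hσ) (hin' _ hn1.le) (hin' _ hn2.le) (hout _ hn1.ge) (hout _ hn2.ge) (by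
      rw [gFun_one, gFun_neg_one, poleProd_ratio_one hτ hσ hN, poleProd_ratio_neg_one hτ hσ hN,
        hPe 1 one_ne_zero, hPe (-1) (by simp), hN.neg_one_pow, one_pow, inv_one, inv_neg, inv_one,
        hc, ← hAdef]
      field_simp
      ring)
  have hprod : ContinuousOn (fun z => gFun z (etaMinus τ * v) * gFun z⁻¹ (etaMinus τ * u))
      γz.trace :=
    (hg v).continuous.continuousOn.mul (hzd.continuousOn_comp_inv (hg u).continuous)
  rw [Contour.integral_congr inner_out, Contour.integral_congr inner_in, Contour.integral_sub
    (hzd.continuousOn_div (hz.continuousOn_div hdiff.continuous.continuousOn))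
    (hzd.continuousOn_div hprod), hcancel, hzd.weightE_eq hu hv]
  ring

end

end EllipticGinibre

end

/-! ### The theorem -/

open EllipticGinibre
theorem mainTheorem10 (M N : ℕ) (hN : 1 ≤ N) (hNM : N ≤ M) (hM : Even M)
    (τ : ℝ) (hτ : τ ∈ Set.Ioo (0 : ℝ) 1)
    (σ : Fin N → ℝ) (hσ : ∀ k, etaMinus τ / etaPlus τ < σ k)
    (Γ₁ Γ₂ : Contour) (hΓ : DSContours τ σ Γ₁ Γ₂)
    (u v : ℝ) (hu : 0 < u) (hv : 0 < v) :
    -- all the integrals defining `𝓔`, `S_N` and `IS_N` converge absolutely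
    ((∀ a b : ℝ, 0 ≤ a → 0 ≤ b → MeasureTheory.Integrable (weightIntegrand a b)) ∧
      MeasureTheory.IntegrableOn (kernelSIntegrand M τ σ Γ₁ Γ₂ u v) (Set.Ioi 0) ∧
      MeasureTheory.IntegrableOn (kernelISIntegrand M τ σ Γ₁ Γ₂ u v)
        (Set.Ioi 0 ×ˢ Set.Ioi 0)) ∧
    -- the double contour integral for `S_N`
    (∀ Γz Γw : Contour,
      Γz.Encircles (innerPoles τ σ) ({0, 1, -1} ∪ Γw.trace) →
      Γw.Encircles (outerPoles τ σ) (cut ∪ Γz.trace) →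
      (∀ z ∈ Γz.trace, ‖z‖ < 1 ∧ 0 < z.re) → (∀ w ∈ Γw.trace, 1 < ‖w‖) →
      kernelS M τ σ Γ₁ Γ₂ u v =
        (etaMinus τ : ℂ) * Γz.integral fun z => Γw.integral fun w =>
          gFun z (etaMinus τ * v) / (1 - z ^ 2) *
          (Complex.exp (-etaMinus τ * u * (w + 1)) / sqrtSqSubOne w) *
          (w / z) ^ (M - N) * ((1 - z * w) / (w - z)) *
          (sigmaProdInv τ σ z * sigmaProd τ σ w)) ∧
    -- the double contour integral for `IS_N`
    (∀ Γz Γw : Contour,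
      Γz.Encircles (innerPoles τ σ) ({0, 1, -1} ∪ (fun w => w⁻¹) '' Γw.trace) →
      Γw.Encircles (innerPoles τ σ) ({0, 1, -1} ∪ (fun z => z⁻¹) '' Γz.trace) →
      (∀ z ∈ Γz.trace, ‖z‖ < 1 ∧ 0 < z.re) → (∀ w ∈ Γw.trace, ‖w‖ < 1 ∧ 0 < w.re) →
      kernelIS M τ σ Γ₁ Γ₂ u v =
        -(weightE (etaMinus τ * u) (etaMinus τ * v) : ℂ) +
        4 * Real.pi * Γz.integral fun z => Γw.integral fun w =>
          gFun z (etaMinus τ * v) / (1 - z ^ 2) * (gFun w (etaMinus τ * u) / (1 - w ^ 2)) *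
          (1 / (z * w)) ^ (M - N) * ((z - w) / (1 - z * w)) *
          (sigmaProdInv τ σ z * sigmaProdInv τ σ w)) ∧
    -- the square case, where the contours also go around `1` and `-1`
    (M = N →
      (∀ Γz Γw : Contour,
        Γz.Encircles ({1, -1} ∪ innerPoles τ σ) Γw.trace →
        Γw.Encircles (outerPoles τ σ) (cut ∪ Γz.trace) →
        (∀ z ∈ Γz.trace, 1 < ‖z‖) → (∀ w ∈ Γw.trace, 1 < ‖w‖) →
        kernelS M τ σ Γ₁ Γ₂ u v =
          (etaMinus τ : ℂ) * Γz.integral fun z => Γw.integral fun w =>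
            gFun z (etaMinus τ * v) / (1 - z ^ 2) *
            (Complex.exp (-etaMinus τ * u * (w + 1)) / sqrtSqSubOne w) *
            ((1 - z * w) / (w - z)) *
            (sigmaProdInv τ σ z * sigmaProd τ σ w)) ∧
      (∀ Γz Γw : Contour,
        Γz.Encircles ({1, -1} ∪ innerPoles τ σ) ∅ →
        Γw.Encircles ({1, -1} ∪ innerPoles τ σ) ∅ →
        (∀ z ∈ Γz.trace, 1 < ‖z‖) → (∀ w ∈ Γw.trace, 1 < ‖w‖) →
        kernelIS M τ σ Γ₁ Γ₂ u v =
          4 * Real.pi * Γz.integral fun z => Γw.integral fun w =>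
            gFun z (etaMinus τ * v) / (1 - z ^ 2) * (gFun w (etaMinus τ * u) / (1 - w ^ 2)) *
            ((z - w) / (1 - z * w)) *
            (sigmaProdInv τ σ z * sigmaProdInv τ σ w))) := by
  rw [etaMinus_div_etaPlus hτ] at hσ
  obtain ⟨C, l, hl, hC, hre, hout⟩ := exists_outer_contour hN hτ.1 hσ
  have h0 : (0 : ℂ) ∉ C.trace := (hout 0 (by simp)).1
  have hn : ∀ z ∈ C.trace, 1 < ‖z‖ := fun z hz =>
    (hl.trans_le (hre z hz)).trans_le (Complex.re_le_norm z)
  have hCi := hC.inv (fun z hz => hl.trans_le (hre z hz)) hout h0 hτ.1 hσ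
  have hCinv : ∀ z ∈ C.trace, z⁻¹ ∉ C.trace ∧ C.index z⁻¹ = 0 := fun z hz => by
    refine hout _ ((Complex.re_le_norm _).trans ?_)
    rw [norm_inv]
    exact (inv_lt_one_of_one_lt₀ (hn z hz)).le
  have hη := etaMinus_pos hτ
  -- From here on DS_N is taken over the reference circle; absolute convergence for Γ₁, Γ₂ follows
  -- because the integrands are the same functions.
  have hDS : ∀ u v, kernelDS M τ σ Γ₁ Γ₂ u v = kernelDS M τ σ C C u v :=
    kernelDS_congr M hτ.1 hσ hΓ hC hCinv
  have hSI : kernelSIntegrand M τ σ Γ₁ Γ₂ u v = kernelSIntegrand M τ σ C C u v := by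
    ext t
    rw [kernelSIntegrand, hDS, kernelSIntegrand]
  have hISI : kernelISIntegrand M τ σ Γ₁ Γ₂ u v = kernelISIntegrand M τ σ C C u v := by
    ext p
    rw [kernelISIntegrand, hDS, kernelISIntegrand]
  have hS : kernelS M τ σ Γ₁ Γ₂ u v = kernelS M τ σ C C u v := by rw [kernelS, hSI, kernelS]
  have hIS : kernelIS M τ σ Γ₁ Γ₂ u v = kernelIS M τ σ C C u v := by rw [kernelIS, hISI, kernelIS]
  obtain ⟨iS, eS⟩ := kernelS_circle M hτ hl hC hre h0 u hv
  obtain ⟨iIS, eIS⟩ := kernelIS_circle M hτ hl hC hre h0 hu hv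
  have hCb : ∀ z ∈ (C.inv h0).trace, ‖z‖ < 1 := fun z hz => by simpa using (hCi.subset hz).1
  have hCiout : ∀ x : ℂ, 1 ≤ ‖x‖ → x ∉ (C.inv h0).trace ∧ (C.inv h0).index x = 0 := fun x hx =>
    ⟨fun h => hx.not_gt (hCb x h), Contour.index_eq_zero_of_one_le_norm hCb hx⟩
  have hCiC : ∀ z ∈ (C.inv h0).trace, z ∉ C.trace ∧ C.index z = 0 := fun z hz =>
    hout z ((Complex.re_le_norm z).trans (hCb z hz).le)
  have hCiCi : ∀ z ∈ (C.inv h0).trace, z⁻¹ ∉ (C.inv h0).trace ∧ (C.inv h0).index z⁻¹ = 0 :=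
    fun z hz => hCiout _ (by
      rw [norm_inv]
      exact (one_le_inv₀ (norm_pos_iff.2 (hCi.subset hz).2)).2 (hCb z hz).le)
  rw [hSI, hISI, hS, hIS, eS, eIS]
  refine ⟨⟨fun a b => integrable_weightIntegrand, iS, iIS⟩, fun Γz Γw hz hw hzd hwd => ?_,
    fun Γz Γw hz hw hzd hwd => ?_, fun hMN => ⟨fun Γz Γw hz hw hzd hwd => ?_,
    fun Γz Γw hz hw hzd hwd => ?_⟩⟩
  · exact congrArg _ (integral_sKernel_congr (M - N) hτ.1 hσ u v hCi hC hCiC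
      (hz.around_disc fun z h => (hzd z h).1) hw.around_cut
      fun z h => hw.outside z (Or.inr h))
  · exact congrArg (fun x => -(weightE (etaMinus τ * u) (etaMinus τ * v) : ℂ) + 4 * Real.pi * x)
      (integral_isKernel_congr (M - N) hτ.1 hσ u v hCi hCi hCiCi
      (hz.around_disc fun z h => (hzd z h).1) (hw.around_disc fun z h => (hwd z h).1)
      fun z h => hw.outside _ (Or.inr (Set.mem_image_of_mem _ h)))
  -- Now M - N = 0, so the factor with the pole at 0 is gone and the z-contour may go around the
  -- whole disc; M even makes N even.
  · subst hMN
    have h := integral_sKernel_congr_square hτ.1 hσ hM u v hz.around_univ (hz.inside 1 (by simp))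
      (hz.inside (-1) (by simp)) hw.around_cut (fun z h => hw.outside z (Or.inr h)) hCi.univ
      (hCiout 1 (by simp)) (hCiout (-1) (by simp)) hC hCiC
    rw [Nat.sub_self, ← h]
    refine congrArg _ (congrArg _ (funext fun z => congrArg _ (funext fun w => ?_)))
    rw [sKernel, pow_zero, mul_one]
  · subst hMN
    have h := integral_isKernel_congr_square hτ.1 hσ hM (mul_pos hη hu).le (mul_pos hη hv).le
      hz.around_univ (hz.aroundDisc hzd) hw.around_univ (hw.aroundDisc hwd) hCi
    rw [Nat.sub_self, ← h]
    refine congrArg _ (congrArg _ (funext fun z => congrArg _ (funext fun w => ?_)))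
    rw [isKernel, pow_zero, mul_one]
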